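/- Let $\Delta\subset\mathbb{Z}^l$ be the set of all lattice points of a full-dimensional lattice polytope in $\mathbb{R}^l$, and let $w=\{w_m\}_{m\in\Delta}$ be a real-valued convex function on $\Delta$ (it has a supporting affine function at every point of $\Delta$) that determines a simplicial decomposition of $\Delta$: for every affine function $\varphi\le w$ on $\Delta$, the set $\{m\in\Delta:\varphi(m)=w_m\}$ is affinely independent. The nonempty sets of this form are the simplices; let $Z_{\rm top}$ be the set of those with $l+1$ vertices. For $t\in\mathbb{C}^*$, and any choice of $\log t$ used to form $t^{w_m}=e^{w_m\log t}$, let $$X_t=\{z\in(\mathbb{C}^*)^l : s_t(z)=0\},\qquad s_t=\sum_{m\in\Delta}t^{w_m}z^m .$$ For a constant $\kappa>0$ put $$\eta_m=\frac{|t^{w_m}z^m|^2}{\sum_{m'\in\Delta}|t^{w_{m'}}z^{m'}|^2},\qquad a_m=\kappa-\log\eta_m,\qquad h_t=\kappa^2\sum_{S\in Z_{\rm top}}\Big(\prod_{m\in S}a_m\Big)^{-2},$$ and let $g_t$ be the approximate metric on $X_t$, with Kähler form $$\omega_t=\frac{i}{2\pi}\partial\bar\partial\log\Big(h_t\sum_{m\in\Delta}|t^{w_m}z^m|^2\Big)\Big|_{X_t}.$$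 Then there is $\kappa_0>0$ such that for every constant $\kappa\ge\kappa_0$ there is $\delta>0$ with the following properties. For $0<|t|<\delta$, $X_t$ is a smooth hypersurface ($ds_t\neq0$ along $X_t$) and $g_t$ is a positive definite (Kähler) metric on it. Moreover the curvature of $g_t$ and all of its covariant derivatives are bounded uniformly in $t$: for every integer $k\ge0$ there is a constant $C_k$ such that $$|\nabla^k R_{g_t}|_{g_t}\le C_k\quad\text{at every point of } X_t,\ \text{for all } t \text{ with } 0<|t|<\delta .$$ -/

import Mathlib

open scoped ContDiff

noncomputable section

/-! ### Riemannian geometry in a coordinate chart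

A metric on an open subset of `ℝⁿ` is a map `g` sending a point and two vectors to a real number;
a covariant `r`-tensor field is a map sending a point and `r` vectors to a real number. -/

namespace ChartGeometry

variable {n : ℕ}

/-- `koszul g x u v w = (∂_u g(v,w) + ∂_v g(u,w) - ∂_w g(u,v)) / 2` for constant fields `u, v, w`. -/
def koszul (g : (Fin n → ℝ) → (Fin n → ℝ) → (Fin n → ℝ) → ℝ) (x u v w : Fin n → ℝ) : ℝ :=
  (fderiv ℝ (fun y => g y v w) x u + fderiv ℝ (fun y => g y u w) x v
    - fderiv ℝ (fun y => g y u v) x w) / 2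

/-- The Gram matrix `g_{ij}` of the metric in the standard basis. -/
def gram (g : (Fin n → ℝ) → (Fin n → ℝ) → (Fin n → ℝ) → ℝ) (x : Fin n → ℝ) :
    Matrix (Fin n) (Fin n) ℝ :=
  Matrix.of fun i j => g x (Pi.single i 1) (Pi.single j 1)

/-- The Christoffel symbols of the Levi-Civita connection: `Γ(u,v) = Γ^k_{ij} u^i v^j e_k` is the
vector with `g(Γ(u,v), w) = koszul g x u v w` for all `w`. -/
def christoffel (g : (Fin n → ℝ) → (Fin n → ℝ) → (Fin n → ℝ) → ℝ) (x u v : Fin n → ℝ) :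
    Fin n → ℝ :=
  Matrix.mulVec (gram g x)⁻¹ fun k => koszul g x u v (Pi.single k 1)

/-- The curvature `R(u,v)w = ∇_u ∇_v w - ∇_v ∇_u w` for constant fields `u, v, w`. -/
def curvature (g : (Fin n → ℝ) → (Fin n → ℝ) → (Fin n → ℝ) → ℝ) (x u v w : Fin n → ℝ) :
    Fin n → ℝ :=
  fderiv ℝ (fun y => christoffel g y v w) x u - fderiv ℝ (fun y => christoffel g y u w) x v
    + christoffel g x u (christoffel g x v w) - christoffel g x v (christoffel g x u w)

/-- The Riemann tensor as a covariant 4-tensor, `(u,v,w,z) ↦ g(R(u,v)w, z)`. -/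
def riemann (g : (Fin n → ℝ) → (Fin n → ℝ) → (Fin n → ℝ) → ℝ) (x : Fin n → ℝ)
    (v : Fin 4 → Fin n → ℝ) : ℝ :=
  g x (curvature g x (v 0) (v 1) (v 2)) (v 3)

/-- The covariant derivative of a covariant tensor field:
`(∇T)(v₀,v₁,…,v_r) = ∂_{v₀} T(v₁,…,v_r) - ∑ₛ T(v₁,…,Γ(v₀,vₛ),…,v_r)`. -/
def covDeriv (g : (Fin n → ℝ) → (Fin n → ℝ) → (Fin n → ℝ) → ℝ) {r : ℕ}
    (T : (Fin n → ℝ) → (Fin r → Fin n → ℝ) → ℝ) (x : Fin n → ℝ)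
    (v : Fin (r + 1) → Fin n → ℝ) : ℝ :=
  fderiv ℝ (fun y => T y (Fin.tail v)) x (v 0)
    - ∑ s : Fin r, T x (Function.update (Fin.tail v) s (christoffel g x (v 0) (Fin.tail v s)))

/-- The `k`-th covariant derivative `∇ᵏ R` of the Riemann tensor, a covariant `(4+k)`-tensor. -/
def covDerivRiemann (g : (Fin n → ℝ) → (Fin n → ℝ) → (Fin n → ℝ) → ℝ) :
    (k : ℕ) → (Fin n → ℝ) → (Fin (4 + k) → Fin n → ℝ) → ℝ
  | 0 => riemann g
  | k + 1 => covDeriv g (covDerivRiemann g k)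

/-- The covariant tensor `T` at a point with metric `g` has (operator) norm at most `C`:
`|T(v₁,…,v_r)| ≤ C |v₁|_g ⋯ |v_r|_g`. -/
def NormLE (g : (Fin n → ℝ) → (Fin n → ℝ) → ℝ) {r : ℕ} (T : (Fin r → Fin n → ℝ) → ℝ)
    (C : ℝ) : Prop :=
  ∀ v : Fin r → Fin n → ℝ, |T v| ≤ C * ∏ s, Real.sqrt (g (v s) (v s))

end ChartGeometry

/-! ### The degenerating hypersurfaces and the approximate metrics -/

namespace ToricDegeneration

variable {l : ℕ}

/-- A lattice point of `ℤˡ` as a vector of `ℝˡ`. -/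
def toReal (m : Fin l → ℤ) : Fin l → ℝ := fun i => (m i : ℝ)

/-- `Δ` is the set of all lattice points of a full-dimensional lattice polytope in `ℝˡ`. -/
structure IsLatticePolytope (Δ : Finset (Fin l → ℤ)) : Prop where
  mem_of_mem_hull : ∀ m : Fin l → ℤ, toReal m ∈ convexHull ℝ (toReal '' (Δ : Set (Fin l → ℤ))) → m ∈ Δ
  full_dim : affineSpan ℝ (toReal '' (Δ : Set (Fin l → ℤ))) = ⊤

/-- `S` is (the set of lattice points of) a cell of the subdivision of `Δ` determined by `w`: the
nonempty set on which `w` agrees with some affine function `φ` satisfying `φ ≤ w` on `Δ`. -/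
def IsCell (Δ : Finset (Fin l → ℤ)) (w : (Fin l → ℤ) → ℝ) (S : Finset (Fin l → ℤ)) : Prop :=
  S.Nonempty ∧ S ⊆ Δ ∧ ∃ (c : ℝ) (ξ : Fin l → ℝ),
    (∀ m ∈ S, c + ∑ i, ξ i * m i = w m) ∧ ∀ m ∈ Δ, m ∉ S → c + ∑ i, ξ i * m i < w m

/-- The function `w` on the lattice points `Δ` is convex (it has a supporting affine function at each
point of `Δ`) and the subdivision of `Δ` that it determines is simplicial. -/
structure IsConvexSimplicial (Δ : Finset (Fin l → ℤ)) (w : (Fin l → ℤ) → ℝ) : Prop where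
  convex : ∀ m ∈ Δ, ∃ S, IsCell Δ w S ∧ m ∈ S
  simplicial : ∀ S, IsCell Δ w S → AffineIndependent ℝ (fun m : S => toReal m.1)

open Classical in
/-- The top dimensional simplices, i.e. those with `l + 1` vertices. -/
def topSimplices (Δ : Finset (Fin l → ℤ)) (w : (Fin l → ℤ) → ℝ) :
    Finset (Finset (Fin l → ℤ)) :=
  Δ.powerset.filter fun S => IsCell Δ w S ∧ S.card = l + 1

/-- The Laurent monomial `s_m(z) = z^m`. -/
def mono (m : Fin l → ℤ) (z : Fin l → ℂ) : ℂ := ∏ i, z i ^ m i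

/-- The term `t^{w_m} s_m(z)`. The power `t^{w_m} = exp(w_m τ)` is formed with a logarithm `τ` of
`t`. -/
def term (w : (Fin l → ℤ) → ℝ) (τ : ℂ) (m : Fin l → ℤ) (z : Fin l → ℂ) : ℂ :=
  Complex.exp (w m * τ) * mono m z

/-- `s_t = ∑_{m ∈ Δ} t^{w_m} s_m`. -/
def section_t (Δ : Finset (Fin l → ℤ)) (w : (Fin l → ℤ) → ℝ) (τ : ℂ) (z : Fin l → ℂ) : ℂ :=
  ∑ m ∈ Δ, term w τ m z

/-- The hypersurface `X_t = {s_t = 0}` in the complex torus `(ℂ^*)ˡ`. -/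
def X (Δ : Finset (Fin l → ℤ)) (w : (Fin l → ℤ) → ℝ) (τ : ℂ) : Set (Fin l → ℂ) :=
  {z | (∀ i, z i ≠ 0) ∧ section_t Δ w τ z = 0}

/-- `∑_{m ∈ Δ} |t^{w_m} s_m|²`. -/
def sumSq (Δ : Finset (Fin l → ℤ)) (w : (Fin l → ℤ) → ℝ) (τ : ℂ) (z : Fin l → ℂ) : ℝ :=
  ∑ m ∈ Δ, ‖term w τ m z‖ ^ 2

/-- `η_m = |t^{w_m} s_m|² / ∑_{m'} |t^{w_{m'}} s_{m'}|²`. -/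
def eta (Δ : Finset (Fin l → ℤ)) (w : (Fin l → ℤ) → ℝ) (τ : ℂ) (m : Fin l → ℤ)
    (z : Fin l → ℂ) : ℝ :=
  ‖term w τ m z‖ ^ 2 / sumSq Δ w τ z

/-- `a_m = κ - log η_m`. -/
def a (Δ : Finset (Fin l → ℤ)) (w : (Fin l → ℤ) → ℝ) (κ : ℝ) (τ : ℂ) (m : Fin l → ℤ)
    (z : Fin l → ℂ) : ℝ :=
  κ - Real.log (eta Δ w τ m z)

/-- `h_t = κ² ∑_S (∏_{m ∈ S} a_m)⁻²`, the sum over the top dimensional simplices `S`. -/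
def h (Δ : Finset (Fin l → ℤ)) (w : (Fin l → ℤ) → ℝ) (κ : ℝ) (τ : ℂ) (z : Fin l → ℂ) : ℝ :=
  κ ^ 2 * ∑ S ∈ topSimplices Δ w, ((∏ m ∈ S, a Δ w κ τ m z)⁻¹) ^ 2

/-- The Kähler potential `log V_t`, where `V_t = h_t ∑_m Ω_{t,m} ⊗ conj Ω_{t,m}`. On `X_t` one has
`d(s_t/s_m) = ds_t/s_m`, so `Ω_{t,m} = t^{w_m} Ω ⊗ d(s_t/s_m)⁻¹ = t^{w_m} s_m Ω_t` with the nowhere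
vanishing holomorphic section `Ω_t = Ω ⊗ (ds_t)⁻¹` of the canonical bundle; the potential is
`log (V_t / (Ω_t ⊗ conj Ω_t))`. -/
def potential (Δ : Finset (Fin l → ℤ)) (w : (Fin l → ℤ) → ℝ) (κ : ℝ) (τ : ℂ)
    (z : Fin l → ℂ) : ℝ :=
  Real.log (h Δ w κ τ z * sumSq Δ w τ z)

/-- The real (1,1)-form `(i/2π) ∂∂̄Φ` on `ℂˡ`, evaluated on two real tangent vectors, in terms of the
real second derivative of `Φ`. For `l = 1` it is `(Φ_xx + Φ_yy) / (4π) dx ∧ dy`. -/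
def ddbar (Φ : (Fin l → ℂ) → ℝ) (z u v : Fin l → ℂ) : ℝ :=
  (fderiv ℝ (fderiv ℝ Φ) z (Complex.I • u) v - fderiv ℝ (fderiv ℝ Φ) z u (Complex.I • v))
    / (4 * Real.pi)

/-- The Kähler form `ω_t = (i/2π) ∂∂̄ log V_t`; on `X_t` one evaluates it on tangent vectors of `X_t`. -/
def omega (Δ : Finset (Fin l → ℤ)) (w : (Fin l → ℤ) → ℝ) (κ : ℝ) (τ : ℂ)
    (z u v : Fin l → ℂ) : ℝ :=
  ddbar (potential Δ w κ τ) z u v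

/-- The approximate metric `g_t(u,v) = ω_t(u, iv)`; on `X_t` one evaluates it on tangent vectors of
`X_t`. -/
def metric (Δ : Finset (Fin l → ℤ)) (w : (Fin l → ℤ) → ℝ) (κ : ℝ) (τ : ℂ)
    (z u v : Fin l → ℂ) : ℝ :=
  omega Δ w κ τ z u (Complex.I • v)

/-- `X_t` is a smooth complex hypersurface: `ds_t` does not vanish at the points of `X_t`. -/
def SmoothHypersurface (Δ : Finset (Fin l → ℤ)) (w : (Fin l → ℤ) → ℝ) (τ : ℂ) : Prop :=
  ∀ z ∈ X Δ w τ, fderiv ℂ (section_t Δ w τ) z ≠ 0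

/-- `g_t` is positive definite on the tangent spaces `ker ds_t` of `X_t`. -/
def MetricPosDef (Δ : Finset (Fin l → ℤ)) (w : (Fin l → ℤ) → ℝ) (κ : ℝ) (τ : ℂ) : Prop :=
  ∀ z ∈ X Δ w τ, ∀ v : Fin l → ℂ, fderiv ℂ (section_t Δ w τ) z v = 0 → v ≠ 0 →
    0 < metric Δ w κ τ z v v

/-- `ψ` is a smooth local parametrization on the open set `U ⊆ ℝ^{2(l-1)}` of a subset `Y` of `ℂˡ`
(to be used for a smooth complex hypersurface `Y`, whose real dimension is `2(l-1)`). -/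
structure IsLocalParam (Y : Set (Fin l → ℂ)) (U : Set (Fin (2 * (l - 1)) → ℝ))
    (ψ : (Fin (2 * (l - 1)) → ℝ) → Fin l → ℂ) : Prop where
  isOpen : IsOpen U
  smooth : ContDiffOn ℝ ∞ ψ U
  mapsTo : Set.MapsTo ψ U Y
  immersion : ∀ x ∈ U, Function.Injective (fderiv ℝ ψ x)

/-- The metric `g_t` in the local coordinates given by `ψ`, i.e. `ψ^* g_t`. -/
def chartMetric (Δ : Finset (Fin l → ℤ)) (w : (Fin l → ℤ) → ℝ) (κ : ℝ) (τ : ℂ)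
    (ψ : (Fin (2 * (l - 1)) → ℝ) → Fin l → ℂ) (x u v : Fin (2 * (l - 1)) → ℝ) : ℝ :=
  metric Δ w κ τ (ψ x) (fderiv ℝ ψ x u) (fderiv ℝ ψ x v)

/-- The `k`-th covariant derivative of the curvature of `(X_t, g_t)` has norm at most `C` at every
point of `X_t` (computed in any local parametrization of `X_t`). -/
def CurvatureBound (Δ : Finset (Fin l → ℤ)) (w : (Fin l → ℤ) → ℝ) (κ : ℝ) (τ : ℂ) (k : ℕ)
    (C : ℝ) : Prop :=
  ∀ U ψ, IsLocalParam (X Δ w τ) U ψ → ∀ x ∈ U,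
    ChartGeometry.NormLE (chartMetric Δ w κ τ ψ x)
      (ChartGeometry.covDerivRiemann (chartMetric Δ w κ τ ψ) k x) C

end ToricDegeneration

end

/-! Every point of the torus has holomorphic coordinates in which the potential, up to a
pluriharmonic function and a constant, and the defining equation, up to a nowhere zero factor, have
jets bounded independently of `t` and of the point. The metric is bounded below there, and the
hypersurface is a graph with controlled slope. Curvature bounds then follow from the coordinate
formulas and their invariance. No limit as `t → 0` is taken; all constants come from the finite
combinatorics of `Δ` and `w`.

Combinatorics: at a point of the torus, `m ↦ a_m` is at least `κ` and equals `L w_m` plus an affine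
function of `m`, with `L = -2 log |t|`. A greedy choice of vertices (`exists_adapted_simplex`) gives
a top simplex `S` such that `a_m ≤ K a_{m'}` whenever `m ∈ S` has a nonzero barycentric coordinate
at `m'`, and `a_{m'} ≥ ε L` off `S`. Write `z exp(A y)` with `A` chosen so that relative to a base
vertex the exponent of the `i`-th vertex is `a_i y_i` (`exists_model`). All exponents are then
`O(a_m)`, while the normalized terms have size `exp((κ - a_m)/2)`. Each derivative costs one factor
`a_m`, which the exponential absorbs. This bounds the jets of the terms, of the ratios of `a_m` to
its value at the centre, and of the potential (`smoothBdd_u`, `smoothBdd_ratio`,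
`smoothBdd_pot_sub`).

Positivity: convexity of log-sum-exp bounds the second derivative of the potential below by a
weighted average of `2 ∑ (a_m'/a_m)²`, the negative terms being absorbed once `κ ≥ 2(l+1)`
(`secondDeriv_pot`). The adapted simplex has a definite share of the weight, and its vertices
control every coordinate (`exists_coercive`).

Hypersurface: on `X_t` the large base term must be cancelled. For small `t` the terms off `S` are
negligible, so another vertex has a large term and the corresponding partial derivative is bounded
below (`exists_deriv_lower`). Implicit differentiation bounds the jets of the resulting graph
(`smoothBdd_graph`). Bounded jets and coercivity bound `∇ᵏR` in the graph chart (`exists_normLE`),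
and any other local parametrization is compared with it by a local isometry (`exists_graph`,
`IsLocalIsometry.normLE`). -/

noncomputable section

/-! ### Combinatorics of the simplicial subdivision -/

namespace ToricDegeneration

variable {l : ℕ}

/-- The lattice points of `S` are the vertices of a full-dimensional simplex. -/
def IsVertexBasis (S : Finset (Fin l → ℤ)) : Prop :=
  AffineIndependent ℝ (fun m : S => toReal m.1) ∧ S.card = l + 1

theorem affineMap_eq_const_add_sum (φ : (Fin l → ℝ) →ᵃ[ℝ] ℝ) (x : Fin l → ℝ) :
    φ x = φ 0 + ∑ i, φ.linear (Pi.single i 1) * x i := by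
  have h1 : φ x = φ.linear x + φ 0 := by
    have := φ.map_vadd 0 x
    simpa using this
  have h2 : φ.linear x = ∑ i, φ.linear (Pi.single i 1) * x i := by
    conv_lhs => rw [← Finset.univ_sum_single x]
    rw [map_sum]
    refine Finset.sum_congr rfl fun i _ => ?_
    have : (Pi.single i (x i) : Fin l → ℝ) = x i • Pi.single i (1 : ℝ) := by
      rw [← Pi.single_smul]; simp
    rw [this, map_smul, smul_eq_mul, mul_comm]
  rw [h1, h2, add_comm]

/-- The affine function `x ↦ c + ⟨ξ, x⟩`. -/
def affineOf (c : ℝ) (ξ : Fin l → ℝ) : (Fin l → ℝ) →ᵃ[ℝ] ℝ :=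
  AffineMap.const ℝ _ c + (Fintype.linearCombination ℝ ξ).toAffineMap

theorem affineOf_apply (c : ℝ) (ξ x : Fin l → ℝ) : affineOf c ξ x = c + ∑ i, ξ i * x i := by
  simp [affineOf, Fintype.linearCombination_apply, mul_comm]

theorem isCell_iff {Δ : Finset (Fin l → ℤ)} {w : (Fin l → ℤ) → ℝ} {S : Finset (Fin l → ℤ)} :
    IsCell Δ w S ↔ S.Nonempty ∧ S ⊆ Δ ∧ ∃ φ : (Fin l → ℝ) →ᵃ[ℝ] ℝ,
      (∀ m ∈ S, φ (toReal m) = w m) ∧ ∀ m ∈ Δ, m ∉ S → φ (toReal m) < w m := by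
  unfold IsCell
  refine and_congr_right fun _ => and_congr_right fun _ => ⟨?_, ?_⟩
  · rintro ⟨c, ξ, h1, h2⟩
    refine ⟨affineOf c ξ, fun m hm => ?_, fun m hm hmS => ?_⟩
    · rw [affineOf_apply]; exact h1 m hm
    · rw [affineOf_apply]; exact h2 m hm hmS
  · rintro ⟨φ, h1, h2⟩
    refine ⟨φ 0, fun i => φ.linear (Pi.single i 1), fun m hm => ?_, fun m hm hmS => ?_⟩
    · rw [← h1 m hm, affineMap_eq_const_add_sum φ (toReal m)]; rfl
    · have := h2 m hm hmS
      rw [affineMap_eq_const_add_sum φ (toReal m)] at this; exact this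

/-- This is how new cells are produced: move an affine minorant until it touches `w` at a further
point and take its full contact set. -/
theorem isCell_filter_eq {Δ : Finset (Fin l → ℤ)} {w : (Fin l → ℤ) → ℝ}
    (φ : (Fin l → ℝ) →ᵃ[ℝ] ℝ) (hφ : ∀ m ∈ Δ, φ (toReal m) ≤ w m)
    (hne : ∃ m ∈ Δ, φ (toReal m) = w m) :
    IsCell Δ w (Δ.filter fun m => φ (toReal m) = w m) := by
  rw [isCell_iff]
  obtain ⟨m, hm, hm'⟩ := hne
  refine ⟨⟨m, by simp [hm, hm']⟩, Finset.filter_subset _ _, φ, fun m hm => ?_, fun m hm h => ?_⟩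
  · exact (Finset.mem_filter.1 hm).2
  · exact lt_of_le_of_ne (hφ m hm) fun e => h (Finset.mem_filter.2 ⟨hm, e⟩)

/-- Raising the affine function `φ ≤ w` in the direction `lam` until it touches `w` at a new point. -/
theorem exists_first_hit {Δ : Finset (Fin l → ℤ)} {w : (Fin l → ℤ) → ℝ}
    (φ lam : (Fin l → ℝ) →ᵃ[ℝ] ℝ) (hφ : ∀ m ∈ Δ, φ (toReal m) ≤ w m)
    (hlam : ∀ m ∈ Δ, φ (toReal m) = w m → lam (toReal m) ≤ 0)
    (hpos : ∃ m ∈ Δ, 0 < lam (toReal m)) :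
    ∃ ε : ℝ, 0 < ε ∧ (∀ m ∈ Δ, (φ + ε • lam) (toReal m) ≤ w m) ∧
      ∃ n ∈ Δ, 0 < lam (toReal n) ∧ (φ + ε • lam) (toReal n) = w n := by
  obtain ⟨m0, hm0, hm0'⟩ := hpos
  -- The point `m` is reached at time `(w m - φ m) / lam m`. Points with `lam ≤ 0` never obstruct
  -- the motion, so the least of these ratios is the first contact; it is positive because no
  -- contact point of `φ` has `lam > 0`.
  obtain ⟨n, hn, hmin⟩ := Finset.exists_min_image (Δ.filter fun m => 0 < lam (toReal m))
    (fun m => (w m - φ (toReal m)) / lam (toReal m)) ⟨m0, by simp [hm0, hm0']⟩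
  rw [Finset.mem_filter] at hn
  obtain ⟨hnΔ, hnpos⟩ := hn
  have hlt : φ (toReal n) < w n :=
    lt_of_le_of_ne (hφ n hnΔ) fun e => absurd (hlam n hnΔ e) (not_le.2 hnpos)
  refine ⟨(w n - φ (toReal n)) / lam (toReal n), div_pos (by linarith) hnpos, fun m hm => ?_,
    n, hnΔ, hnpos, ?_⟩
  · have hε : 0 < (w n - φ (toReal n)) / lam (toReal n) := div_pos (by linarith) hnpos
    simp only [AffineMap.coe_add, AffineMap.coe_smul, Pi.add_apply, Pi.smul_apply, smul_eq_mul]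
    by_cases h : 0 < lam (toReal m)
    · have h1 := hmin m (Finset.mem_filter.2 ⟨hm, h⟩)
      rw [le_div_iff₀ h] at h1
      linarith
    · have := mul_nonpos_of_nonneg_of_nonpos hε.le (not_lt.1 h)
      linarith [hφ m hm]
  · simp only [AffineMap.coe_add, AffineMap.coe_smul, Pi.add_apply, Pi.smul_apply, smul_eq_mul]
    field_simp
    ring

theorem card_le_of_affineIndependent {S : Finset (Fin l → ℤ)}
    (h : AffineIndependent ℝ (fun m : S => toReal m.1)) : S.card ≤ l + 1 := by
  have := h.card_le_finrank_succ
  have h2 := Submodule.finrank_le (vectorSpan ℝ (Set.range fun m : S => toReal m.1))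
  simp only [Fintype.card_coe, Module.finrank_fin_fun] at this h2
  omega

/-- A point outside an affine span is separated from it by an affine function. -/
theorem exists_affineMap_separating {s : Set (Fin l → ℝ)} {p x : Fin l → ℝ} (hp : p ∈ s)
    (hx : x ∉ affineSpan ℝ s) : ∃ f : (Fin l → ℝ) →ᵃ[ℝ] ℝ, (∀ y ∈ s, f y = 0) ∧ 0 < f x := by
  have h1 : x - p ∉ (affineSpan ℝ s).direction := by
    intro h
    apply hx
    have := AffineSubspace.vadd_mem_of_mem_direction h (mem_affineSpan ℝ hp)
    simpa using this
  obtain ⟨f, hf, hle⟩ := Submodule.exists_le_ker_of_notMem h1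
  let g : (Fin l → ℝ) →ᵃ[ℝ] ℝ := f.toAffineMap - AffineMap.const ℝ _ (f p)
  have hg : ∀ y, g y = f (y - p) := fun y => by simp [g]
  refine ⟨(f (x - p)) • g, fun y hy => ?_, ?_⟩
  · have : f (y - p) = 0 := by
      apply hle
      exact AffineSubspace.vsub_mem_direction (mem_affineSpan ℝ hy) (mem_affineSpan ℝ hp)
    simp [hg, -map_sub, this]
  · simp only [AffineMap.coe_smul, Pi.smul_apply, smul_eq_mul, hg]
    exact mul_self_pos.2 hf

theorem mem_topSimplices {Δ : Finset (Fin l → ℤ)} {w : (Fin l → ℤ) → ℝ}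
    {S : Finset (Fin l → ℤ)} : S ∈ topSimplices Δ w ↔ IsCell Δ w S ∧ S.card = l + 1 := by
  classical
  simp only [topSimplices, Finset.mem_filter, Finset.mem_powerset]
  exact ⟨fun h => h.2, fun h => ⟨h.1.2.1, h⟩⟩

theorem isVertexBasis_of_mem {Δ : Finset (Fin l → ℤ)} {w : (Fin l → ℤ) → ℝ}
    (hw : IsConvexSimplicial Δ w) {S : Finset (Fin l → ℤ)} (hS : S ∈ topSimplices Δ w) :
    IsVertexBasis S :=
  ⟨hw.simplicial S (mem_topSimplices.1 hS).1, (mem_topSimplices.1 hS).2⟩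

theorem nonempty_of_isLatticePolytope {Δ : Finset (Fin l → ℤ)} (hΔ : IsLatticePolytope Δ) :
    Δ.Nonempty := by
  rw [Finset.nonempty_iff_ne_empty]
  rintro rfl
  have := hΔ.full_dim
  simp at this

/-- A cell of maximal cardinality must span. Otherwise some affine function vanishes on it and is
positive at a point of `Δ`; adding it to the supporting function until the first contact keeps the
old vertices and gains one. Spanning and affine independence give `l + 1` vertices. -/
theorem topSimplices_nonempty {Δ : Finset (Fin l → ℤ)} {w : (Fin l → ℤ) → ℝ}
    (hΔ : IsLatticePolytope Δ) (hw : IsConvexSimplicial Δ w) : (topSimplices Δ w).Nonempty := by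
  classical
  obtain ⟨m0, hm0⟩ := nonempty_of_isLatticePolytope hΔ
  obtain ⟨S0, hS0, -⟩ := hw.convex m0 hm0
  obtain ⟨S, hS, hmax⟩ := Finset.exists_max_image (Δ.powerset.filter fun S => IsCell Δ w S)
    Finset.card ⟨S0, by simp [hS0, hS0.2.1]⟩
  have hcell : IsCell Δ w S := (Finset.mem_filter.1 hS).2
  refine ⟨S, mem_topSimplices.2 ⟨hcell, ?_⟩⟩
  have hind := hw.simplicial S hcell
  by_contra hne
  obtain ⟨⟨p, hp⟩, hSΔ, φ, hφ1, hφ2⟩ := isCell_iff.1 hcell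
  have hspan : ¬ ∀ m ∈ Δ, toReal m ∈ affineSpan ℝ (toReal '' (S : Set (Fin l → ℤ))) := by
    intro hall
    have htop : affineSpan ℝ (toReal '' (S : Set (Fin l → ℤ))) = ⊤ := by
      rw [eq_top_iff, ← hΔ.full_dim, affineSpan_le]
      rintro _ ⟨m, hm, rfl⟩
      exact hall m hm
    have := hind.affineSpan_eq_top_iff_card_eq_finrank_add_one.1
      (by rw [← htop]; congr 1; ext; simp)
    simp at this
    exact hne this
  push Not at hspan
  obtain ⟨m1, hm1, hm1S⟩ := hspan
  obtain ⟨f, hf0, hf1⟩ := exists_affineMap_separating (s := toReal '' (S : Set (Fin l → ℤ)))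
    ⟨p, hp, rfl⟩ hm1S
  have hle : ∀ m ∈ Δ, φ (toReal m) ≤ w m := fun m hm => by
    by_cases h : m ∈ S
    · exact (hφ1 m h).le
    · exact (hφ2 m hm h).le
  have hact : ∀ m ∈ Δ, φ (toReal m) = w m → m ∈ S := fun m hm e => by
    by_contra h
    exact absurd e (hφ2 m hm h).ne
  obtain ⟨ε, hε, hle', n, hn, hnpos, hneq⟩ := exists_first_hit φ f hle
    (fun m hm e => (hf0 _ ⟨m, hact m hm e, rfl⟩).le) ⟨m1, hm1, hf1⟩
  have hcell' := isCell_filter_eq (φ + ε • f) hle' ⟨n, hn, hneq⟩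
  have hcard := hmax _ (Finset.mem_filter.2 ⟨Finset.mem_powerset.2 hcell'.2.1, hcell'⟩)
  have hss : S ⊂ Δ.filter fun m => (φ + ε • f) (toReal m) = w m := by
    rw [Finset.ssubset_iff_of_subset]
    · refine ⟨n, by simp only [Finset.mem_filter]; exact ⟨hn, hneq⟩, fun h => ?_⟩
      exact absurd (hf0 _ ⟨n, h, rfl⟩) hnpos.ne'
    · intro m hm
      have h0 := hf0 _ ⟨m, hm, rfl⟩
      simp only [Finset.mem_filter]
      refine ⟨hSΔ hm, ?_⟩
      simp [h0, hφ1 m hm]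
  exact absurd (Finset.card_lt_card hss) (not_lt.2 hcard)

theorem exists_bary {S : Finset (Fin l → ℤ)} (hS : IsVertexBasis S) :
    ∃ lam : (Fin l → ℤ) → ((Fin l → ℝ) →ᵃ[ℝ] ℝ),
      (∀ m ∈ S, ∀ n ∈ S, lam m (toReal n) = if m = n then 1 else 0) ∧
      ∀ (f : (Fin l → ℝ) →ᵃ[ℝ] ℝ) (x : Fin l → ℝ), f x = ∑ m ∈ S, lam m x * f (toReal m) := by
  classical
  let b : AffineBasis S ℝ (Fin l → ℝ) :=
    ⟨fun m => toReal m.1, hS.1, by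
      rw [hS.1.affineSpan_eq_top_iff_card_eq_finrank_add_one]; simp [hS.2]⟩
  refine ⟨fun m => if h : m ∈ S then b.coord ⟨m, h⟩ else 0, fun m hm n hn => ?_, fun f x => ?_⟩
  · have h1 : b.coord ⟨m, hm⟩ (toReal n) = _ := b.coord_apply ⟨m, hm⟩ ⟨n, hn⟩
    simp only [hm, dite_true]
    rw [h1]
    simp
  · rw [← Finset.sum_attach]
    simp only [Finset.coe_mem, dite_true]
    conv_lhs => rw [← b.affineCombination_coord_eq_self x]
    rw [Finset.map_affineCombination _ _ _ (b.sum_coord_apply_eq_one x),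
      Finset.affineCombination_eq_linear_combination _ _ _ (b.sum_coord_apply_eq_one x)]
    rfl

open Classical in
/-- The barycentric coordinate functions of the simplex with vertices `S`, as affine functions. -/
def bary (S : Finset (Fin l → ℤ)) : (Fin l → ℤ) → ((Fin l → ℝ) →ᵃ[ℝ] ℝ) :=
  if h : IsVertexBasis S then (exists_bary h).choose else 0

theorem bary_apply {S : Finset (Fin l → ℤ)} (hS : IsVertexBasis S) {m n : Fin l → ℤ} (hm : m ∈ S)
    (hn : n ∈ S) : bary S m (toReal n) = if m = n then 1 else 0 := by
  rw [bary, dif_pos hS]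
  exact (exists_bary hS).choose_spec.1 m hm n hn

theorem eq_sum_bary {S : Finset (Fin l → ℤ)} (hS : IsVertexBasis S)
    (f : (Fin l → ℝ) →ᵃ[ℝ] ℝ) (x : Fin l → ℝ) :
    f x = ∑ m ∈ S, bary S m x * f (toReal m) := by
  rw [bary, dif_pos hS]
  exact (exists_bary hS).choose_spec.2 f x

theorem sum_bary {S : Finset (Fin l → ℤ)} (hS : IsVertexBasis S) (x : Fin l → ℝ) :
    ∑ m ∈ S, bary S m x = 1 := by
  simpa using (eq_sum_bary hS (AffineMap.const ℝ _ 1) x).symm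

/-- The affine function that agrees with `w` on the vertices of `S`. -/
def interp (w : (Fin l → ℤ) → ℝ) (S : Finset (Fin l → ℤ)) : (Fin l → ℝ) →ᵃ[ℝ] ℝ :=
  ∑ m ∈ S, w m • bary S m

theorem interp_apply (w : (Fin l → ℤ) → ℝ) (S : Finset (Fin l → ℤ)) (x : Fin l → ℝ) :
    interp w S x = ∑ m ∈ S, bary S m x * w m := by
  have key : ∀ s : Finset (Fin l → ℤ),
      (∑ m ∈ s, w m • bary S m) x = ∑ m ∈ s, bary S m x * w m := by
    intro s
    induction s using Finset.induction_on with
    | empty => simp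
    | insert a s ha ih => simp [Finset.sum_insert ha, ih, mul_comm]
  exact key S

theorem interp_eq {S : Finset (Fin l → ℤ)} (hS : IsVertexBasis S) {w : (Fin l → ℤ) → ℝ}
    {φ : (Fin l → ℝ) →ᵃ[ℝ] ℝ} (h : ∀ m ∈ S, φ (toReal m) = w m) (x : Fin l → ℝ) :
    interp w S x = φ x := by
  rw [interp_apply, eq_sum_bary hS φ x]
  exact Finset.sum_congr rfl fun m hm => by rw [h m hm]

theorem interp_of_mem {S : Finset (Fin l → ℤ)} (hS : IsVertexBasis S) {w : (Fin l → ℤ) → ℝ}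
    {m : Fin l → ℤ} (hm : m ∈ S) : interp w S (toReal m) = w m := by
  rw [interp_apply, Finset.sum_eq_single m]
  · simp [bary_apply hS hm hm]
  · intro n hn hne; simp [bary_apply hS hn hm, hne]
  · exact fun h => absurd hm h

theorem interp_lt {Δ : Finset (Fin l → ℤ)} {w : (Fin l → ℤ) → ℝ}
    (hw : IsConvexSimplicial Δ w) {S : Finset (Fin l → ℤ)} (hS : S ∈ topSimplices Δ w)
    {m : Fin l → ℤ} (hm : m ∈ Δ) (hmS : m ∉ S) : interp w S (toReal m) < w m := by
  obtain ⟨-, -, φ, h1, h2⟩ := isCell_iff.1 (mem_topSimplices.1 hS).1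
  rw [interp_eq (isVertexBasis_of_mem hw hS) h1]
  exact h2 m hm hmS

theorem interp_le {Δ : Finset (Fin l → ℤ)} {w : (Fin l → ℤ) → ℝ}
    (hw : IsConvexSimplicial Δ w) {S : Finset (Fin l → ℤ)} (hS : S ∈ topSimplices Δ w)
    {m : Fin l → ℤ} (hm : m ∈ Δ) : interp w S (toReal m) ≤ w m := by
  by_cases h : m ∈ S
  · exact (interp_of_mem (isVertexBasis_of_mem hw hS) h).le
  · exact (interp_lt hw hS hm h).le

/-- Among the top simplices containing `F` there is one that, seen from `F`, contains the direction
of `m'`. -/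
theorem exists_top_bary_nonneg {Δ : Finset (Fin l → ℤ)} {w : (Fin l → ℤ) → ℝ}
    (hw : IsConvexSimplicial Δ w) {F S₀ : Finset (Fin l → ℤ)}
    (hS₀ : S₀ ∈ topSimplices Δ w) (hF : F ⊆ S₀) {m' : Fin l → ℤ} (hm' : m' ∈ Δ) :
    ∃ S ∈ topSimplices Δ w, F ⊆ S ∧ ∀ p ∈ S, p ∉ F → 0 ≤ bary S p (toReal m') := by
  classical
  -- Choose `S` with the largest interpolated value at `m'`. If the coordinate of some `p ∉ F` were
  -- negative at `m'`, crossing the facet opposite `p`, by raising the supporting function along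
  -- `-bary S p`, would give another top simplex containing `F` with a larger value there.
  obtain ⟨S, hS, hmax⟩ := Finset.exists_max_image ((topSimplices Δ w).filter fun S => F ⊆ S)
    (fun S => interp w S (toReal m')) ⟨S₀, by simp [hS₀, hF]⟩
  rw [Finset.mem_filter] at hS
  obtain ⟨hS, hFS⟩ := hS
  refine ⟨S, hS, hFS, fun p hp hpF => ?_⟩
  by_contra hneg
  push Not at hneg
  have hb := isVertexBasis_of_mem hw hS
  have hact : ∀ m ∈ Δ, interp w S (toReal m) = w m → m ∈ S := fun m hm e => by
    by_contra h
    exact absurd e (interp_lt hw hS hm h).ne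
  obtain ⟨ε, hε, hle', n, hn, hnpos, hneq⟩ := exists_first_hit (interp w S) (-(bary S p))
    (fun m hm => interp_le hw hS hm)
    (fun m hm e => by
      have := bary_apply hb hp (hact m hm e)
      simp only [AffineMap.coe_neg, Pi.neg_apply, this]
      split_ifs <;> norm_num)
    ⟨m', hm', by simpa using hneg⟩
  set φ := interp w S + ε • (-(bary S p)) with hφ
  have hcell' := isCell_filter_eq φ hle' ⟨n, hn, hneq⟩
  set S' := Δ.filter fun m => φ (toReal m) = w m with hS'
  have hSΔ : S ⊆ Δ := (mem_topSimplices.1 hS).1.2.1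
  have hsub : insert n (S.erase p) ⊆ S' := by
    intro m hm
    rw [hS', Finset.mem_filter]
    rcases Finset.mem_insert.1 hm with rfl | hm
    · exact ⟨hn, hneq⟩
    · have hmS := Finset.mem_of_mem_erase hm
      refine ⟨hSΔ hmS, ?_⟩
      have := bary_apply hb hp hmS
      rw [if_neg (Finset.ne_of_mem_erase hm).symm] at this
      simp [hφ, this, interp_of_mem hb hmS]
  have hnS : n ∉ S.erase p := by
    intro h
    have := bary_apply hb hp (Finset.mem_of_mem_erase h)
    rw [if_neg (Finset.ne_of_mem_erase h).symm] at this
    simp [this] at hnpos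
  have hcard : S'.card = l + 1 := by
    apply le_antisymm (card_le_of_affineIndependent (hw.simplicial _ hcell'))
    have := Finset.card_le_card hsub
    rw [Finset.card_insert_of_notMem hnS, Finset.card_erase_of_mem hp, hb.2] at this
    simpa using this
  have hS'top : S' ∈ topSimplices Δ w := mem_topSimplices.2 ⟨hcell', hcard⟩
  have hFS' : F ⊆ S' := fun m hm => hsub (Finset.mem_insert_of_mem
    (Finset.mem_erase.2 ⟨fun e => hpF (e ▸ hm), hFS hm⟩))
  have h1 := hmax S' (Finset.mem_filter.2 ⟨hS'top, hFS'⟩)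
  rw [interp_eq (isVertexBasis_of_mem hw hS'top)
    (φ := φ) (fun m hm => (Finset.mem_filter.1 hm).2)] at h1
  simp only [hφ, AffineMap.coe_add, AffineMap.coe_smul, AffineMap.coe_neg, Pi.add_apply,
    Pi.smul_apply, Pi.neg_apply, smul_eq_mul] at h1
  nlinarith

/-- `m'` is separated from the affine span of `G`. -/
def Sep (G : Finset (Fin l → ℤ)) (m' : Fin l → ℤ) : Prop :=
  ∃ f : (Fin l → ℝ) →ᵃ[ℝ] ℝ, (∀ m ∈ G, f (toReal m) = 0) ∧ f (toReal m') ≠ 0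

theorem Sep.mono {G H : Finset (Fin l → ℤ)} {m' : Fin l → ℤ} (h : Sep H m') (hGH : G ⊆ H) :
    Sep G m' := by
  obtain ⟨f, h1, h2⟩ := h
  exact ⟨f, fun m hm => h1 m (hGH hm), h2⟩

/-- Uniform bounds for the barycentric coordinates of the points of `Δ`. -/
theorem exists_bary_bounds (Δ : Finset (Fin l → ℤ)) (w : (Fin l → ℤ) → ℝ) :
    ∃ B c : ℝ, 0 < B ∧ 0 < c ∧ ∀ S ∈ topSimplices Δ w, ∀ m ∈ S, ∀ m' ∈ Δ,
      |bary S m (toReal m')| ≤ B ∧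
        (bary S m (toReal m') ≠ 0 → c ≤ |bary S m (toReal m')|) := by
  classical
  let I := (topSimplices Δ w) ×ˢ (Δ ×ˢ Δ)
  let v : Finset (Fin l → ℤ) × ((Fin l → ℤ) × (Fin l → ℤ)) → ℝ :=
    fun q => |bary q.1 q.2.1 (toReal q.2.2)|
  have hsum : ∀ q ∈ I, v q ≤ ∑ q ∈ I, v q :=
    fun q hq => Finset.single_le_sum (f := v) (fun _ _ => abs_nonneg _) hq
  have hc : ∃ c : ℝ, 0 < c ∧ ∀ q ∈ I, v q ≠ 0 → c ≤ v q := by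
    generalize I = J
    induction J using Finset.induction_on with
    | empty => exact ⟨1, one_pos, by simp⟩
    | insert a s _ ih =>
      obtain ⟨c, hc, h⟩ := ih
      by_cases h0 : v a = 0
      · refine ⟨c, hc, fun q hq hne => ?_⟩
        rcases Finset.mem_insert.1 hq with rfl | hq
        · exact absurd h0 hne
        · exact h q hq hne
      · refine ⟨min c (v a), lt_min hc (lt_of_le_of_ne (abs_nonneg _) (Ne.symm h0)),
          fun q hq hne => ?_⟩
        rcases Finset.mem_insert.1 hq with rfl | hq
        · exact min_le_right _ _
        · exact (min_le_left _ _).trans (h q hq hne)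
  obtain ⟨c, hc, hc'⟩ := hc
  have hB : 0 ≤ ∑ q ∈ I, v q := Finset.sum_nonneg fun _ _ => abs_nonneg _
  refine ⟨∑ q ∈ I, v q + 1, c, by linarith, hc, fun S hS m hm m' hm' => ?_⟩
  have hmem : (S, (m, m')) ∈ I := by
    simp only [I, Finset.mem_product]
    exact ⟨hS, (mem_topSimplices.1 hS).1.2.1 hm, hm'⟩
  exact ⟨(hsum _ hmem).trans (by linarith), fun hne => hc' _ hmem (abs_ne_zero.2 hne)⟩

/-- Barycentric interpolation reproduces the affine part of `α` exactly, so only the convexity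
defect of `w`, scaled by `L`, remains. This defect is nonnegative on `Δ` and bounded below off `S`.
-/
theorem sum_bary_mul_le {Δ : Finset (Fin l → ℤ)} {w : (Fin l → ℤ) → ℝ}
    (hw : IsConvexSimplicial Δ w) {S : Finset (Fin l → ℤ)} (hS : S ∈ topSimplices Δ w)
    {L : ℝ} {f : (Fin l → ℝ) →ᵃ[ℝ] ℝ} {α : (Fin l → ℤ) → ℝ}
    (hα : ∀ m ∈ Δ, α m = L * w m + f (toReal m)) {m' : Fin l → ℤ} (hm' : m' ∈ Δ) :
    α m' = ∑ m ∈ S, bary S m (toReal m') * α m + L * (w m' - interp w S (toReal m')) := by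
  have hSΔ : S ⊆ Δ := (mem_topSimplices.1 hS).1.2.1
  have h1 : ∑ m ∈ S, bary S m (toReal m') * α m
      = L * interp w S (toReal m') + f (toReal m') := by
    rw [interp_apply, eq_sum_bary (isVertexBasis_of_mem hw hS) f, Finset.mul_sum,
      ← Finset.sum_add_distrib]
    exact Finset.sum_congr rfl fun m hm => by rw [hα m (hSΔ hm)]; ring
  rw [h1, hα m' hm']; ring

/-- Greedy construction of partial simplices adapted to a nonnegative function `α` with the same
subdivision as `w`. -/
theorem exists_adapted_face {Δ : Finset (Fin l → ℤ)} {w : (Fin l → ℤ) → ℝ}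
    (hΔ : IsLatticePolytope Δ) (hw : IsConvexSimplicial Δ w) (j : ℕ) (hj : j ≤ l + 1) :
    ∃ K : ℝ, 0 < K ∧ ∀ (L : ℝ) (f : (Fin l → ℝ) →ᵃ[ℝ] ℝ) (α : (Fin l → ℤ) → ℝ), 0 ≤ L →
      (∀ m ∈ Δ, α m = L * w m + f (toReal m)) → (∀ m ∈ Δ, 0 ≤ α m) →
      ∃ F : Finset (Fin l → ℤ), F.card = j ∧ (∃ S ∈ topSimplices Δ w, F ⊆ S) ∧
        ∀ m ∈ F, ∀ m' ∈ Δ, Sep (F.erase m) m' → α m ≤ K * α m' := by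
  classical
  induction j with
  | zero =>
    refine ⟨1, one_pos, fun L f α _ _ _ => ⟨∅, rfl, ?_, by simp⟩⟩
    obtain ⟨S, hS⟩ := topSimplices_nonempty hΔ hw
    exact ⟨S, hS, by simp⟩
  | succ j ih =>
    obtain ⟨K, hK, ih⟩ := ih (by omega)
    obtain ⟨B, c, hB, hc, hbd⟩ := exists_bary_bounds Δ w
    set K' := (1 + B * K * j) / c with hK'
    have hK'pos : 0 < K' := by positivity
    refine ⟨max K K', lt_max_of_lt_left hK, fun L f α hL hα hα0 => ?_⟩
    obtain ⟨F, hFc, ⟨S₀, hS₀, hFS₀⟩, hF⟩ := ih L f α hL hα hα0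
    have hlt : F.card < S₀.card := by rw [hFc, (mem_topSimplices.1 hS₀).2]; omega
    obtain ⟨p₀, hp₀, hp₀F⟩ := Finset.exists_mem_notMem_of_card_lt_card hlt
    have hb₀ := isVertexBasis_of_mem hw hS₀
    have hsep₀ : Sep F p₀ := ⟨bary S₀ p₀, fun m hm => by
      rw [bary_apply hb₀ hp₀ (hFS₀ hm), if_neg]; rintro rfl; exact hp₀F hm,
      by rw [bary_apply hb₀ hp₀ hp₀]; simp⟩
    -- Greedy choice: `m'` has least `α` outside the affine span of `F`. It need not extend `F` to a
    -- face of the subdivision, so it is replaced by a vertex `p` of a simplex that contains `F` and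
    -- points towards `m'`.
    obtain ⟨m', hm', hmin⟩ := Finset.exists_min_image (Δ.filter fun m => Sep F m) α
      ⟨p₀, Finset.mem_filter.2 ⟨(mem_topSimplices.1 hS₀).1.2.1 hp₀, hsep₀⟩⟩
    rw [Finset.mem_filter] at hm'
    obtain ⟨hm'Δ, hsep⟩ := hm'
    obtain ⟨S, hS, hFS, hnn⟩ := exists_top_bary_nonneg hw hS₀ hFS₀ hm'Δ
    have hb := isVertexBasis_of_mem hw hS
    have hSΔ : S ⊆ Δ := (mem_topSimplices.1 hS).1.2.1
    have hp : ∃ p ∈ S, p ∉ F ∧ bary S p (toReal m') ≠ 0 := by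
      by_contra hcon
      push Not at hcon
      obtain ⟨g, hg, hg'⟩ := hsep
      apply hg'
      rw [eq_sum_bary hb g]
      refine Finset.sum_eq_zero fun m hm => ?_
      by_cases h : m ∈ F
      · rw [hg m h, mul_zero]
      · rw [hcon m hm h, zero_mul]
    obtain ⟨p, hpS, hpF, hpne⟩ := hp
    -- In the interpolation identity for `α m'`, the defect and the other vertices outside `F`
    -- contribute nonnegatively, while the `j` vertices of `F` contribute at least `-B K α m'` each.
    -- Hence `c α p ≤ (1 + B K j) α m'`, which explains `K'`.
    have hαp : α p ≤ K' * α m' := by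
      have e := sum_bary_mul_le hw hS hα hm'Δ
      have h0 : 0 ≤ L * (w m' - interp w S (toReal m')) :=
        mul_nonneg hL (by linarith [interp_le hw hS hm'Δ])
      have h1 : ∑ m ∈ S, bary S m (toReal m') * α m =
          ∑ m ∈ F, bary S m (toReal m') * α m + ∑ m ∈ S \ F, bary S m (toReal m') * α m := by
        rw [add_comm, Finset.sum_sdiff hFS]
      have h2 : bary S p (toReal m') * α p ≤ ∑ m ∈ S \ F, bary S m (toReal m') * α m := by
        refine Finset.single_le_sum (f := fun m => bary S m (toReal m') * α m)
          (fun m hm => ?_) (Finset.mem_sdiff.2 ⟨hpS, hpF⟩)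
        rw [Finset.mem_sdiff] at hm
        exact mul_nonneg (hnn m hm.1 hm.2) (hα0 m (hSΔ hm.1))
      have h3 : -(B * K * j * α m') ≤ ∑ m ∈ F, bary S m (toReal m') * α m := by
        have : ∑ m ∈ F, -(B * (K * α m')) ≤ ∑ m ∈ F, bary S m (toReal m') * α m := by
          refine Finset.sum_le_sum fun m hm => ?_
          have ha : α m ≤ K * α m' := hF m hm m' hm'Δ (hsep.mono (Finset.erase_subset _ _))
          have hb1 := (hbd S hS m (hFS hm) m' hm'Δ).1
          have : |bary S m (toReal m') * α m| ≤ B * (K * α m') := by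
            rw [abs_mul, abs_of_nonneg (hα0 m (hSΔ (hFS hm)))]
            exact mul_le_mul hb1 ha (hα0 m (hSΔ (hFS hm))) hB.le
          exact (abs_le.1 this).1
        rw [Finset.sum_const, hFc, nsmul_eq_mul] at this
        linarith
      have h4 : c ≤ bary S p (toReal m') := by
        have := (hbd S hS p hpS m' hm'Δ).2 hpne
        rwa [abs_of_nonneg (hnn p hpS hpF)] at this
      have h5 : c * α p ≤ bary S p (toReal m') * α p :=
        mul_le_mul_of_nonneg_right h4 (hα0 p (hSΔ hpS))
      rw [hK', div_mul_eq_mul_div, le_div_iff₀ hc]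
      linarith
    have hle : ∀ {x y : ℝ} {m : Fin l → ℤ}, m ∈ Δ → x ≤ y * α m → y ≤ max K K' →
        x ≤ max K K' * α m := fun hm h1 h2 =>
      h1.trans (mul_le_mul_of_nonneg_right h2 (hα0 _ hm))
    refine ⟨insert p F, by rw [Finset.card_insert_of_notMem hpF, hFc],
      ⟨S, hS, Finset.insert_subset hpS hFS⟩, fun m hm n hn hs => ?_⟩
    -- For the new vertex the comparison comes from the minimality of `m'`. For an old vertex,
    -- separation from a larger set implies separation from the smaller one, so the previous bound
    -- applies.
    rcases Finset.mem_insert.1 hm with rfl | hmF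
    · rw [Finset.erase_insert hpF] at hs
      have := hmin n (Finset.mem_filter.2 ⟨hn, hs⟩)
      exact hle hn (hαp.trans (mul_le_mul_of_nonneg_left this hK'pos.le)) (le_max_right _ _)
    · refine hle hn (hF m hmF n hn (hs.mono ?_)) (le_max_left _ _)
      exact Finset.erase_subset_erase _ (Finset.subset_insert _ _)

theorem exists_gap (Δ : Finset (Fin l → ℤ)) (w : (Fin l → ℤ) → ℝ)
    (hw : IsConvexSimplicial Δ w) : ∃ c : ℝ, 0 < c ∧ ∀ S ∈ topSimplices Δ w, ∀ m ∈ Δ, m ∉ S →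
      c ≤ w m - interp w S (toReal m) := by
  classical
  let J := ((topSimplices Δ w) ×ˢ Δ).filter fun q => q.2 ∉ q.1
  rcases J.eq_empty_or_nonempty with h | h
  · refine ⟨1, one_pos, fun S hS m hm hmS => ?_⟩
    have : (S, m) ∈ J := by simp [J, hS, hm, hmS]
    rw [h] at this
    simp at this
  · obtain ⟨q, hq, hmin⟩ := Finset.exists_min_image J
      (fun q => w q.2 - interp w q.1 (toReal q.2)) h
    simp only [J, Finset.mem_filter, Finset.mem_product] at hq
    refine ⟨_, sub_pos.2 (interp_lt hw hq.1.1 hq.1.2 hq.2), fun S hS m hm hmS => ?_⟩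
    exact hmin (S, m) (by simp [J, hS, hm, hmS])

/-- Existence of a top simplex adapted to a nonnegative function `α = L w + affine`. -/
theorem exists_adapted_simplex {Δ : Finset (Fin l → ℤ)} {w : (Fin l → ℤ) → ℝ}
    (hΔ : IsLatticePolytope Δ) (hw : IsConvexSimplicial Δ w) :
    ∃ K ε : ℝ, 0 < K ∧ 0 < ε ∧
      ∀ (L : ℝ) (f : (Fin l → ℝ) →ᵃ[ℝ] ℝ) (α : (Fin l → ℤ) → ℝ), 0 ≤ L →
      (∀ m ∈ Δ, α m = L * w m + f (toReal m)) → (∀ m ∈ Δ, 0 ≤ α m) →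
      ∃ S ∈ topSimplices Δ w,
        (∀ m ∈ S, ∀ m' ∈ Δ, bary S m (toReal m') ≠ 0 → α m ≤ K * α m') ∧
        ∀ m' ∈ Δ, m' ∉ S → ε * L ≤ α m' := by
  classical
  obtain ⟨K, hK, h⟩ := exists_adapted_face hΔ hw (l + 1) le_rfl
  obtain ⟨B, c, hB, hc, hbd⟩ := exists_bary_bounds Δ w
  obtain ⟨γ, hγ, hgap⟩ := exists_gap Δ w hw
  -- Off the simplex the defect is at least `γ L`, while the `l + 1` vertices lower the
  -- interpolation by at most `B K (l + 1) α m'`. Solving for `α m'` gives this value of `ε`.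
  refine ⟨K, γ / (1 + B * K * (l + 1)), hK, by positivity, fun L f α hL hα hα0 => ?_⟩
  obtain ⟨F, hFc, ⟨S, hS, hFS⟩, hF⟩ := h L f α hL hα hα0
  have hb := isVertexBasis_of_mem hw hS
  obtain rfl : F = S := Finset.eq_of_subset_of_card_le hFS (by rw [hFc, hb.2])
  have hFΔ : F ⊆ Δ := (mem_topSimplices.1 hS).1.2.1
  have key : ∀ m ∈ F, ∀ m' ∈ Δ, bary F m (toReal m') ≠ 0 → α m ≤ K * α m' := by
    refine fun m hm m' hm' hne => hF m hm m' hm' ⟨bary F m, fun n hn => ?_, hne⟩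
    rw [bary_apply hb hm (Finset.mem_of_mem_erase hn), if_neg (Finset.ne_of_mem_erase hn).symm]
  refine ⟨F, hS, key, fun m' hm' hm'F => ?_⟩
  have e := sum_bary_mul_le hw hS hα hm'
  have h1 : -(B * K * (l + 1) * α m') ≤ ∑ m ∈ F, bary F m (toReal m') * α m := by
    have : ∑ m ∈ F, -(B * (K * α m')) ≤ ∑ m ∈ F, bary F m (toReal m') * α m := by
      refine Finset.sum_le_sum fun m hm => ?_
      have hnn : 0 ≤ B * (K * α m') := mul_nonneg hB.le (mul_nonneg hK.le (hα0 m' hm'))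
      by_cases h0 : bary F m (toReal m') = 0
      · rw [h0, zero_mul]; linarith
      · have : |bary F m (toReal m') * α m| ≤ B * (K * α m') := by
          rw [abs_mul, abs_of_nonneg (hα0 m (hFΔ hm))]
          exact mul_le_mul (hbd F hS m hm m' hm').1 (key m hm m' hm' h0) (hα0 m (hFΔ hm)) hB.le
        exact (abs_le.1 this).1
    rw [Finset.sum_const, hFc, nsmul_eq_mul] at this
    push_cast at this
    linarith
  have h2 := mul_le_mul_of_nonneg_left (hgap F hS m' hm' hm'F) hL
  rw [div_mul_eq_mul_div, div_le_iff₀ (by positivity)]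
  linarith

/-- Any other vertex basis `S'` can be matched with `S` through nonzero barycentric coordinates. -/
theorem exists_equiv_bary_ne_zero {S S' : Finset (Fin l → ℤ)} (hS : IsVertexBasis S)
    (hS' : IsVertexBasis S') : ∃ e : S ≃ S', ∀ m : S, bary S m.1 (toReal (e m).1) ≠ 0 := by
  classical
  have e₀ : S ≃ S' := Fintype.equivOfCardEq (by simp [hS.2, hS'.2])
  let A : Matrix S S ℝ := Matrix.of fun i j => bary S i.1 (toReal (e₀ j).1)
  let A' : Matrix S S ℝ := Matrix.of fun i j => bary S' (e₀ i).1 (toReal j.1)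
  have hmul : A * A' = 1 := by
    ext i j
    rw [Matrix.mul_apply, Matrix.one_apply]
    have h1 := eq_sum_bary hS' (bary S i.1) (toReal j.1)
    rw [bary_apply hS i.2 j.2, ← Finset.sum_coe_sort S'] at h1
    rw [← e₀.sum_comp] at h1
    simp only [Subtype.ext_iff]
    rw [h1]
    exact Finset.sum_congr rfl fun k _ => by simp [A, A', mul_comm]
  have hdet : A.det ≠ 0 := by
    intro h0
    have := congrArg Matrix.det hmul
    rw [Matrix.det_mul, h0, zero_mul, Matrix.det_one] at this
    exact zero_ne_one this
  -- An invertible matrix has a nonvanishing term in its Leibniz expansion, and the permutation of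
  -- that term is the matching.
  rw [← Matrix.det_transpose, Matrix.det_apply] at hdet
  obtain ⟨σ, -, hσ⟩ := Finset.exists_ne_zero_of_sum_ne_zero hdet
  have hprod : ∏ i, A.transpose (σ i) i ≠ 0 := fun h => hσ (by rw [h, smul_zero])
  rw [Finset.prod_ne_zero_iff] at hprod
  exact ⟨σ.trans e₀, fun m => by simpa [A] using hprod m (Finset.mem_univ _)⟩

/-- Match every vertex of `S` with a vertex of `S'` at which its barycentric coordinate is nonzero
and compare factor by factor. It follows that the summand of the adapted simplex in `h` dominates
all others up to a constant. -/
theorem prod_adapted_le {Δ : Finset (Fin l → ℤ)} {w : (Fin l → ℤ) → ℝ}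
    (hw : IsConvexSimplicial Δ w) {K : ℝ} {α : (Fin l → ℤ) → ℝ} (hα0 : ∀ m ∈ Δ, 0 ≤ α m)
    {S S' : Finset (Fin l → ℤ)} (hS : S ∈ topSimplices Δ w) (hS' : S' ∈ topSimplices Δ w)
    (h : ∀ m ∈ S, ∀ m' ∈ Δ, bary S m (toReal m') ≠ 0 → α m ≤ K * α m') :
    ∏ m ∈ S, α m ≤ K ^ (l + 1) * ∏ m ∈ S', α m := by
  have hSb := isVertexBasis_of_mem hw hS
  obtain ⟨e, he⟩ := exists_equiv_bary_ne_zero hSb (isVertexBasis_of_mem hw hS')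
  have hSΔ : S ⊆ Δ := (mem_topSimplices.1 hS).1.2.1
  have hSΔ' : S' ⊆ Δ := (mem_topSimplices.1 hS').1.2.1
  calc ∏ m ∈ S, α m = ∏ m : S, α m.1 := (Finset.prod_coe_sort S _).symm
    _ ≤ ∏ m : S, (K * α (e m).1) := Finset.prod_le_prod (fun m _ => hα0 m.1 (hSΔ m.2))
        fun m _ => h m.1 m.2 _ (hSΔ' (e m).2) (he m)
    _ = K ^ (l + 1) * ∏ m : S, α (e m).1 := by
        rw [Finset.prod_mul_distrib, Finset.prod_const, Finset.card_univ, Fintype.card_coe, hSb.2]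
    _ = K ^ (l + 1) * ∏ m ∈ S', α m := by
        rw [e.prod_comp (fun m => α m.1), Finset.prod_coe_sort]

end ToricDegeneration

end

noncomputable section

/-! ### Families of germs with uniformly bounded jets -/

open Filter Topology

/-- The jets of order at most `n` of the germs `f i` at the points `p i` are bounded uniformly
in `i`. -/
def JetBdd {ι E : Type} [NormedAddCommGroup E] [NormedSpace ℝ E] (p : ι → E) :
    (n : ℕ) → {F : Type} → [NormedAddCommGroup F] → [NormedSpace ℝ F] → (ι → E → F) → Prop
  | 0, _, _, _, f => (∀ i, ContDiffAt ℝ ∞ (f i) (p i)) ∧ ∃ C : ℝ, ∀ i, ‖f i (p i)‖ ≤ C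
  | n + 1, _, _, _, f => ((∀ i, ContDiffAt ℝ ∞ (f i) (p i)) ∧ ∃ C : ℝ, ∀ i, ‖f i (p i)‖ ≤ C) ∧
      JetBdd p n (fun i => fderiv ℝ (f i))

/-- All jets of the germs `f i` at the points `p i` are bounded uniformly in `i`. -/
def SmoothBdd {ι E F : Type} [NormedAddCommGroup E] [NormedSpace ℝ E] [NormedAddCommGroup F]
    [NormedSpace ℝ F] (p : ι → E) (f : ι → E → F) : Prop :=
  ∀ n, JetBdd p n f

theorem eventually_differentiableAt {E F : Type*} [NormedAddCommGroup E] [NormedSpace ℝ E]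
    [NormedAddCommGroup F] [NormedSpace ℝ F] {f : E → F} {x : E} (h : ContDiffAt ℝ ∞ f x) :
    ∀ᶠ y in 𝓝 x, DifferentiableAt ℝ f y := by
  have h1 : ContDiffAt ℝ 1 f x := h.of_le (by exact_mod_cast le_top)
  exact (h1.eventually (by simp)).mono fun y hy => hy.differentiableAt (by simp)

theorem ContDiffAt.fderiv_smooth {E F : Type*} [NormedAddCommGroup E] [NormedSpace ℝ E]
    [NormedAddCommGroup F] [NormedSpace ℝ F] {f : E → F} {x : E} (h : ContDiffAt ℝ ∞ f x) :
    ContDiffAt ℝ ∞ (fderiv ℝ f) x :=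
  h.fderiv_right (by simp)

theorem ContinuousLinearMap.contDiffAt_bilinear {E F G H : Type*} [NormedAddCommGroup E]
    [NormedSpace ℝ E] [NormedAddCommGroup F] [NormedSpace ℝ F] [NormedAddCommGroup G]
    [NormedSpace ℝ G] [NormedAddCommGroup H] [NormedSpace ℝ H] (B : F →L[ℝ] G →L[ℝ] H)
    {f : E → F} {g : E → G} {x : E} (hf : ContDiffAt ℝ ∞ f x) (hg : ContDiffAt ℝ ∞ g x) :
    ContDiffAt ℝ ∞ (fun y => B (f y) (g y)) x :=
  ((B.contDiff.contDiffAt).comp x hf).clm_apply hg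

namespace JetBdd

variable {ι E : Type} [NormedAddCommGroup E] [NormedSpace ℝ E] {p : ι → E}
variable {F G H : Type} [NormedAddCommGroup F] [NormedSpace ℝ F] [NormedAddCommGroup G]
  [NormedSpace ℝ G] [NormedAddCommGroup H] [NormedSpace ℝ H] {n : ℕ}

theorem jet_zero {f : ι → E → F} (h : JetBdd p n f) : JetBdd p 0 f := by
  cases n with
  | zero => exact h
  | succ n => exact h.1

theorem contDiffAt {f : ι → E → F} (h : JetBdd p n f) (i : ι) : ContDiffAt ℝ ∞ (f i) (p i) :=
  h.jet_zero.1 i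

theorem bound {f : ι → E → F} (h : JetBdd p n f) : ∃ C : ℝ, 0 ≤ C ∧ ∀ i, ‖f i (p i)‖ ≤ C := by
  obtain ⟨C, hC⟩ := h.jet_zero.2
  exact ⟨max C 0, le_max_right _ _, fun i => (hC i).trans (le_max_left _ _)⟩

/-- Differentiation rules hold only near `p i`, where the functions are differentiable; this lemma
lets them be used inside inductions on the order of the jet. -/
theorem congr {f g : ι → E → F} (h : JetBdd p n f) (hfg : ∀ i, f i =ᶠ[𝓝 (p i)] g i) :
    JetBdd p n g := by
  have h0 : ∀ {F : Type} [NormedAddCommGroup F] [NormedSpace ℝ F] {f g : ι → E → F},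
      JetBdd p 0 f → (∀ i, f i =ᶠ[𝓝 (p i)] g i) → JetBdd p 0 g := by
    intro F _ _ f g h hfg
    obtain ⟨C, hC⟩ := h.2
    exact ⟨fun i => (h.1 i).congr_of_eventuallyEq (hfg i).symm,
      C, fun i => by rw [← (hfg i).eq_of_nhds]; exact hC i⟩
  induction n generalizing F with
  | zero => exact h0 h hfg
  | succ n ih => exact ⟨h0 h.jet_zero hfg, ih h.2 fun i => (hfg i).fderiv⟩

theorem of_succ {f : ι → E → F} (h : JetBdd p (n + 1) f) : JetBdd p n f := by
  induction n generalizing F with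
  | zero => exact h.1
  | succ n ih => exact ⟨h.1, ih h.2⟩

theorem const {c : ι → F} (hc : ∃ C : ℝ, ∀ i, ‖c i‖ ≤ C) : JetBdd p n (fun i _ => c i) := by
  induction n generalizing F with
  | zero => exact ⟨fun i => contDiffAt_const, hc⟩
  | succ n ih =>
    refine ⟨⟨fun i => contDiffAt_const, hc⟩, ?_⟩
    have : (fun i => fderiv ℝ (fun _ : E => c i)) = fun (i : ι) (_ : E) => (0 : E →L[ℝ] F) := by
      funext i x; simp
    rw [this]
    exact ih ⟨0, by simp⟩

theorem add {f g : ι → E → F} (hf : JetBdd p n f) (hg : JetBdd p n g) :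
    JetBdd p n (fun i x => f i x + g i x) := by
  have h0 : ∀ {F : Type} [NormedAddCommGroup F] [NormedSpace ℝ F] {f g : ι → E → F},
      JetBdd p 0 f → JetBdd p 0 g → JetBdd p 0 (fun i x => f i x + g i x) := by
    intro F _ _ f g hf hg
    obtain ⟨C, -, hC⟩ := hf.bound
    obtain ⟨D, -, hD⟩ := hg.bound
    exact ⟨fun i => (hf.1 i).add (hg.1 i), C + D, fun i => norm_add_le_of_le (hC i) (hD i)⟩
  induction n generalizing F with
  | zero => exact h0 hf hg
  | succ n ih =>
    refine ⟨h0 hf.jet_zero hg.jet_zero, (ih hf.2 hg.2).congr fun i => ?_⟩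
    filter_upwards [eventually_differentiableAt (hf.contDiffAt i),
      eventually_differentiableAt (hg.contDiffAt i)] with y h1 h2
    exact (fderiv_fun_add h1 h2).symm

/-- By the Leibniz rule the derivative is a sum of two expressions of the same kind for other
bilinear maps, so the induction runs over all spaces and all `B` at once. -/
theorem bilin (B : F →L[ℝ] G →L[ℝ] H) {f : ι → E → F} {g : ι → E → G} (hf : JetBdd p n f)
    (hg : JetBdd p n g) : JetBdd p n (fun i x => B (f i x) (g i x)) := by
  have h0 : ∀ {F G H : Type} [NormedAddCommGroup F] [NormedSpace ℝ F] [NormedAddCommGroup G]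
      [NormedSpace ℝ G] [NormedAddCommGroup H] [NormedSpace ℝ H] (B : F →L[ℝ] G →L[ℝ] H)
      {f : ι → E → F} {g : ι → E → G}, JetBdd p 0 f → JetBdd p 0 g →
      JetBdd p 0 (fun i x => B (f i x) (g i x)) := by
    intro F G H _ _ _ _ _ _ B f g hf hg
    obtain ⟨C, hC0, hC⟩ := hf.bound
    obtain ⟨D, -, hD⟩ := hg.bound
    refine ⟨fun i => B.contDiffAt_bilinear (hf.1 i) (hg.1 i), ‖B‖ * C * D, fun i => ?_⟩
    refine (B.le_opNorm₂ _ _).trans ?_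
    have := hC i
    have := hD i
    gcongr
  induction n generalizing F G H with
  | zero => exact h0 B hf hg
  | succ n ih =>
    refine ⟨h0 B hf.jet_zero hg.jet_zero, ((ih (B.precompR E) hf.of_succ hg.2).add
      (ih (B.precompL E) hf.2 hg.of_succ)).congr fun i => ?_⟩
    filter_upwards [eventually_differentiableAt (hf.contDiffAt i),
      eventually_differentiableAt (hg.contDiffAt i)] with y h1 h2
    exact (B.hasFDerivAt_of_bilinear h1.hasFDerivAt h2.hasFDerivAt).fderiv.symm

theorem clm_apply {f : ι → E → (F →L[ℝ] G)} {g : ι → E → F} (hf : JetBdd p n f)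
    (hg : JetBdd p n g) : JetBdd p n (fun i x => f i x (g i x)) :=
  bilin (ContinuousLinearMap.id ℝ (F →L[ℝ] G)) hf hg

theorem clm_comp {f : ι → E → (G →L[ℝ] H)} {g : ι → E → (F →L[ℝ] G)} (hf : JetBdd p n f)
    (hg : JetBdd p n g) : JetBdd p n (fun i x => (f i x).comp (g i x)) :=
  bilin (ContinuousLinearMap.compL ℝ F G H) hf hg

theorem clm (L : F →L[ℝ] G) {f : ι → E → F} (hf : JetBdd p n f) :
    JetBdd p n (fun i x => L (f i x)) :=
  clm_apply (const (c := fun _ : ι => L) ⟨‖L‖, fun _ => le_rfl⟩) hf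

theorem neg {f : ι → E → F} (hf : JetBdd p n f) : JetBdd p n (fun i x => -f i x) := by
  simpa using clm (-(ContinuousLinearMap.id ℝ F)) hf

theorem sub {f g : ι → E → F} (hf : JetBdd p n f) (hg : JetBdd p n g) :
    JetBdd p n (fun i x => f i x - g i x) := by
  simpa [sub_eq_add_neg] using hf.add hg.neg

theorem mul {A : Type} [NormedRing A] [NormedAlgebra ℝ A] {f g : ι → E → A} (hf : JetBdd p n f)
    (hg : JetBdd p n g) : JetBdd p n (fun i x => f i x * g i x) :=
  bilin (ContinuousLinearMap.mul ℝ A) hf hg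

theorem sum {σ : Type*} (s : Finset σ) {f : σ → ι → E → F} (hf : ∀ j ∈ s, JetBdd p n (f j)) :
    JetBdd p n (fun i x => ∑ j ∈ s, f j i x) := by
  classical
  induction s using Finset.induction_on with
  | empty => simpa using const (p := p) (n := n) (c := fun _ : ι => (0 : F)) ⟨0, by simp⟩
  | insert a s ha ih =>
    simp only [Finset.sum_insert ha]
    exact (hf a (Finset.mem_insert_self _ _)).add
      (ih fun j hj => hf j (Finset.mem_insert_of_mem hj))

theorem prod {A σ : Type} [NormedCommRing A] [NormedAlgebra ℝ A] (s : Finset σ)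
    {f : σ → ι → E → A} (hf : ∀ j ∈ s, JetBdd p n (f j)) :
    JetBdd p n (fun i x => ∏ j ∈ s, f j i x) := by
  classical
  induction s using Finset.induction_on with
  | empty => simpa using const (p := p) (n := n) (c := fun _ : ι => (1 : A)) ⟨‖(1 : A)‖, by simp⟩
  | insert a s ha ih =>
    simp only [Finset.prod_insert ha]
    exact (hf a (Finset.mem_insert_self _ _)).mul
      (ih fun j hj => hf j (Finset.mem_insert_of_mem hj))

theorem comp {f : ι → F → G} {g : ι → E → F} (hf : JetBdd (fun i => g i (p i)) n f)
    (hg : JetBdd p n g) : JetBdd p n (fun i x => f i (g i x)) := by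
  have h0 : ∀ {G : Type} [NormedAddCommGroup G] [NormedSpace ℝ G] {f : ι → F → G},
      JetBdd (fun i => g i (p i)) 0 f → JetBdd p 0 g → JetBdd p 0 (fun i x => f i (g i x)) := by
    intro G _ _ f hf hg
    obtain ⟨C, hC⟩ := hf.2
    exact ⟨fun i => (hf.1 i).comp (p i) (hg.1 i), C, hC⟩
  induction n generalizing G with
  | zero => exact h0 hf hg
  | succ n ih =>
    refine ⟨h0 hf.jet_zero hg.jet_zero, ((ih hf.2 hg.of_succ).clm_comp hg.2).congr fun i => ?_⟩
    filter_upwards [(hg.contDiffAt i).continuousAt.eventually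
      (eventually_differentiableAt (hf.contDiffAt i)),
      eventually_differentiableAt (hg.contDiffAt i)] with y h1 h2
    exact (h1.hasFDerivAt.comp y h2.hasFDerivAt).fderiv.symm

/-- The derivative is `-f⁻² f'`, so jets of order `n` of `f⁻¹` itself bound those of order `n + 1`.
Only values at the base points enter, so a lower bound there suffices. -/
theorem inv {A : Type} [NormedField A] [NormedAlgebra ℝ A] {f : ι → E → A}
    (hf : JetBdd p n f) (hlow : ∃ c : ℝ, 0 < c ∧ ∀ i, c ≤ ‖f i (p i)‖) :
    JetBdd p n (fun i x => (f i x)⁻¹) := by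
  obtain ⟨c, hc, hlow⟩ := hlow
  have hne : ∀ i, f i (p i) ≠ 0 := fun i => norm_pos_iff.1 (hc.trans_le (hlow i))
  have h0 : JetBdd p 0 f → JetBdd p 0 (fun i x => (f i x)⁻¹) := by
    intro hf
    refine ⟨fun i => (hf.1 i).inv (hne i), c⁻¹, fun i => ?_⟩
    rw [norm_inv]
    exact inv_anti₀ hc (hlow i)
  induction n with
  | zero => exact h0 hf
  | succ n ih =>
    have h1 := ih hf.of_succ
    refine ⟨h0 hf.jet_zero, (bilin (ContinuousLinearMap.lsmul ℝ A) (h1.mul h1) hf.2).neg.congr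
      fun i => ?_⟩
    filter_upwards [eventually_differentiableAt (hf.contDiffAt i),
      (hf.contDiffAt i).continuousAt.eventually_ne (hne i)] with y h1 h2
    have h3 := ((hasFDerivAt_inv' (𝕜 := ℝ) h2).comp y h1.hasFDerivAt).fderiv
    rw [Function.comp_def] at h3
    rw [h3]
    ext v
    simp
    ring

theorem log {f : ι → E → ℝ} (hf : JetBdd p n f) (hlow : ∃ c : ℝ, 0 < c ∧ ∀ i, c ≤ f i (p i)) :
    JetBdd p n (fun i x => Real.log (f i x)) := by
  obtain ⟨c, hc, hlow⟩ := hlow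
  have hpos : ∀ i, 0 < f i (p i) := fun i => hc.trans_le (hlow i)
  have h0 : JetBdd p 0 f → JetBdd p 0 (fun i x => Real.log (f i x)) := by
    intro hf
    obtain ⟨C, -, hC⟩ := hf.bound
    refine ⟨fun i => (hf.1 i).log (hpos i).ne', max |Real.log c| |Real.log C|, fun i => ?_⟩
    rw [Real.norm_eq_abs]
    have h1 := Real.log_le_log hc (hlow i)
    have h2 := Real.log_le_log (hpos i) ((le_abs_self _).trans (hC i))
    exact abs_le_max_abs_abs h1 h2
  cases n with
  | zero => exact h0 hf
  | succ n =>
    refine ⟨h0 hf.jet_zero, (bilin (ContinuousLinearMap.lsmul ℝ ℝ) (inv hf.of_succ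
      ⟨c, hc, fun i => (hlow i).trans (le_abs_self _)⟩) hf.2).congr fun i => ?_⟩
    filter_upwards [eventually_differentiableAt (hf.contDiffAt i),
      (hf.contDiffAt i).continuousAt.eventually_ne (hpos i).ne'] with y h1 h2
    rw [(h1.hasFDerivAt.log h2).fderiv]
    rfl

end JetBdd

namespace SmoothBdd

variable {ι E : Type} [NormedAddCommGroup E] [NormedSpace ℝ E] {p : ι → E}
variable {F G H : Type} [NormedAddCommGroup F] [NormedSpace ℝ F] [NormedAddCommGroup G]
  [NormedSpace ℝ G] [NormedAddCommGroup H] [NormedSpace ℝ H]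

theorem contDiffAt {f : ι → E → F} (h : SmoothBdd p f) (i : ι) : ContDiffAt ℝ ∞ (f i) (p i) :=
  (h 0).contDiffAt i

theorem bound {f : ι → E → F} (h : SmoothBdd p f) : ∃ C : ℝ, 0 ≤ C ∧ ∀ i, ‖f i (p i)‖ ≤ C :=
  (h 0).bound

theorem congr {f g : ι → E → F} (h : SmoothBdd p f) (hfg : ∀ i, f i =ᶠ[𝓝 (p i)] g i) :
    SmoothBdd p g := fun n => (h n).congr hfg

theorem const {c : ι → F} (hc : ∃ C : ℝ, ∀ i, ‖c i‖ ≤ C) : SmoothBdd p (fun i _ => c i) :=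
  fun _ => .const hc

theorem fderiv {f : ι → E → F} (h : SmoothBdd p f) : SmoothBdd p (fun i => fderiv ℝ (f i)) :=
  fun n => (h (n + 1)).2

theorem clm_apply {f : ι → E → (F →L[ℝ] G)} {g : ι → E → F} (hf : SmoothBdd p f)
    (hg : SmoothBdd p g) : SmoothBdd p (fun i x => f i x (g i x)) := fun n => (hf n).clm_apply (hg n)

theorem apply_const {f : ι → E → (F →L[ℝ] G)} (hf : SmoothBdd p f) (v : F) :
    SmoothBdd p (fun i x => f i x v) :=
  hf.clm_apply (const (c := fun _ : ι => v) ⟨‖v‖, fun _ => le_rfl⟩)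

theorem clm (L : F →L[ℝ] G) {f : ι → E → F} (hf : SmoothBdd p f) :
    SmoothBdd p (fun i x => L (f i x)) := fun n => (hf n).clm L

theorem add {f g : ι → E → F} (hf : SmoothBdd p f) (hg : SmoothBdd p g) :
    SmoothBdd p (fun i x => f i x + g i x) := fun n => (hf n).add (hg n)

theorem sub {f g : ι → E → F} (hf : SmoothBdd p f) (hg : SmoothBdd p g) :
    SmoothBdd p (fun i x => f i x - g i x) := fun n => (hf n).sub (hg n)

theorem mul {A : Type} [NormedRing A] [NormedAlgebra ℝ A] {f g : ι → E → A} (hf : SmoothBdd p f)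
    (hg : SmoothBdd p g) : SmoothBdd p (fun i x => f i x * g i x) := fun n => (hf n).mul (hg n)

theorem sum {σ : Type*} (s : Finset σ) {f : σ → ι → E → F} (hf : ∀ j ∈ s, SmoothBdd p (f j)) :
    SmoothBdd p (fun i x => ∑ j ∈ s, f j i x) := fun n => .sum s fun j hj => hf j hj n

theorem prod {A σ : Type} [NormedCommRing A] [NormedAlgebra ℝ A] (s : Finset σ)
    {f : σ → ι → E → A} (hf : ∀ j ∈ s, SmoothBdd p (f j)) :
    SmoothBdd p (fun i x => ∏ j ∈ s, f j i x) := fun n => .prod s fun j hj => hf j hj n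

theorem comp {f : ι → F → G} {g : ι → E → F} (hf : SmoothBdd (fun i => g i (p i)) f)
    (hg : SmoothBdd p g) : SmoothBdd p (fun i x => f i (g i x)) := fun n => (hf n).comp (hg n)

theorem inv {A : Type} [NormedField A] [NormedAlgebra ℝ A] {f : ι → E → A}
    (hf : SmoothBdd p f) (hlow : ∃ c : ℝ, 0 < c ∧ ∀ i, c ≤ ‖f i (p i)‖) :
    SmoothBdd p (fun i x => (f i x)⁻¹) := fun n => (hf n).inv hlow

theorem log {f : ι → E → ℝ} (hf : SmoothBdd p f) (hlow : ∃ c : ℝ, 0 < c ∧ ∀ i, c ≤ f i (p i)) :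
    SmoothBdd p (fun i x => Real.log (f i x)) := fun n => (hf n).log hlow

/-- A uniformly bounded family of continuous linear maps has uniformly bounded jets at `0`. -/
theorem linear {L : ι → E →L[ℝ] F} (hL : ∃ C : ℝ, ∀ i, ‖L i‖ ≤ C) :
    SmoothBdd (fun _ => 0) (fun i x => L i x) := by
  intro n
  have h0 : JetBdd (fun _ => (0 : E)) 0 (fun i x => L i x) :=
    ⟨fun i => (L i).contDiff.contDiffAt, 0, fun i => by simp⟩
  cases n with
  | zero => exact h0
  | succ n =>
    refine ⟨h0, (JetBdd.const (c := L) hL).congr fun i => .of_forall fun x => ?_⟩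
    exact (L i).fderiv.symm

/-- The germs `a ^ j * c * exp (a * λ y)` where `c` is exponentially small in `a`. -/
theorem cexp_linear {a : ι → ℝ} {c : ι → ℂ} {L : ι → E →L[ℝ] ℂ}
    (hc : ∀ j : ℕ, ∃ C : ℝ, ∀ i, ‖a i ^ j • c i‖ ≤ C) (hL : ∃ C : ℝ, ∀ i, ‖L i‖ ≤ C) :
    SmoothBdd (fun _ => 0) (fun i x => c i * Complex.exp (a i • L i x)) := by
  have hd : ∀ i x, HasFDerivAt (fun x => Complex.exp (a i • L i x))
      (Complex.exp (a i • L i x) • (a i • L i)) x := fun i x =>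
    ((a i • L i).hasFDerivAt (x := x)).cexp
  have hsm : ∀ i, ContDiff ℝ ∞ (fun x : E => Complex.exp (a i • L i x)) := fun i =>
    (a i • L i).contDiff.cexp
  -- Each derivative brings down a factor `a i`, so the induction must carry all powers `a i ^ j`
  -- simultaneously.
  have key : ∀ n (j : ℕ), JetBdd (fun _ : ι => (0 : E)) n
      (fun i x => (a i ^ j • c i) * Complex.exp (a i • L i x)) := by
    intro n
    have h0 : ∀ j : ℕ, JetBdd (fun _ : ι => (0 : E)) 0
        (fun i x => (a i ^ j • c i) * Complex.exp (a i • L i x)) := fun j => by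
      obtain ⟨C, hC⟩ := hc j
      exact ⟨fun i => (contDiff_const.mul (hsm i)).contDiffAt, C, fun i => by simpa using hC i⟩
    induction n with
    | zero => exact h0
    | succ n ih =>
      refine fun j => ⟨h0 j, (JetBdd.bilin (ContinuousLinearMap.lsmul ℝ ℂ) (ih (j + 1))
        (JetBdd.const (c := L) hL)).congr fun i => .of_forall fun x => ?_⟩
      rw [((hd i x).const_mul (a i ^ j • c i)).fderiv]
      ext v
      simp [pow_succ]
      ring
  intro n
  simpa using key n 0

end SmoothBdd

end

noncomputable section

/-! ### Tensor calculus in charts -/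

namespace ChartGeometry

open Filter Topology

variable {n : ℕ} {F : Type*} [NormedAddCommGroup F] [NormedSpace ℝ F]

/-- The function `b` of two vectors is bilinear. -/
def IsBilin (b : (Fin n → ℝ) → (Fin n → ℝ) → F) : Prop :=
  ∃ m : (Fin n → ℝ) →ₗ[ℝ] (Fin n → ℝ) →ₗ[ℝ] F, ∀ u v, b u v = m u v

/-- The function `T` of `r` vectors is multilinear. -/
def IsMultilin {r : ℕ} (T : (Fin r → Fin n → ℝ) → F) : Prop :=
  ∃ m : MultilinearMap ℝ (fun _ : Fin r => Fin n → ℝ) F, ∀ v, T v = m v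

theorem eq_sum_single (u : Fin n → ℝ) : u = ∑ i, u i • (Pi.single i 1 : Fin n → ℝ) := by
  conv_lhs => rw [← Finset.univ_sum_single u]
  exact Finset.sum_congr rfl fun i _ => by rw [← Pi.single_smul]; simp

namespace IsBilin

variable {b : (Fin n → ℝ) → (Fin n → ℝ) → F}

theorem add_left (h : IsBilin b) (u u' v : Fin n → ℝ) : b (u + u') v = b u v + b u' v := by
  obtain ⟨m, hm⟩ := h; simp [hm]

theorem add_right (h : IsBilin b) (u v v' : Fin n → ℝ) : b u (v + v') = b u v + b u v' := by
  obtain ⟨m, hm⟩ := h; simp [hm]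

theorem smul_left (h : IsBilin b) (c : ℝ) (u v : Fin n → ℝ) : b (c • u) v = c • b u v := by
  obtain ⟨m, hm⟩ := h; simp [hm]

theorem smul_right (h : IsBilin b) (c : ℝ) (u v : Fin n → ℝ) : b u (c • v) = c • b u v := by
  obtain ⟨m, hm⟩ := h; simp [hm]

theorem sub_left (h : IsBilin b) (u u' v : Fin n → ℝ) : b (u - u') v = b u v - b u' v := by
  obtain ⟨m, hm⟩ := h; simp [hm]

theorem expand (h : IsBilin b) (u v : Fin n → ℝ) :
    b u v = ∑ i, ∑ j, (u i * v j) • b (Pi.single i 1) (Pi.single j 1) := by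
  obtain ⟨m, hm⟩ := h
  simp only [hm]
  conv_lhs => rw [eq_sum_single u, eq_sum_single v]
  simp only [map_sum, LinearMap.sum_apply, map_smul, LinearMap.smul_apply, mul_smul]
  simp only [Finset.smul_sum]
  rw [Finset.sum_comm]
  exact Finset.sum_congr rfl fun i _ => Finset.sum_congr rfl fun j _ => smul_comm _ _ _

theorem expand_left (h : IsBilin b) (u v : Fin n → ℝ) :
    b u v = ∑ i, u i • b (Pi.single i 1) v := by
  obtain ⟨m, hm⟩ := h
  simp only [hm]
  conv_lhs => rw [eq_sum_single u]
  simp only [map_sum, LinearMap.sum_apply, map_smul, LinearMap.smul_apply]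

theorem expand_right (h : IsBilin b) (u v : Fin n → ℝ) :
    b u v = ∑ i, v i • b u (Pi.single i 1) := by
  obtain ⟨m, hm⟩ := h
  simp only [hm]
  conv_lhs => rw [eq_sum_single v]
  simp only [map_sum, map_smul]

theorem mk' (h1 : ∀ u u' v, b (u + u') v = b u v + b u' v) (h2 : ∀ (c : ℝ) u v, b (c • u) v = c • b u v)
    (h3 : ∀ u v v', b u (v + v') = b u v + b u v') (h4 : ∀ (c : ℝ) u v, b u (c • v) = c • b u v) :
    IsBilin b :=
  ⟨LinearMap.mk₂ ℝ b h1 h2 h3 h4, fun _ _ => rfl⟩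

end IsBilin

theorem IsMultilin.expand {r : ℕ} {T : (Fin r → Fin n → ℝ) → F} (h : IsMultilin T)
    (v : Fin r → Fin n → ℝ) :
    T v = ∑ f : Fin r → Fin n, (∏ s, v s (f s)) • T fun s => Pi.single (f s) 1 := by
  obtain ⟨m, hm⟩ := h
  simp only [hm]
  conv_lhs => rw [show v = fun s => ∑ i, v s i • (Pi.single i 1 : Fin n → ℝ) from
    funext fun s => eq_sum_single (v s)]
  rw [m.map_sum]
  exact Finset.sum_congr rfl fun f _ => m.map_smul_univ _ _

theorem IsMultilin.update_expand {r : ℕ} {T : (Fin r → Fin n → ℝ) → F} (h : IsMultilin T)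
    (v : Fin r → Fin n → ℝ) (s : Fin r) (u : Fin n → ℝ) :
    T (Function.update v s u) = ∑ i, u i • T (Function.update v s (Pi.single i 1)) := by
  obtain ⟨m, hm⟩ := h
  simp only [hm]
  conv_lhs => rw [eq_sum_single u]
  rw [m.map_update_sum]
  exact Finset.sum_congr rfl fun i _ => m.map_update_smul _ _ _ _

/-- The derivative of `z ↦ B(φ z)(a z, b z)` for a field `B` of bilinear maps. -/
theorem hasFDerivAt_bilin {B : (Fin n → ℝ) → (Fin n → ℝ) → (Fin n → ℝ) → F}
    {φ a b : (Fin n → ℝ) → Fin n → ℝ} {y : Fin n → ℝ} (hB : ∀ᶠ x in 𝓝 (φ y), IsBilin (B x))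
    (hd : ∀ u v, DifferentiableAt ℝ (fun x => B x u v) (φ y)) (hφ : DifferentiableAt ℝ φ y)
    (ha : DifferentiableAt ℝ a y) (hb : DifferentiableAt ℝ b y) :
    DifferentiableAt ℝ (fun z => B (φ z) (a z) (b z)) y ∧
    ∀ h, fderiv ℝ (fun z => B (φ z) (a z) (b z)) y h =
      fderiv ℝ (fun x => B x (a y) (b y)) (φ y) (fderiv ℝ φ y h)
        + B (φ y) (fderiv ℝ a y h) (b y) + B (φ y) (a y) (fderiv ℝ b y h) := by
  -- The field `B` is known to be differentiable only with constant arguments. Expanding in the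
  -- standard basis reduces to finitely many such functions.
  have hev : (fun z => B (φ z) (a z) (b z)) =ᶠ[𝓝 y] fun z => ∑ i, ∑ j,
      (a z i * b z j) • B (φ z) (Pi.single i 1) (Pi.single j 1) :=
    (hφ.continuousAt.eventually hB).mono fun z hz => hz.expand _ _
  have hai := hasFDerivAt_pi'.1 ha.hasFDerivAt
  have hbi := hasFDerivAt_pi'.1 hb.hasFDerivAt
  have key := HasFDerivAt.fun_sum (u := Finset.univ) fun i _ =>
    HasFDerivAt.fun_sum (u := Finset.univ) fun j _ =>
      ((hai i).fun_mul (hbi j)).fun_smul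
        ((hd (Pi.single i 1) (Pi.single j 1)).hasFDerivAt.comp y hφ.hasFDerivAt)
  have key' := key.congr_of_eventuallyEq hev
  refine ⟨key'.differentiableAt, fun h => ?_⟩
  have hev2 : (fun x => B x (a y) (b y)) =ᶠ[𝓝 (φ y)] fun x => ∑ i, ∑ j,
      (a y i * b y j) • B x (Pi.single i 1) (Pi.single j 1) :=
    hB.mono fun z hz => hz.expand _ _
  have key2 := (HasFDerivAt.fun_sum (u := Finset.univ) fun i _ =>
    HasFDerivAt.fun_sum (u := Finset.univ) fun j _ =>
      ((hd (Pi.single i 1) (Pi.single j 1)).hasFDerivAt.const_smul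
        (a y i * b y j))).congr_of_eventuallyEq hev2
  rw [key'.fderiv, key2.fderiv, hB.self_of_nhds.expand (fderiv ℝ a y h) (b y),
    hB.self_of_nhds.expand (a y) (fderiv ℝ b y h)]
  simp only [sum_apply, ← Finset.sum_add_distrib]
  refine Finset.sum_congr rfl fun i _ => Finset.sum_congr rfl fun j _ => ?_
  simp only [add_apply, smul_apply,
    ContinuousLinearMap.comp_apply, ContinuousLinearMap.smulRight_apply,
    ContinuousLinearMap.proj_apply, smul_eq_mul, Function.comp_apply, add_smul]
  rw [mul_comm (fderiv ℝ a y h i)]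
  abel

/-- The derivative of `z ↦ T(φ z)(a z)` for a field `T` of multilinear maps. -/
theorem hasFDerivAt_multilin {r : ℕ} {T : (Fin n → ℝ) → (Fin r → Fin n → ℝ) → ℝ}
    {φ : (Fin n → ℝ) → Fin n → ℝ} {a : Fin r → (Fin n → ℝ) → Fin n → ℝ} {y : Fin n → ℝ}
    (hT : ∀ᶠ x in 𝓝 (φ y), IsMultilin (T x))
    (hd : ∀ v, DifferentiableAt ℝ (fun x => T x v) (φ y)) (hφ : DifferentiableAt ℝ φ y)
    (ha : ∀ s, DifferentiableAt ℝ (a s) y) (h : Fin n → ℝ) :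
    fderiv ℝ (fun z => T (φ z) fun s => a s z) y h =
      fderiv ℝ (fun x => T x fun s => a s y) (φ y) (fderiv ℝ φ y h)
        + ∑ s, T (φ y) (Function.update (fun s => a s y) s (fderiv ℝ (a s) y h)) := by
  classical
  have hev : (fun z => T (φ z) fun s => a s z) =ᶠ[𝓝 y] fun z => ∑ f : Fin r → Fin n,
      (∏ s, a s z (f s)) • T (φ z) fun s => Pi.single (f s) 1 :=
    (hφ.continuousAt.eventually hT).mono fun z hz => hz.expand _
  have hai := fun s => hasFDerivAt_pi'.1 (ha s).hasFDerivAt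
  have key := (HasFDerivAt.fun_sum (u := Finset.univ) fun (f : Fin r → Fin n) _ =>
      (HasFDerivAt.finsetProd (u := Finset.univ) (g := fun s z => a s z (f s))
        fun s _ => hai s (f s)).fun_smul
        ((hd fun s => Pi.single (f s) 1).hasFDerivAt.comp y hφ.hasFDerivAt)).congr_of_eventuallyEq hev
  have hev2 : (fun x => T x fun s => a s y) =ᶠ[𝓝 (φ y)] fun x => ∑ f : Fin r → Fin n,
      (∏ s, a s y (f s)) • T x fun s => Pi.single (f s) 1 :=
    hT.mono fun z hz => hz.expand _
  have key2 := (HasFDerivAt.fun_sum (u := Finset.univ) fun (f : Fin r → Fin n) _ =>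
      ((hd fun s => Pi.single (f s) 1).hasFDerivAt.const_smul
        (∏ s, a s y (f s)))).congr_of_eventuallyEq hev2
  rw [key.fderiv, key2.fderiv]
  have h3 : ∀ s, T (φ y) (Function.update (fun s => a s y) s (fderiv ℝ (a s) y h)) =
      ∑ f : Fin r → Fin n, ((∏ j ∈ Finset.univ.erase s, a j y (f j)) * fderiv ℝ (a s) y h (f s)) *
        T (φ y) fun s => Pi.single (f s) 1 := by
    intro s
    rw [hT.self_of_nhds.expand]
    refine Finset.sum_congr rfl fun f _ => ?_
    rw [← Finset.mul_prod_erase Finset.univ _ (Finset.mem_univ s), Function.update_self, smul_eq_mul,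
      mul_comm (fderiv ℝ (a s) y h (f s))]
    congr 2
    refine Finset.prod_congr rfl fun j hj => ?_
    rw [Function.update_of_ne (Finset.ne_of_mem_erase hj)]
  simp only [h3]
  rw [Finset.sum_comm]
  simp only [sum_apply, ← Finset.sum_add_distrib]
  refine Finset.sum_congr rfl fun f _ => ?_
  simp [Finset.sum_mul]

/-- `g` is a smooth Riemannian metric on the open set `V`. -/
structure IsSmoothMetricOn (g : (Fin n → ℝ) → (Fin n → ℝ) → (Fin n → ℝ) → ℝ)
    (V : Set (Fin n → ℝ)) : Prop where
  isOpen : IsOpen V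
  bilin : ∀ x ∈ V, IsBilin (g x)
  symm : ∀ x ∈ V, ∀ u v, g x u v = g x v u
  pos : ∀ x ∈ V, ∀ u, u ≠ 0 → 0 < g x u u
  smooth : ∀ x ∈ V, ∀ u v, ContDiffAt ℝ ∞ (fun x => g x u v) x

/-- `T` is a smooth covariant tensor field on the open set `V`. -/
structure IsSmoothTensorOn {r : ℕ} (T : (Fin n → ℝ) → (Fin r → Fin n → ℝ) → ℝ)
    (V : Set (Fin n → ℝ)) : Prop where
  multilin : ∀ x ∈ V, IsMultilin (T x)
  smooth : ∀ x ∈ V, ∀ v, ContDiffAt ℝ ∞ (fun x => T x v) x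

theorem contDiffAt_det {ι X : Type*} [Fintype ι] [DecidableEq ι] [NormedAddCommGroup X]
    [NormedSpace ℝ X] {A : X → Matrix ι ι ℝ} {x : X}
    (h : ∀ i j, ContDiffAt ℝ ∞ (fun y => A y i j) x) : ContDiffAt ℝ ∞ (fun y => (A y).det) x := by
  simp only [Matrix.det_apply]
  exact ContDiffAt.sum fun σ _ => (contDiffAt_prod fun i _ => h _ _).const_smul _

theorem contDiffAt_inv_apply {ι X : Type*} [Fintype ι] [DecidableEq ι] [NormedAddCommGroup X]
    [NormedSpace ℝ X] {A : X → Matrix ι ι ℝ} {x : X}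
    (h : ∀ i j, ContDiffAt ℝ ∞ (fun y => A y i j) x) (hdet : (A x).det ≠ 0) (i j : ι) :
    ContDiffAt ℝ ∞ (fun y => (A y)⁻¹ i j) x := by
  simp only [Matrix.inv_def, Ring.inverse_eq_inv', Matrix.smul_apply, smul_eq_mul,
    Matrix.adjugate_apply]
  refine ((contDiffAt_det h).inv hdet).mul (contDiffAt_det fun a b => ?_)
  by_cases hb : a = j
  · subst hb; simp only [Matrix.updateRow_self]; exact contDiffAt_const
  · simp only [Matrix.updateRow_ne hb]; exact h a b

namespace IsSmoothMetricOn

variable {g : (Fin n → ℝ) → (Fin n → ℝ) → (Fin n → ℝ) → ℝ} {V : Set (Fin n → ℝ)}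
  {x : Fin n → ℝ}

theorem eventually_mem (hg : IsSmoothMetricOn g V) (hx : x ∈ V) : ∀ᶠ y in 𝓝 x, y ∈ V :=
  hg.isOpen.eventually_mem hx

theorem eventually_bilin (hg : IsSmoothMetricOn g V) (hx : x ∈ V) :
    ∀ᶠ y in 𝓝 x, IsBilin (g y) :=
  (hg.eventually_mem hx).mono fun y hy => hg.bilin y hy

theorem differentiableAt (hg : IsSmoothMetricOn g V) (hx : x ∈ V) (u v : Fin n → ℝ) :
    DifferentiableAt ℝ (fun x => g x u v) x := (hg.smooth x hx u v).differentiableAt (by simp)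

theorem ext (hg : IsSmoothMetricOn g V) (hx : x ∈ V) {u v : Fin n → ℝ}
    (h : ∀ w, g x u w = g x v w) : u = v := by
  by_contra hne
  have := hg.pos x hx (u - v) (sub_ne_zero.2 hne)
  rw [(hg.bilin x hx).sub_left, h, sub_self] at this
  exact lt_irrefl _ this

theorem eq_gram (hg : IsSmoothMetricOn g V) (hx : x ∈ V) (u v : Fin n → ℝ) :
    g x u v = u ⬝ᵥ (gram g x).mulVec v := by
  rw [(hg.bilin x hx).expand]
  simp only [dotProduct, Matrix.mulVec, gram, Matrix.of_apply, Finset.mul_sum, smul_eq_mul]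
  refine Finset.sum_congr rfl fun i _ => Finset.sum_congr rfl fun j _ => ?_
  ring

theorem det_ne_zero (hg : IsSmoothMetricOn g V) (hx : x ∈ V) : (gram g x).det ≠ 0 := by
  intro h
  obtain ⟨v, hv, h0⟩ := Matrix.exists_mulVec_eq_zero_iff.2 h
  have := hg.pos x hx v hv
  rw [hg.eq_gram hx, h0, dotProduct_zero] at this
  exact lt_irrefl _ this

theorem fderiv_add_left (hg : IsSmoothMetricOn g V) (hx : x ∈ V) (u u' v : Fin n → ℝ) :
    fderiv ℝ (fun y => g y (u + u') v) x =
      fderiv ℝ (fun y => g y u v) x + fderiv ℝ (fun y => g y u' v) x := by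
  rw [← fderiv_fun_add (hg.differentiableAt hx _ _) (hg.differentiableAt hx _ _)]
  exact Filter.EventuallyEq.fderiv_eq ((hg.eventually_bilin hx).mono fun y hy => hy.add_left _ _ _)

theorem fderiv_smul_left (hg : IsSmoothMetricOn g V) (hx : x ∈ V) (c : ℝ) (u v : Fin n → ℝ) :
    fderiv ℝ (fun y => g y (c • u) v) x = c • fderiv ℝ (fun y => g y u v) x := by
  rw [← fderiv_fun_const_smul (hg.differentiableAt hx _ _)]
  exact Filter.EventuallyEq.fderiv_eq ((hg.eventually_bilin hx).mono fun y hy => hy.smul_left _ _ _)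

theorem fderiv_symm (hg : IsSmoothMetricOn g V) (hx : x ∈ V) (u v : Fin n → ℝ) :
    fderiv ℝ (fun y => g y u v) x = fderiv ℝ (fun y => g y v u) x :=
  Filter.EventuallyEq.fderiv_eq ((hg.eventually_mem hx).mono
    fun y hy => hg.symm y hy _ _)

theorem koszul_add (hg : IsSmoothMetricOn g V) (hx : x ∈ V) (u v w w' : Fin n → ℝ) :
    koszul g x u v (w + w') = koszul g x u v w + koszul g x u v w' := by
  simp only [koszul, hg.fderiv_symm hx v (w + w'), hg.fderiv_symm hx u (w + w'),
    hg.fderiv_add_left hx, map_add, add_apply, hg.fderiv_symm hx v w,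
    hg.fderiv_symm hx u w, hg.fderiv_symm hx v w', hg.fderiv_symm hx u w']
  ring

theorem koszul_smul (hg : IsSmoothMetricOn g V) (hx : x ∈ V) (c : ℝ) (u v w : Fin n → ℝ) :
    koszul g x u v (c • w) = c * koszul g x u v w := by
  simp only [koszul, hg.fderiv_symm hx v (c • w), hg.fderiv_symm hx u (c • w),
    hg.fderiv_smul_left hx, map_smul, smul_apply, hg.fderiv_symm hx v w,
    hg.fderiv_symm hx u w, smul_eq_mul]
  ring

theorem koszul_add_left (hg : IsSmoothMetricOn g V) (hx : x ∈ V) (u u' v w : Fin n → ℝ) :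
    koszul g x (u + u') v w = koszul g x u v w + koszul g x u' v w := by
  simp only [koszul, hg.fderiv_add_left hx, map_add, add_apply]
  ring

theorem koszul_smul_left (hg : IsSmoothMetricOn g V) (hx : x ∈ V) (c : ℝ) (u v w : Fin n → ℝ) :
    koszul g x (c • u) v w = c * koszul g x u v w := by
  simp only [koszul, hg.fderiv_smul_left hx, map_smul, smul_apply, smul_eq_mul]
  ring

theorem koszul_symm (hg : IsSmoothMetricOn g V) (hx : x ∈ V) (u v w : Fin n → ℝ) :
    koszul g x u v w = koszul g x v u w := by
  simp only [koszul, hg.fderiv_symm hx u v]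
  ring

theorem christoffel_symm (hg : IsSmoothMetricOn g V) (hx : x ∈ V) (u v : Fin n → ℝ) :
    christoffel g x u v = christoffel g x v u := by
  unfold christoffel
  congr 1
  funext k
  exact hg.koszul_symm hx _ _ _

/-- The inverse Gram matrix yields the identity on basis vectors; it extends to all `w` because
`koszul` is linear in its last argument. -/
theorem apply_christoffel (hg : IsSmoothMetricOn g V) (hx : x ∈ V) (u v w : Fin n → ℝ) :
    g x (christoffel g x u v) w = koszul g x u v w := by
  rw [hg.symm x hx, hg.eq_gram hx, christoffel, Matrix.mulVec_mulVec,
    Matrix.mul_nonsing_inv _ (isUnit_iff_ne_zero.2 (hg.det_ne_zero hx)), Matrix.one_mulVec]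
  let L : (Fin n → ℝ) →ₗ[ℝ] ℝ :=
    { toFun := fun w => koszul g x u v w
      map_add' := hg.koszul_add hx u v
      map_smul' := fun c w => hg.koszul_smul hx c u v w }
  have : koszul g x u v w = L w := rfl
  rw [this, eq_sum_single w, map_sum]
  simp only [map_smul, smul_eq_mul, dotProduct]
  rw [← eq_sum_single w]
  rfl

/-- Linearity in the first argument is tested by pairing with an arbitrary vector, using
nondegeneracy; the second argument follows by symmetry. -/
theorem christoffel_bilin (hg : IsSmoothMetricOn g V) (hx : x ∈ V) :
    IsBilin (christoffel g x) := by
  have h1 : ∀ u u' v, christoffel g x (u + u') v = christoffel g x u v + christoffel g x u' v := by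
    intro u u' v
    refine hg.ext hx fun w => ?_
    rw [(hg.bilin x hx).add_left]
    simp only [hg.apply_christoffel hx, hg.koszul_add_left hx]
  have h2 : ∀ (c : ℝ) u v, christoffel g x (c • u) v = c • christoffel g x u v := by
    intro c u v
    refine hg.ext hx fun w => ?_
    rw [(hg.bilin x hx).smul_left]
    simp only [hg.apply_christoffel hx, hg.koszul_smul_left hx, smul_eq_mul]
  refine .mk' h1 h2 (fun u v v' => ?_) (fun c u v => ?_)
  · rw [hg.christoffel_symm hx, h1, hg.christoffel_symm hx v, hg.christoffel_symm hx v']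
  · rw [hg.christoffel_symm hx, h2, hg.christoffel_symm hx v]

theorem koszul_smooth (hg : IsSmoothMetricOn g V) (hx : x ∈ V) (u v w : Fin n → ℝ) :
    ContDiffAt ℝ ∞ (fun y => koszul g y u v w) x := by
  unfold koszul
  have h : ∀ a b c : Fin n → ℝ, ContDiffAt ℝ ∞ (fun y => fderiv ℝ (fun y => g y a b) y c) x :=
    fun a b c => (hg.smooth x hx a b).fderiv_smooth.clm_apply contDiffAt_const
  exact (((h _ _ _).add (h _ _ _)).sub (h _ _ _)).div_const _

theorem christoffel_smooth (hg : IsSmoothMetricOn g V) (hx : x ∈ V) (u v : Fin n → ℝ) :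
    ContDiffAt ℝ ∞ (fun y => christoffel g y u v) x := by
  rw [contDiffAt_pi]
  intro k
  simp only [christoffel, Matrix.mulVec, dotProduct]
  refine ContDiffAt.sum fun j _ => (contDiffAt_inv_apply (fun a b => ?_)
    (hg.det_ne_zero hx) k j).mul (hg.koszul_smooth hx _ _ _)
  exact hg.smooth x hx _ _

theorem eventually_christoffel_bilin (hg : IsSmoothMetricOn g V) (hx : x ∈ V) :
    ∀ᶠ y in 𝓝 x, IsBilin (christoffel g y) :=
  (hg.eventually_mem hx).mono fun _ hy => hg.christoffel_bilin hy

end IsSmoothMetricOn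

end ChartGeometry

end

/-! ### Tensoriality of the curvature and its invariance under local isometries -/

noncomputable section

namespace ChartGeometry

open Filter Topology

variable {n : ℕ}

theorem two_le_infty : minSmoothness ℝ 2 ≤ ∞ := by
  simp only [minSmoothness_of_isRCLikeNormedField]
  exact WithTop.coe_le_coe.2 (le_top (a := (2 : ℕ∞)))

theorem IsMultilin.of_add_smul {r : ℕ} {T : (Fin r → Fin n → ℝ) → ℝ}
    (h : ∀ v s a (c : ℝ) b, T (Function.update v s (a + c • b)) =
      T (Function.update v s a) + c * T (Function.update v s b)) : IsMultilin T := by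
  have h0 : ∀ v s, T (Function.update v s 0) = 0 := by
    intro v s
    have := h v s 0 1 0
    simp at this
    exact this
  refine ⟨{ toFun := T
            map_update_add' := ?_
            map_update_smul' := ?_ }, fun v => rfl⟩
  · intro inst v s a b
    obtain rfl := Subsingleton.elim inst (instDecidableEqFin r)
    simpa using h v s a 1 b
  · intro inst v s c b
    obtain rfl := Subsingleton.elim inst (instDecidableEqFin r)
    have := h v s 0 c b
    rwa [h0, zero_add, zero_add] at this

theorem IsMultilin.add_smul {r : ℕ} {T : (Fin r → Fin n → ℝ) → ℝ} (h : IsMultilin T)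
    (v : Fin r → Fin n → ℝ) (s : Fin r) (a : Fin n → ℝ) (c : ℝ) (b : Fin n → ℝ) :
    T (Function.update v s (a + c • b)) =
      T (Function.update v s a) + c * T (Function.update v s b) := by
  obtain ⟨m, hm⟩ := h
  simp only [hm]
  rw [m.map_update_add, m.map_update_smul, smul_eq_mul]

theorem IsMultilin.update_add {r : ℕ} {T : (Fin r → Fin n → ℝ) → ℝ} (h : IsMultilin T)
    (v : Fin r → Fin n → ℝ) (s : Fin r) (a b : Fin n → ℝ) :
    T (Function.update v s (a + b)) = T (Function.update v s a) + T (Function.update v s b) := by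
  simpa using h.add_smul v s a 1 b

theorem IsBilin.add_smul_left {F : Type*} [NormedAddCommGroup F] [NormedSpace ℝ F]
    {b : (Fin n → ℝ) → (Fin n → ℝ) → F} (h : IsBilin b) (u : Fin n → ℝ) (c : ℝ)
    (u' v : Fin n → ℝ) : b (u + c • u') v = b u v + c • b u' v := by
  rw [h.add_left, h.smul_left]

theorem IsBilin.add_smul_right {F : Type*} [NormedAddCommGroup F] [NormedSpace ℝ F]
    {b : (Fin n → ℝ) → (Fin n → ℝ) → F} (h : IsBilin b) (u v : Fin n → ℝ) (c : ℝ)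
    (v' : Fin n → ℝ) : b u (v + c • v') = b u v + c • b u v' := by
  rw [h.add_right, h.smul_right]

namespace IsSmoothMetricOn

variable {g : (Fin n → ℝ) → (Fin n → ℝ) → (Fin n → ℝ) → ℝ} {V : Set (Fin n → ℝ)}
  {x : Fin n → ℝ}

theorem christoffel_differentiableAt (hg : IsSmoothMetricOn g V) (hx : x ∈ V)
    (u v : Fin n → ℝ) : DifferentiableAt ℝ (fun y => christoffel g y u v) x :=
  (hg.christoffel_smooth hx u v).differentiableAt (by simp)

theorem fderiv_christoffel_left (hg : IsSmoothMetricOn g V) (hx : x ∈ V) (u : Fin n → ℝ) (c : ℝ)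
    (u' v : Fin n → ℝ) : fderiv ℝ (fun y => christoffel g y (u + c • u') v) x =
      fderiv ℝ (fun y => christoffel g y u v) x + c • fderiv ℝ (fun y => christoffel g y u' v) x := by
  have hd := hg.christoffel_differentiableAt hx
  rw [← fderiv_fun_const_smul (hd _ _), ← fderiv_fun_add (hd _ _) ((hd _ _).fun_const_smul c)]
  exact Filter.EventuallyEq.fderiv_eq ((hg.eventually_christoffel_bilin hx).mono
    fun y hy => hy.add_smul_left _ _ _ _)

theorem fderiv_christoffel_right (hg : IsSmoothMetricOn g V) (hx : x ∈ V) (u v : Fin n → ℝ)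
    (c : ℝ) (v' : Fin n → ℝ) : fderiv ℝ (fun y => christoffel g y u (v + c • v')) x =
      fderiv ℝ (fun y => christoffel g y u v) x + c • fderiv ℝ (fun y => christoffel g y u v') x := by
  have hd := hg.christoffel_differentiableAt hx
  rw [← fderiv_fun_const_smul (hd _ _), ← fderiv_fun_add (hd _ _) ((hd _ _).fun_const_smul c)]
  exact Filter.EventuallyEq.fderiv_eq ((hg.eventually_christoffel_bilin hx).mono
    fun y hy => hy.add_smul_right _ _ _ _)

theorem curvature_left (hg : IsSmoothMetricOn g V) (hx : x ∈ V) (u : Fin n → ℝ) (c : ℝ)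
    (u' v w : Fin n → ℝ) : curvature g x (u + c • u') v w =
      curvature g x u v w + c • curvature g x u' v w := by
  have hb := hg.christoffel_bilin hx
  simp only [curvature, hg.fderiv_christoffel_left hx, hb.add_smul_left, hb.add_smul_right,
    map_add, map_smul, add_apply, smul_apply, smul_sub, smul_add]
  abel

theorem curvature_antisymm (u v w : Fin n → ℝ) :
    curvature g x u v w = -curvature g x v u w := by
  simp only [curvature]
  abel

theorem curvature_mid (hg : IsSmoothMetricOn g V) (hx : x ∈ V) (u v : Fin n → ℝ) (c : ℝ)
    (v' w : Fin n → ℝ) : curvature g x u (v + c • v') w =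
      curvature g x u v w + c • curvature g x u v' w := by
  rw [curvature_antisymm, hg.curvature_left hx, curvature_antisymm v, curvature_antisymm v',
    smul_neg, neg_add, neg_neg, neg_neg]

theorem curvature_right (hg : IsSmoothMetricOn g V) (hx : x ∈ V) (u v w : Fin n → ℝ) (c : ℝ)
    (w' : Fin n → ℝ) : curvature g x u v (w + c • w') =
      curvature g x u v w + c • curvature g x u v w' := by
  have hb := hg.christoffel_bilin hx
  simp only [curvature, hg.fderiv_christoffel_right hx, hb.add_smul_right,
    add_apply, smul_apply, smul_sub, smul_add]
  abel

theorem curvature_smooth (hg : IsSmoothMetricOn g V) (hx : x ∈ V) (u v w : Fin n → ℝ) :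
    ContDiffAt ℝ ∞ (fun y => curvature g y u v w) x := by
  have h : ∀ a b c, ContDiffAt ℝ ∞ (fun y => fderiv ℝ (fun y => christoffel g y a b) y c) x :=
    fun a b c => (hg.christoffel_smooth hx a b).fderiv_smooth.clm_apply contDiffAt_const
  have h2 : ∀ a b c, ContDiffAt ℝ ∞ (fun y => christoffel g y a (christoffel g y b c)) x := by
    intro a b c
    have : ContDiffAt ℝ ∞ (fun y => ∑ i, christoffel g y b c i •
        christoffel g y a (Pi.single i 1)) x :=
      ContDiffAt.sum fun i _ => (contDiffAt_pi.1 (hg.christoffel_smooth hx b c) i).smul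
        (hg.christoffel_smooth hx a _)
    exact this.congr_of_eventuallyEq ((hg.eventually_christoffel_bilin hx).mono
      fun y hy => hy.expand_right _ _)
  exact (((h _ _ _).sub (h _ _ _)).add (h2 _ _ _)).sub (h2 _ _ _)

theorem riemann_tensor (hg : IsSmoothMetricOn g V) : IsSmoothTensorOn (riemann g) V := by
  refine ⟨fun x hx => .of_add_smul fun v s a c b => ?_, fun x hx v => ?_⟩
  · have hb := hg.bilin x hx
    fin_cases s <;> simp [riemann, Function.update, hg.curvature_left hx, hg.curvature_mid hx,
      hg.curvature_right hx, hb.add_smul_left, hb.add_smul_right]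
  · have : ContDiffAt ℝ ∞ (fun y => ∑ i, curvature g y (v 0) (v 1) (v 2) i •
        g y (Pi.single i 1) (v 3)) x :=
      ContDiffAt.sum fun i _ => (contDiffAt_pi.1 (hg.curvature_smooth hx _ _ _) i).smul
        (hg.smooth x hx _ _)
    exact this.congr_of_eventuallyEq ((hg.eventually_bilin hx).mono
      fun y hy => hy.expand_left _ _)

theorem covDeriv_tensor (hg : IsSmoothMetricOn g V) {r : ℕ}
    {T : (Fin n → ℝ) → (Fin r → Fin n → ℝ) → ℝ} (hT : IsSmoothTensorOn T V) :
    IsSmoothTensorOn (covDeriv g T) V := by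
  have hev : ∀ x ∈ V, ∀ᶠ y in 𝓝 x, IsMultilin (T y) := fun x hx =>
    (hg.eventually_mem hx).mono fun y hy => hT.multilin y hy
  refine ⟨fun x hx => .of_add_smul fun v s a c b => ?_, fun x hx v => ?_⟩
  · have hb := hg.christoffel_bilin hx
    have hm := hT.multilin x hx
    refine Fin.cases ?_ (fun s => ?_) s
    · simp only [covDeriv, Function.update_self, Fin.tail_update_zero, hb.add_smul_left, map_add,
        map_smul, hm.add_smul, Finset.sum_add_distrib, Finset.mul_sum, mul_sub, smul_eq_mul]
      abel
    · have hne : (0 : Fin (r + 1)) ≠ s.succ := (Fin.succ_ne_zero s).symm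
      have hd : ∀ v, DifferentiableAt ℝ (fun y => T y v) x := fun v =>
        (hT.smooth x hx v).differentiableAt (by simp)
      have h1 : fderiv ℝ (fun y => T y (Function.update (Fin.tail v) s (a + c • b))) x =
          fderiv ℝ (fun y => T y (Function.update (Fin.tail v) s a)) x +
            c • fderiv ℝ (fun y => T y (Function.update (Fin.tail v) s b)) x := by
        rw [← fderiv_fun_const_smul (hd _), ← fderiv_fun_add (hd _) ((hd _).fun_const_smul c)]
        exact Filter.EventuallyEq.fderiv_eq ((hev x hx).mono fun y hy => hy.add_smul _ _ _ _ _)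
      simp only [covDeriv, Function.update_of_ne hne, Fin.tail_update_succ, h1, add_apply,
        smul_apply, smul_eq_mul]
      rw [mul_sub, Finset.mul_sum]
      have h2 : ∀ s', T x (Function.update (Function.update (Fin.tail v) s (a + c • b)) s'
            (christoffel g x (v 0) (Function.update (Fin.tail v) s (a + c • b) s'))) =
          T x (Function.update (Function.update (Fin.tail v) s a) s'
            (christoffel g x (v 0) (Function.update (Fin.tail v) s a s'))) +
          c * T x (Function.update (Function.update (Fin.tail v) s b) s'
            (christoffel g x (v 0) (Function.update (Fin.tail v) s b s'))) := by
        intro s'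
        by_cases hs : s' = s
        · subst hs
          simp only [Function.update_self, Function.update_idem, hb.add_smul_right, hm.add_smul]
        · simp only [Function.update_of_ne hs, Function.update_comm (Ne.symm hs), hm.add_smul]
      simp only [h2, Finset.sum_add_distrib]
      abel
  · have h1 : ContDiffAt ℝ ∞ (fun y => fderiv ℝ (fun y => T y (Fin.tail v)) y (v 0)) x :=
      (hT.smooth x hx _).fderiv_smooth.clm_apply contDiffAt_const
    refine h1.sub (ContDiffAt.sum fun s _ => ?_)
    have : ContDiffAt ℝ ∞ (fun y => ∑ i, christoffel g y (v 0) (Fin.tail v s) i •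
        T y (Function.update (Fin.tail v) s (Pi.single i 1))) x :=
      ContDiffAt.sum fun i _ => (contDiffAt_pi.1 (hg.christoffel_smooth hx _ _) i).smul
        (hT.smooth x hx _)
    exact this.congr_of_eventuallyEq ((hev x hx).mono fun y hy => hy.update_expand _ _ _)

theorem covDerivRiemann_tensor (hg : IsSmoothMetricOn g V) (k : ℕ) :
    IsSmoothTensorOn (covDerivRiemann g k) V := by
  induction k with
  | zero => exact hg.riemann_tensor
  | succ k ih => exact hg.covDeriv_tensor ih

end IsSmoothMetricOn

/-- `φ` is a local isometry from `(V', g')` to `(V, g)`. -/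
structure IsLocalIsometry (φ : (Fin n → ℝ) → Fin n → ℝ)
    (g' : (Fin n → ℝ) → (Fin n → ℝ) → (Fin n → ℝ) → ℝ) (V' : Set (Fin n → ℝ))
    (g : (Fin n → ℝ) → (Fin n → ℝ) → (Fin n → ℝ) → ℝ) (V : Set (Fin n → ℝ)) : Prop where
  source : IsSmoothMetricOn g' V'
  target : IsSmoothMetricOn g V
  mapsTo : ∀ y ∈ V', φ y ∈ V
  smooth : ∀ y ∈ V', ContDiffAt ℝ ∞ φ y
  pullback : ∀ y ∈ V', ∀ u v, g' y u v = g (φ y) (fderiv ℝ φ y u) (fderiv ℝ φ y v)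

namespace IsLocalIsometry

variable {φ : (Fin n → ℝ) → Fin n → ℝ} {g' : (Fin n → ℝ) → (Fin n → ℝ) → (Fin n → ℝ) → ℝ}
  {V' : Set (Fin n → ℝ)} {g : (Fin n → ℝ) → (Fin n → ℝ) → (Fin n → ℝ) → ℝ}
  {V : Set (Fin n → ℝ)} {y : Fin n → ℝ}

/-- A kernel vector of `Dφ` would have zero `g'`-length, and the dimensions agree. Identities at `φ
y` can therefore be tested on vectors `Dφ w`. -/
theorem surjective (h : IsLocalIsometry φ g' V' g V) (hy : y ∈ V') :
    Function.Surjective (fderiv ℝ φ y) := by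
  have hinj : Function.Injective (fderiv ℝ φ y : (Fin n → ℝ) →ₗ[ℝ] (Fin n → ℝ)) := by
    rw [← LinearMap.ker_eq_bot, LinearMap.ker_eq_bot']
    intro u hu
    by_contra hne
    have := h.source.pos y hy u hne
    rw [h.pullback y hy] at this
    simp only [ContinuousLinearMap.coe_coe] at hu
    rw [hu, ← zero_smul ℝ (0 : Fin n → ℝ), (h.target.bilin _ (h.mapsTo y hy)).smul_left] at this
    simp at this
  exact LinearMap.injective_iff_surjective.1 hinj

theorem differentiableAt (h : IsLocalIsometry φ g' V' g V) (hy : y ∈ V') :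
    DifferentiableAt ℝ φ y := (h.smooth y hy).differentiableAt (by simp)

theorem fderiv_differentiableAt (h : IsLocalIsometry φ g' V' g V) (hy : y ∈ V')
    (u : Fin n → ℝ) : DifferentiableAt ℝ (fun z => fderiv ℝ φ z u) y :=
  ((h.smooth y hy).fderiv_smooth.clm_apply contDiffAt_const).differentiableAt (by simp)

/-- The second derivative of `φ`, in the form `(u, v) ↦ ∂_u (Dφ v)`. -/
theorem fderiv_fderiv_apply (h : IsLocalIsometry φ g' V' g V) (hy : y ∈ V') (u v : Fin n → ℝ) :
    fderiv ℝ (fun z => fderiv ℝ φ z v) y u = fderiv ℝ (fderiv ℝ φ) y u v := by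
  have hd : DifferentiableAt ℝ (fderiv ℝ φ) y :=
    (h.smooth y hy).fderiv_smooth.differentiableAt (by simp)
  rw [fderiv_clm_apply hd (differentiableAt_const v)]
  simp

theorem fderiv_fderiv_symm (h : IsLocalIsometry φ g' V' g V) (hy : y ∈ V') (u v : Fin n → ℝ) :
    fderiv ℝ (fun z => fderiv ℝ φ z v) y u = fderiv ℝ (fun z => fderiv ℝ φ z u) y v := by
  rw [h.fderiv_fderiv_apply hy, h.fderiv_fderiv_apply hy]
  exact ((h.smooth y hy).isSymmSndFDerivAt two_le_infty) u v

theorem fderiv_third_symm (h : IsLocalIsometry φ g' V' g V) (hy : y ∈ V') (u v w : Fin n → ℝ) :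
    fderiv ℝ (fun x => fderiv ℝ (fun z => fderiv ℝ φ z w) x v) y u =
      fderiv ℝ (fun x => fderiv ℝ (fun z => fderiv ℝ φ z w) x u) y v := by
  have hs : ContDiffAt ℝ ∞ (fun z => fderiv ℝ φ z w) y :=
    (h.smooth y hy).fderiv_smooth.clm_apply contDiffAt_const
  have hd : DifferentiableAt ℝ (fderiv ℝ (fun z => fderiv ℝ φ z w)) y :=
    hs.fderiv_smooth.differentiableAt (by simp)
  rw [fderiv_clm_apply hd (differentiableAt_const v), fderiv_clm_apply hd (differentiableAt_const u)]
  simpa using (hs.isSymmSndFDerivAt two_le_infty) u v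

theorem fderiv_metric (h : IsLocalIsometry φ g' V' g V) (hy : y ∈ V') (u v w : Fin n → ℝ) :
    fderiv ℝ (fun z => g' z v w) y u =
      fderiv ℝ (fun x => g x (fderiv ℝ φ y v) (fderiv ℝ φ y w)) (φ y) (fderiv ℝ φ y u)
        + g (φ y) (fderiv ℝ (fun z => fderiv ℝ φ z v) y u) (fderiv ℝ φ y w)
        + g (φ y) (fderiv ℝ φ y v) (fderiv ℝ (fun z => fderiv ℝ φ z w) y u) := by
  have hev : (fun z => g' z v w) =ᶠ[𝓝 y] fun z => g (φ z) (fderiv ℝ φ z v) (fderiv ℝ φ z w) :=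
    (h.source.eventually_mem hy).mono fun z hz => h.pullback z hz v w
  rw [hev.fderiv_eq]
  exact (hasFDerivAt_bilin (h.target.eventually_bilin (h.mapsTo y hy))
    (fun u v => h.target.differentiableAt (h.mapsTo y hy) u v) (h.differentiableAt hy)
    (h.fderiv_differentiableAt hy v) (h.fderiv_differentiableAt hy w)).2 u

/-- Of the six terms containing second derivatives of `φ`, four cancel in pairs by symmetry and the
other two coincide. -/
theorem koszul_eq (h : IsLocalIsometry φ g' V' g V) (hy : y ∈ V') (u v w : Fin n → ℝ) :
    koszul g' y u v w = koszul g (φ y) (fderiv ℝ φ y u) (fderiv ℝ φ y v) (fderiv ℝ φ y w) +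
      g (φ y) (fderiv ℝ (fun z => fderiv ℝ φ z v) y u) (fderiv ℝ φ y w) := by
  simp only [koszul, h.fderiv_metric hy]
  rw [h.fderiv_fderiv_symm hy w u, h.fderiv_fderiv_symm hy w v, h.fderiv_fderiv_symm hy v u,
    h.target.symm _ (h.mapsTo y hy) (fderiv ℝ φ y v) (fderiv ℝ (fun z => fderiv ℝ φ z w) y u)]
  ring

theorem christoffel_eq (h : IsLocalIsometry φ g' V' g V) (hy : y ∈ V') (u v : Fin n → ℝ) :
    fderiv ℝ φ y (christoffel g' y u v) =
      christoffel g (φ y) (fderiv ℝ φ y u) (fderiv ℝ φ y v)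
        + fderiv ℝ (fun z => fderiv ℝ φ z v) y u := by
  refine h.target.ext (h.mapsTo y hy) fun w => ?_
  obtain ⟨w, rfl⟩ := h.surjective hy w
  rw [← h.pullback y hy, h.source.apply_christoffel hy, h.koszul_eq hy,
    (h.target.bilin _ (h.mapsTo y hy)).add_left, h.target.apply_christoffel (h.mapsTo y hy)]

/-- Differentiate the transformation law of the Christoffel symbols. After antisymmetrization in `u,
v` the third derivatives of `φ` cancel, and the second derivatives cancel against those produced by
the terms quadratic in the symbols. -/
theorem curvature_eq (h : IsLocalIsometry φ g' V' g V) (hy : y ∈ V') (u v w : Fin n → ℝ) :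
    fderiv ℝ φ y (curvature g' y u v w) =
      curvature g (φ y) (fderiv ℝ φ y u) (fderiv ℝ φ y v) (fderiv ℝ φ y w) := by
  have hφy := h.mapsTo y hy
  have hb := h.target.christoffel_bilin hφy
  have hderiv : ∀ u v : Fin n → ℝ, fderiv ℝ φ y (fderiv ℝ (fun z => christoffel g' z v w) y u) =
      fderiv ℝ (fun x => christoffel g x (fderiv ℝ φ y v) (fderiv ℝ φ y w)) (φ y) (fderiv ℝ φ y u)
      + christoffel g (φ y) (fderiv ℝ (fun z => fderiv ℝ φ z v) y u) (fderiv ℝ φ y w)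
      + christoffel g (φ y) (fderiv ℝ φ y v) (fderiv ℝ (fun z => fderiv ℝ φ z w) y u)
      + fderiv ℝ (fun x => fderiv ℝ (fun z => fderiv ℝ φ z w) x v) y u
      - fderiv ℝ (fun z => fderiv ℝ φ z (christoffel g' y v w)) y u := by
    intro u v
    have hev : (fun z => fderiv ℝ φ z (christoffel g' z v w)) =ᶠ[𝓝 y] fun z =>
        christoffel g (φ z) (fderiv ℝ φ z v) (fderiv ℝ φ z w)
          + fderiv ℝ (fun z => fderiv ℝ φ z w) z v :=
      (h.source.eventually_mem hy).mono fun z hz => h.christoffel_eq hz v w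
    have hd : DifferentiableAt ℝ (fderiv ℝ φ) y :=
      (h.smooth y hy).fderiv_smooth.differentiableAt (by simp)
    have hs : ContDiffAt ℝ ∞ (fun z => fderiv ℝ φ z w) y :=
      (h.smooth y hy).fderiv_smooth.clm_apply contDiffAt_const
    have hd2 : DifferentiableAt ℝ (fun x => fderiv ℝ (fun z => fderiv ℝ φ z w) x v) y :=
      (hs.fderiv_smooth.clm_apply contDiffAt_const).differentiableAt (by simp)
    have hbil := hasFDerivAt_bilin (h.target.eventually_christoffel_bilin hφy)
      (fun u v => h.target.christoffel_differentiableAt hφy u v) (h.differentiableAt hy)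
      (h.fderiv_differentiableAt hy v) (h.fderiv_differentiableAt hy w)
    have e1 := congrArg (fun L : (Fin n → ℝ) →L[ℝ] (Fin n → ℝ) => L u) (hev.fderiv_eq (𝕜 := ℝ))
    rw [fderiv_clm_apply hd (h.source.christoffel_differentiableAt hy v w),
      fderiv_fun_add hbil.1 hd2] at e1
    simp only [add_apply, ContinuousLinearMap.comp_apply, ContinuousLinearMap.flip_apply] at e1
    rw [hbil.2, ← h.fderiv_fderiv_apply hy] at e1
    rw [← e1]
    abel
  have hquad : ∀ u v : Fin n → ℝ, fderiv ℝ φ y (christoffel g' y u (christoffel g' y v w)) =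
      christoffel g (φ y) (fderiv ℝ φ y u) (christoffel g (φ y) (fderiv ℝ φ y v) (fderiv ℝ φ y w))
      + christoffel g (φ y) (fderiv ℝ φ y u) (fderiv ℝ (fun z => fderiv ℝ φ z w) y v)
      + fderiv ℝ (fun z => fderiv ℝ φ z (christoffel g' y v w)) y u := by
    intro u v
    rw [h.christoffel_eq hy u, h.christoffel_eq hy v, hb.add_right]
  simp only [curvature, map_add, map_sub, hderiv, hquad]
  rw [h.fderiv_fderiv_symm hy u v, h.fderiv_third_symm hy u v]
  abel

theorem riemann_eq (h : IsLocalIsometry φ g' V' g V) (hy : y ∈ V') (v : Fin 4 → Fin n → ℝ) :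
    riemann g' y v = riemann g (φ y) fun s => fderiv ℝ φ y (v s) := by
  rw [riemann, h.pullback y hy, h.curvature_eq hy]
  rfl

/-- The second derivatives of `φ` that arise from differentiating the arguments `Dφ vₛ` are exactly
the inhomogeneous terms of the transformation law of the Christoffel symbols. -/
theorem covDeriv_eq (h : IsLocalIsometry φ g' V' g V) {r : ℕ}
    {T' T : (Fin n → ℝ) → (Fin r → Fin n → ℝ) → ℝ} (hT : IsSmoothTensorOn T V)
    (hTT : ∀ y ∈ V', ∀ v, T' y v = T (φ y) fun s => fderiv ℝ φ y (v s)) (hy : y ∈ V')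
    (v : Fin (r + 1) → Fin n → ℝ) :
    covDeriv g' T' y v = covDeriv g T (φ y) fun s => fderiv ℝ φ y (v s) := by
  have hφy := h.mapsTo y hy
  have hev : (fun z => T' z (Fin.tail v)) =ᶠ[𝓝 y]
      fun z => T (φ z) fun s => fderiv ℝ φ z (Fin.tail v s) :=
    (h.source.eventually_mem hy).mono fun z hz => hTT z hz _
  have h1 := hasFDerivAt_multilin (T := T) (φ := φ) (y := y)
    (a := fun s z => fderiv ℝ φ z (Fin.tail v s))
    ((h.target.eventually_mem hφy).mono fun x hx => hT.multilin x hx)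
    (fun v => (hT.smooth _ hφy v).differentiableAt (by simp)) (h.differentiableAt hy)
    (fun s => h.fderiv_differentiableAt hy _) (v 0)
  have hupd : ∀ s c, (fun s' => fderiv ℝ φ y (Function.update (Fin.tail v) s c s')) =
      Function.update (fun s' => fderiv ℝ φ y (Fin.tail v s')) s (fderiv ℝ φ y c) := by
    intro s c
    funext s'
    by_cases hs : s' = s
    · subst hs; simp
    · simp [Function.update_of_ne hs]
  simp only [covDeriv]
  rw [hev.fderiv_eq, h1]
  simp only [hTT y hy, hupd, h.christoffel_eq hy, (hT.multilin _ hφy).update_add,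
    Finset.sum_add_distrib]
  have ht : Fin.tail (fun s => fderiv ℝ φ y (v s)) = fun s => fderiv ℝ φ y (Fin.tail v s) := rfl
  rw [ht]
  ring

theorem covDerivRiemann_eq (h : IsLocalIsometry φ g' V' g V) (k : ℕ) (hy : y ∈ V')
    (v : Fin (4 + k) → Fin n → ℝ) :
    covDerivRiemann g' k y v = covDerivRiemann g k (φ y) fun s => fderiv ℝ φ y (v s) := by
  induction k generalizing y with
  | zero => exact h.riemann_eq hy v
  | succ k ih =>
    exact h.covDeriv_eq (h.target.covDerivRiemann_tensor k) (fun y hy v => ih hy v) hy v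

/-- Every vector at `φ y` lifts to one of the same length at `y`. This carries a bound from a
well-chosen chart to an arbitrary one. -/
theorem normLE (h : IsLocalIsometry φ g' V' g V) (k : ℕ) (hy : y ∈ V') {C : ℝ}
    (hC : NormLE (g' y) (covDerivRiemann g' k y) C) :
    NormLE (g (φ y)) (covDerivRiemann g k (φ y)) C := by
  intro v
  choose u hu using fun s => h.surjective hy (v s)
  have := hC u
  rw [h.covDerivRiemann_eq k hy] at this
  simpa only [h.pullback y hy, hu] using this

end IsLocalIsometry

end ChartGeometry

end

noncomputable section

/-! ### Curvature bounds from jet bounds of the metric -/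

namespace SmoothBdd

variable {ι E : Type} [NormedAddCommGroup E] [NormedSpace ℝ E] {p : ι → E}

theorem det {n : ℕ} {A : ι → E → Matrix (Fin n) (Fin n) ℝ}
    (h : ∀ a b, SmoothBdd p (fun i x => A i x a b)) : SmoothBdd p (fun i x => (A i x).det) := by
  simp only [Matrix.det_apply']
  exact .sum _ fun σ _ => (const (c := fun _ => _) ⟨_, fun _ => le_rfl⟩).mul
    (.prod _ fun j _ => h _ _)

theorem inv_apply {n : ℕ} {A : ι → E → Matrix (Fin n) (Fin n) ℝ}
    (h : ∀ a b, SmoothBdd p (fun i x => A i x a b))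
    (hdet : ∃ c : ℝ, 0 < c ∧ ∀ i, c ≤ ‖(A i (p i)).det‖) (a b : Fin n) :
    SmoothBdd p (fun i x => (A i x)⁻¹ a b) := by
  simp only [Matrix.inv_def, Ring.inverse_eq_inv', Matrix.smul_apply, smul_eq_mul,
    Matrix.adjugate_apply]
  refine ((det h).inv hdet).mul (det fun a' b' => ?_)
  by_cases hb : a' = b
  · subst hb
    simp only [Matrix.updateRow_self]
    exact const (c := fun _ => _) ⟨_, fun _ => le_rfl⟩
  · simp only [Matrix.updateRow_ne hb]; exact h a' b'

theorem pi {n : ℕ} {f : ι → E → Fin n → ℝ} (h : ∀ k, SmoothBdd p (fun i x => f i x k)) :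
    SmoothBdd p f := by
  have : SmoothBdd p (fun i x => ∑ k, ContinuousLinearMap.single ℝ (fun _ : Fin n => ℝ) k
      (f i x k)) := .sum _ fun k _ => (h k).clm _
  refine this.congr fun i => .of_forall fun x => ?_
  simpa using Finset.univ_sum_single (f i x)

theorem component {n : ℕ} {f : ι → E → Fin n → ℝ} (h : SmoothBdd p f) (k : Fin n) :
    SmoothBdd p (fun i x => f i x k) :=
  h.clm (ContinuousLinearMap.proj (R := ℝ) (φ := fun _ : Fin n => ℝ) k)

end SmoothBdd

namespace ChartGeometry

open Filter Topology

/-- A family of smooth metrics `g i` near the points `p i` that have uniformly bounded jets and are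
uniformly bounded below at the points `p i`. -/
structure IsBoundedFamily {ι : Type} {n : ℕ} (p : ι → Fin n → ℝ)
    (g : ι → (Fin n → ℝ) → (Fin n → ℝ) → (Fin n → ℝ) → ℝ) (V : ι → Set (Fin n → ℝ)) : Prop where
  metric : ∀ i, IsSmoothMetricOn (g i) (V i)
  mem : ∀ i, p i ∈ V i
  bdd : ∀ u v, SmoothBdd p (fun i x => g i x u v)
  coercive : ∃ c : ℝ, 0 < c ∧ ∀ i u, c * ‖u‖ ^ 2 ≤ g i (p i) u u

namespace IsBoundedFamily

variable {ι : Type} {n : ℕ} {p : ι → Fin n → ℝ}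
  {g : ι → (Fin n → ℝ) → (Fin n → ℝ) → (Fin n → ℝ) → ℝ} {V : ι → Set (Fin n → ℝ)}

/-- If `A u` is a basis vector `e_b`, coercivity gives `c‖u‖² ≤ u_b ≤ ‖u‖`, so the entries of `A⁻¹`
are at most `c⁻¹`. This bounds `det A⁻¹` above, hence `det A` away from zero, which the jet bounds
for the inverse Gram matrix require. -/
theorem det_lower (h : IsBoundedFamily p g V) :
    ∃ c : ℝ, 0 < c ∧ ∀ i, c ≤ ‖(gram (g i) (p i)).det‖ := by
  obtain ⟨c, hc, hcoer⟩ := h.coercive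
  have hentry : ∀ i a b, |(gram (g i) (p i))⁻¹ a b| ≤ c⁻¹ := by
    intro i a b
    set A := gram (g i) (p i) with hA
    have hdet : A.det ≠ 0 := (h.metric i).det_ne_zero (h.mem i)
    set u : Fin n → ℝ := A⁻¹.mulVec (Pi.single b 1) with hu
    have hAu : A.mulVec u = Pi.single b 1 := by
      rw [hu, Matrix.mulVec_mulVec, Matrix.mul_nonsing_inv _ (isUnit_iff_ne_zero.2 hdet),
        Matrix.one_mulVec]
    have h1 := hcoer i u
    rw [(h.metric i).eq_gram (h.mem i), hAu, dotProduct_single, mul_one] at h1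
    have h2 : u b ≤ ‖u‖ := (le_abs_self _).trans (norm_le_pi_norm u b)
    have h3 : ‖u‖ ≤ c⁻¹ := by
      rcases eq_or_lt_of_le (norm_nonneg u) with h0 | h0
      · rw [← h0]; positivity
      · rw [← one_div, le_div_iff₀ hc]
        have : c * ‖u‖ ^ 2 ≤ ‖u‖ := h1.trans h2
        nlinarith
    have h4 : A⁻¹ a b = u a := by rw [hu, Matrix.mulVec_single_one]; rfl
    rw [h4]
    exact (norm_le_pi_norm u a).trans h3
  refine ⟨((Nat.factorial (Fintype.card (Fin n))) • c⁻¹ ^ Fintype.card (Fin n))⁻¹,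
    by positivity, fun i => ?_⟩
  have hdet : (gram (g i) (p i)).det ≠ 0 := (h.metric i).det_ne_zero (h.mem i)
  have h1 := Matrix.det_le (A := (gram (g i) (p i))⁻¹) (abv := AbsoluteValue.abs) (x := c⁻¹)
    (hentry i)
  rw [Matrix.det_nonsing_inv, Ring.inverse_eq_inv', AbsoluteValue.abs_apply, abs_inv] at h1
  rw [Real.norm_eq_abs]
  exact inv_le_of_inv_le₀ (abs_pos.2 hdet) h1

theorem koszul_bdd (h : IsBoundedFamily p g V) (u v w : Fin n → ℝ) :
    SmoothBdd p (fun i x => koszul (g i) x u v w) := by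
  have hd : ∀ a b c : Fin n → ℝ, SmoothBdd p (fun i x => fderiv ℝ (fun y => g i y a b) x c) :=
    fun a b c => (h.bdd a b).fderiv.apply_const c
  simp only [koszul, div_eq_mul_inv]
  exact (((hd _ _ _).add (hd _ _ _)).sub (hd _ _ _)).mul
    (.const (c := fun _ => _) ⟨_, fun _ => le_rfl⟩)

theorem christoffel_bdd (h : IsBoundedFamily p g V) (u v : Fin n → ℝ) :
    SmoothBdd p (fun i x => christoffel (g i) x u v) := by
  refine .pi fun k => ?_
  simp only [christoffel, Matrix.mulVec, dotProduct]
  exact .sum _ fun j _ => (SmoothBdd.inv_apply (fun a b => h.bdd _ _) h.det_lower k j).mul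
    (h.koszul_bdd _ _ _)

theorem curvature_bdd (h : IsBoundedFamily p g V) (u v w : Fin n → ℝ) :
    SmoothBdd p (fun i x => curvature (g i) x u v w) := by
  have hd : ∀ a b c : Fin n → ℝ,
      SmoothBdd p (fun i x => fderiv ℝ (fun y => christoffel (g i) y a b) x c) :=
    fun a b c => (h.christoffel_bdd a b).fderiv.apply_const c
  have h2 : ∀ a b c : Fin n → ℝ,
      SmoothBdd p (fun i x => christoffel (g i) x a (christoffel (g i) x b c)) := by
    intro a b c
    refine SmoothBdd.pi fun k => ?_
    have : SmoothBdd p (fun i x => ∑ j, christoffel (g i) x b c j *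
        christoffel (g i) x a (Pi.single j 1) k) :=
      .sum _ fun j _ => ((h.christoffel_bdd b c).component j).mul
        ((h.christoffel_bdd a _).component k)
    refine this.congr fun i => ((h.metric i).eventually_christoffel_bilin (h.mem i)).mono
      fun x hx => ?_
    simp only
    rw [hx.expand_right a (christoffel (g i) x b c), Finset.sum_apply]
    rfl
  exact (((hd _ _ _).sub (hd _ _ _)).add (h2 _ _ _)).sub (h2 _ _ _)

theorem riemann_bdd (h : IsBoundedFamily p g V) (v : Fin 4 → Fin n → ℝ) :
    SmoothBdd p (fun i x => riemann (g i) x v) := by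
  have : SmoothBdd p (fun i x => ∑ j, curvature (g i) x (v 0) (v 1) (v 2) j *
      g i x (Pi.single j 1) (v 3)) :=
    .sum _ fun j _ => ((h.curvature_bdd _ _ _).component j).mul (h.bdd _ _)
  exact this.congr fun i => ((h.metric i).eventually_bilin (h.mem i)).mono
    fun x hx => (hx.expand_left _ _).symm

theorem covDeriv_bdd (h : IsBoundedFamily p g V) {r : ℕ}
    {T : ι → (Fin n → ℝ) → (Fin r → Fin n → ℝ) → ℝ} (hT : ∀ i, IsSmoothTensorOn (T i) (V i))
    (hb : ∀ v, SmoothBdd p (fun i x => T i x v)) (v : Fin (r + 1) → Fin n → ℝ) :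
    SmoothBdd p (fun i x => covDeriv (g i) (T i) x v) := by
  refine ((hb _).fderiv.apply_const _).sub (.sum _ fun s _ => ?_)
  have : SmoothBdd p (fun i x => ∑ j, christoffel (g i) x (v 0) (Fin.tail v s) j *
      T i x (Function.update (Fin.tail v) s (Pi.single j 1))) :=
    .sum _ fun j _ => ((h.christoffel_bdd _ _).component j).mul (hb _)
  exact this.congr fun i => ((h.metric i).eventually_mem (h.mem i)).mono
    fun x hx => (((hT i).multilin x hx).update_expand _ _ _).symm

theorem covDerivRiemann_bdd (h : IsBoundedFamily p g V) (k : ℕ) (v : Fin (4 + k) → Fin n → ℝ) :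
    SmoothBdd p (fun i x => covDerivRiemann (g i) k x v) := by
  induction k with
  | zero => exact h.riemann_bdd v
  | succ k ih => exact h.covDeriv_bdd (fun i => (h.metric i).covDerivRiemann_tensor k) ih v

/-- The components in the standard basis are bounded, and coercivity bounds coordinate norms by
`g`-lengths, at the cost of `c^{-1/2}` per argument. -/
theorem exists_normLE (h : IsBoundedFamily p g V) (k : ℕ) :
    ∃ C : ℝ, ∀ i, NormLE (g i (p i)) (covDerivRiemann (g i) k (p i)) C := by
  obtain ⟨c, hc, hcoer⟩ := h.coercive
  choose B hB0 hB using fun f : Fin (4 + k) → Fin n =>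
    (h.covDerivRiemann_bdd k fun s => Pi.single (f s) 1).bound
  refine ⟨(∑ f, B f) * (Real.sqrt c)⁻¹ ^ (4 + k), fun i v => ?_⟩
  have hv : ∀ s, ‖v s‖ ≤ (Real.sqrt c)⁻¹ * Real.sqrt (g i (p i) (v s) (v s)) := by
    intro s
    rw [inv_mul_eq_div, le_div_iff₀ (Real.sqrt_pos.2 hc), mul_comm]
    apply Real.le_sqrt_of_sq_le
    rw [mul_pow, Real.sq_sqrt hc.le]
    exact hcoer i (v s)
  rw [(((h.metric i).covDerivRiemann_tensor k).multilin _ (h.mem i)).expand v]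
  calc |∑ f : Fin (4 + k) → Fin n, (∏ s, v s (f s)) •
        covDerivRiemann (g i) k (p i) fun s => Pi.single (f s) 1|
      ≤ ∑ f : Fin (4 + k) → Fin n, |(∏ s, v s (f s)) •
        covDerivRiemann (g i) k (p i) fun s => Pi.single (f s) 1| := Finset.abs_sum_le_sum_abs _ _
    _ ≤ ∑ f, (∏ s, ((Real.sqrt c)⁻¹ * Real.sqrt (g i (p i) (v s) (v s)))) * B f := by
        refine Finset.sum_le_sum fun f _ => ?_
        rw [smul_eq_mul, abs_mul, Finset.abs_prod]
        refine mul_le_mul ?_ (hB f i) (abs_nonneg _) (by positivity)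
        exact Finset.prod_le_prod (fun _ _ => abs_nonneg _)
          fun s _ => (norm_le_pi_norm (v s) (f s)).trans (hv s)
    _ = _ := by
        rw [← Finset.mul_sum, Finset.prod_mul_distrib, Finset.prod_const, Finset.card_univ,
          Fintype.card_fin]
        ring

end IsBoundedFamily

end ChartGeometry

end

noncomputable section

/-! ### Second derivatives along lines -/

open Filter Topology

/-- The second derivative at `0` of a function of one real variable. -/
def secondDeriv (f : ℝ → ℝ) : ℝ := deriv (deriv f) 0

theorem ContDiffAt.deriv_smooth {f : ℝ → ℝ} {x : ℝ} (h : ContDiffAt ℝ ∞ f x) :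
    ContDiffAt ℝ ∞ (deriv f) x :=
  h.fderiv_smooth.clm_apply contDiffAt_const

theorem secondDeriv_add {f g : ℝ → ℝ} (hf : ContDiffAt ℝ ∞ f 0) (hg : ContDiffAt ℝ ∞ g 0) :
    secondDeriv (fun r => f r + g r) = secondDeriv f + secondDeriv g := by
  have hev : deriv (fun r => f r + g r) =ᶠ[𝓝 0] fun r => deriv f r + deriv g r := by
    filter_upwards [eventually_differentiableAt hf, eventually_differentiableAt hg] with r h1 h2
    exact deriv_fun_add h1 h2
  rw [secondDeriv, hev.deriv_eq, deriv_fun_add (hf.deriv_smooth.differentiableAt (by simp))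
    (hg.deriv_smooth.differentiableAt (by simp))]
  rfl

theorem secondDeriv_const_mul (c : ℝ) (f : ℝ → ℝ) :
    secondDeriv (fun r => c * f r) = c * secondDeriv f := by
  have : deriv (fun r => c * f r) = fun r => c * deriv f r := by
    funext r; exact deriv_const_mul_field c
  rw [secondDeriv, this, deriv_const_mul_field]
  rfl

theorem secondDeriv_affine (a b : ℝ) : secondDeriv (fun r => a + b * r) = 0 := by
  have : deriv (fun r => a + b * r) = fun _ => b := by
    funext r
    simp [deriv_const_add]
  rw [secondDeriv, this, deriv_const]

theorem secondDeriv_sum {σ : Type*} (s : Finset σ) {f : σ → ℝ → ℝ}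
    (hf : ∀ j ∈ s, ContDiffAt ℝ ∞ (f j) 0) :
    secondDeriv (fun r => ∑ j ∈ s, f j r) = ∑ j ∈ s, secondDeriv (f j) := by
  classical
  induction s using Finset.induction_on with
  | empty => simpa using secondDeriv_affine 0 0
  | insert a s ha ih =>
    simp only [Finset.sum_insert ha]
    rw [secondDeriv_add (hf a (Finset.mem_insert_self _ _))
      (ContDiffAt.sum fun j hj => hf j (Finset.mem_insert_of_mem hj)),
      ih fun j hj => hf j (Finset.mem_insert_of_mem hj)]

theorem secondDeriv_log {f : ℝ → ℝ} (hf : ContDiffAt ℝ ∞ f 0) (h0 : 0 < f 0) :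
    secondDeriv (fun r => Real.log (f r)) = secondDeriv f / f 0 - (deriv f 0 / f 0) ^ 2 := by
  have hev : deriv (fun r => Real.log (f r)) =ᶠ[𝓝 0] fun r => deriv f r / f r := by
    filter_upwards [eventually_differentiableAt hf,
      hf.continuousAt.eventually_ne h0.ne'] with r h1 h2
    exact (h1.hasDerivAt.log h2).deriv
  rw [secondDeriv, hev.deriv_eq, deriv_fun_div (hf.deriv_smooth.differentiableAt (by simp))
    (hf.differentiableAt (by simp)) h0.ne', secondDeriv]
  field_simp

/-- Were it negative, the second derivative test would make `0` a local maximum as well, so `f`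
would be locally constant with second derivative zero. -/
theorem secondDeriv_nonneg {f : ℝ → ℝ} (hf : ContDiffAt ℝ ∞ f 0) (h : IsLocalMin f 0) :
    0 ≤ secondDeriv f := by
  by_contra hneg
  push Not at hneg
  have hmax := isLocalMax_of_deriv_deriv_neg hneg h.deriv_eq_zero hf.continuousAt
  have hconst : f =ᶠ[𝓝 0] fun _ => f 0 := by
    filter_upwards [h, hmax] with r h1 h2
    exact le_antisymm h2 h1
  have : secondDeriv f = 0 := by
    have h1 : deriv f =ᶠ[𝓝 0] deriv fun _ => f 0 := hconst.deriv
    rw [secondDeriv, h1.deriv_eq]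
    simp
  linarith

/-- Weighted Jensen inequality for the logarithm of a sum of exponentials. -/
theorem sum_mul_le_log_sum_exp {σ : Type*} (s : Finset σ) (hs : s.Nonempty) (x y : σ → ℝ) :
    Real.log (∑ j ∈ s, Real.exp (x j)) +
      ∑ j ∈ s, Real.exp (x j) / (∑ k ∈ s, Real.exp (x k)) * (y j - x j) ≤
        Real.log (∑ j ∈ s, Real.exp (y j)) := by
  set A := ∑ k ∈ s, Real.exp (x k) with hA
  have hApos : 0 < A := Finset.sum_pos (fun _ _ => Real.exp_pos _) hs
  have hBpos : 0 < ∑ k ∈ s, Real.exp (y k) := Finset.sum_pos (fun _ _ => Real.exp_pos _) hs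
  have hsum : ∑ j ∈ s, Real.exp (x j) / A = 1 := by
    rw [← Finset.sum_div]; exact div_self hApos.ne'
  have hj := convexOn_exp.map_sum_le (t := s) (w := fun j => Real.exp (x j) / A)
    (p := fun j => y j - x j) (fun j _ => by positivity) hsum (fun _ _ => Set.mem_univ _)
  simp only [smul_eq_mul] at hj
  have e : ∑ j ∈ s, Real.exp (x j) / A * Real.exp (y j - x j) =
      (∑ j ∈ s, Real.exp (y j)) / A := by
    rw [Finset.sum_div]
    refine Finset.sum_congr rfl fun j _ => ?_
    rw [Real.exp_sub]
    field_simp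
  rw [e, le_div_iff₀ hApos] at hj
  have := Real.log_le_log (by positivity) hj
  rw [Real.log_mul (Real.exp_pos _).ne' hApos.ne', Real.log_exp] at this
  linarith

/-- With the weights frozen at `0`, Jensen's inequality says that log-sum-exp minus the weighted sum
of the `f j` has a minimum at `0`, where the second derivative is nonnegative. -/
theorem secondDeriv_log_sum_exp {σ : Type*} (s : Finset σ) (hs : s.Nonempty) {f : σ → ℝ → ℝ}
    (hf : ∀ j ∈ s, ContDiffAt ℝ ∞ (f j) 0) :
    ∑ j ∈ s, Real.exp (f j 0) / (∑ k ∈ s, Real.exp (f k 0)) * secondDeriv (f j) ≤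
      secondDeriv (fun r => Real.log (∑ j ∈ s, Real.exp (f j r))) := by
  set q : σ → ℝ := fun j => Real.exp (f j 0) / (∑ k ∈ s, Real.exp (f k 0)) with hq
  have hF : ContDiffAt ℝ ∞ (fun r => Real.log (∑ j ∈ s, Real.exp (f j r))) 0 :=
    (ContDiffAt.sum fun j hj => (hf j hj).exp).log
      (Finset.sum_pos (fun _ _ => Real.exp_pos _) hs).ne'
  have hterm : ∀ j ∈ s, ContDiffAt ℝ ∞ (fun r => -q j * f j r) 0 :=
    fun j hj => contDiffAt_const.mul (hf j hj)
  have hG : ContDiffAt ℝ ∞ (fun r => ∑ j ∈ s, -q j * f j r) 0 := ContDiffAt.sum hterm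
  have hmin : IsLocalMin (fun r => Real.log (∑ j ∈ s, Real.exp (f j r)) +
      ∑ j ∈ s, -q j * f j r) 0 := by
    refine Filter.Eventually.of_forall fun r => ?_
    have h1 := sum_mul_le_log_sum_exp s hs (fun j => f j 0) (fun j => f j r)
    simp only [mul_sub, Finset.sum_sub_distrib] at h1
    simp only [neg_mul, Finset.sum_neg_distrib, hq]
    linarith
  have h2 := secondDeriv_nonneg (hF.add hG) hmin
  rw [secondDeriv_add hF hG, secondDeriv_sum s hterm] at h2
  simp only [secondDeriv_const_mul] at h2
  simp only [neg_mul, Finset.sum_neg_distrib] at h2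
  linarith

theorem fderiv_fderiv_eq_secondDeriv {E : Type*} [NormedAddCommGroup E] [NormedSpace ℝ E]
    {Φ : E → ℝ} (h : ContDiffAt ℝ ∞ Φ 0) (u : E) :
    fderiv ℝ (fderiv ℝ Φ) 0 u u = secondDeriv (fun r => Φ (r • u)) := by
  have hline : ∀ r : ℝ, HasDerivAt (fun r : ℝ => r • u) u r := fun r => by
    simpa using (hasDerivAt_id r).smul_const u
  have hcont : Tendsto (fun r : ℝ => r • u) (𝓝 0) (𝓝 0) := by
    have := (hline 0).continuousAt.tendsto
    simpa using this
  have hev : deriv (fun r : ℝ => Φ (r • u)) =ᶠ[𝓝 0] fun r => fderiv ℝ Φ (r • u) u := by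
    filter_upwards [hcont.eventually (eventually_differentiableAt h)] with r hr
    exact (hr.hasFDerivAt.comp_hasDerivAt r (hline r)).deriv
  have hd : DifferentiableAt ℝ (fderiv ℝ Φ) 0 := h.fderiv_smooth.differentiableAt (by simp)
  have hd' : HasFDerivAt (fun x => fderiv ℝ Φ x u) ((fderiv ℝ (fderiv ℝ Φ) 0).flip u)
      ((0 : ℝ) • u) := by
    rw [zero_smul]
    exact (hd.hasFDerivAt.clm_apply (hasFDerivAt_const u 0)).congr_fderiv (by simp)
  rw [secondDeriv, hev.deriv_eq]
  exact (hd'.comp_hasDerivAt (0 : ℝ) (hline 0)).deriv.symm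

end

noncomputable section

/-! ### The local model of the potential and of the defining equation -/

namespace ToricDegeneration

open Filter Topology

variable {l : ℕ}

/-- The complex linear form with coefficients `r`. -/
def linForm (r : Fin l → ℝ) : (Fin l → ℂ) →L[ℂ] ℂ :=
  ∑ i, (r i : ℂ) • ContinuousLinearMap.proj (R := ℂ) (φ := fun _ : Fin l => ℂ) i

theorem linForm_apply (r : Fin l → ℝ) (y : Fin l → ℂ) : linForm r y = ∑ i, (r i : ℂ) * y i := by
  simp [linForm]

/-- Local data at a point of the torus: `coef m` are the normalized values of the terms, `rho m` the
exponents of the terms in adapted coordinates, and `simplex` the adapted simplex with the vertices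
`base` and `vert i`. The constant `C` bounds the geometry. -/
structure ModelPoint (Δ : Finset (Fin l → ℤ)) (Z : Finset (Finset (Fin l → ℤ))) (κ C : ℝ) where
  /-- the normalized values of the terms -/
  coef : (Fin l → ℤ) → ℂ
  /-- the exponents of the terms in adapted coordinates -/
  rho : (Fin l → ℤ) → Fin l → ℝ
  /-- the adapted simplex -/
  simplex : Finset (Fin l → ℤ)
  /-- a vertex with a large term -/
  base : Fin l → ℤ
  /-- the other vertices -/
  vert : Fin l → Fin l → ℤ
  subset : ∀ S ∈ Z, S ⊆ Δ
  card : ∀ S ∈ Z, S.card = l + 1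
  mem : simplex ∈ Z
  coef_ne : ∀ m ∈ Δ, coef m ≠ 0
  sum_coef : ∑ m ∈ Δ, ‖coef m‖ ^ 2 = 1
  base_mem : base ∈ simplex
  vert_mem : ∀ i, vert i ∈ simplex
  vert_inj : Function.Injective vert
  vert_ne : ∀ i, vert i ≠ base
  rho_base : rho base = 0
  rho_vert : ∀ i, rho (vert i) = Pi.single i (κ - Real.log (‖coef (vert i)‖ ^ 2))
  -- The last three fields record adaptedness: exponents are `O(a_m)`, so the smallness of `coef m`
  -- beats them; the base term is bounded below; and the weight of `simplex` dominates every other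
  -- weight up to a constant.
  rho_le : ∀ m ∈ Δ, ∀ i, |rho m i| ≤ C * (κ - Real.log (‖coef m‖ ^ 2))
  base_le : κ - Real.log (‖coef base‖ ^ 2) ≤ C
  prod_le : ∀ S ∈ Z, ∏ m ∈ simplex, (κ - Real.log (‖coef m‖ ^ 2)) ≤
    C * ∏ m ∈ S, (κ - Real.log (‖coef m‖ ^ 2))

namespace ModelPoint

variable {Δ : Finset (Fin l → ℤ)} {Z : Finset (Finset (Fin l → ℤ))} {κ C : ℝ}

/-- The value of `a_m` at the point. -/
def a₀ (P : ModelPoint Δ Z κ C) (m : Fin l → ℤ) : ℝ := κ - Real.log (‖P.coef m‖ ^ 2)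

/-- The normalized term. -/
def u (P : ModelPoint Δ Z κ C) (m : Fin l → ℤ) (y : Fin l → ℂ) : ℂ :=
  P.coef m * Complex.exp (linForm (P.rho m) y)

/-- The logarithm of the sum of the squared norms of the normalized terms. -/
def logSum (P : ModelPoint Δ Z κ C) (y : Fin l → ℂ) : ℝ := Real.log (∑ m ∈ Δ, ‖P.u m y‖ ^ 2)

/-- The function `a_m` in adapted coordinates. -/
def aFun (P : ModelPoint Δ Z κ C) (m : Fin l → ℤ) (y : Fin l → ℂ) : ℝ :=
  P.a₀ m + P.logSum y - 2 * (linForm (P.rho m) y).re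

/-- The potential in adapted coordinates, up to a pluriharmonic function. -/
def pot (P : ModelPoint Δ Z κ C) (y : Fin l → ℂ) : ℝ :=
  P.logSum y + Real.log (∑ S ∈ Z, ((∏ m ∈ S, P.aFun m y)⁻¹) ^ 2)

/-- The defining equation in adapted coordinates. -/
def sig (P : ModelPoint Δ Z κ C) (y : Fin l → ℂ) : ℂ := ∑ m ∈ Δ, P.u m y

theorem simplex_subset (P : ModelPoint Δ Z κ C) : P.simplex ⊆ Δ := P.subset _ P.mem

theorem norm_coef_le (P : ModelPoint Δ Z κ C) {m : Fin l → ℤ} (hm : m ∈ Δ) : ‖P.coef m‖ ≤ 1 := by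
  have h := Finset.single_le_sum (f := fun m => ‖P.coef m‖ ^ 2) (fun _ _ => by positivity) hm
  rw [P.sum_coef] at h
  exact (sq_le_one_iff₀ (norm_nonneg _)).1 h

theorem norm_coef_pos (P : ModelPoint Δ Z κ C) {m : Fin l → ℤ} (hm : m ∈ Δ) : 0 < ‖P.coef m‖ :=
  norm_pos_iff.2 (P.coef_ne m hm)

theorem le_a₀ (P : ModelPoint Δ Z κ C) {m : Fin l → ℤ} (hm : m ∈ Δ) : κ ≤ P.a₀ m := by
  have := Real.log_nonpos (by positivity) (pow_le_one₀ (norm_nonneg _) (P.norm_coef_le hm) (n := 2))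
  unfold a₀
  linarith

theorem norm_coef_eq (P : ModelPoint Δ Z κ C) {m : Fin l → ℤ} (hm : m ∈ Δ) :
    ‖P.coef m‖ = Real.exp ((κ - P.a₀ m) / 2) := by
  have := P.norm_coef_pos hm
  rw [a₀, Real.log_pow, sub_sub_cancel]
  push_cast
  rw [mul_div_cancel_left₀ _ two_ne_zero, Real.exp_log this]

theorem norm_u (P : ModelPoint Δ Z κ C) (m : Fin l → ℤ) (y : Fin l → ℂ) :
    ‖P.u m y‖ = ‖P.coef m‖ * Real.exp (linForm (P.rho m) y).re := by
  rw [u, norm_mul, Complex.norm_exp]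

theorem sum_pos (P : ModelPoint Δ Z κ C) (y : Fin l → ℂ) : 0 < ∑ m ∈ Δ, ‖P.u m y‖ ^ 2 := by
  refine Finset.sum_pos (fun m hm => ?_) ⟨_, P.simplex_subset P.base_mem⟩
  rw [norm_u]
  have := P.norm_coef_pos hm
  positivity

/-- A single squared norm never exceeds the whole sum. Since this holds at every `y`, the inverses
and logarithms in `pot` are smooth everywhere. -/
theorem le_aFun (P : ModelPoint Δ Z κ C) {m : Fin l → ℤ} (hm : m ∈ Δ) (y : Fin l → ℂ) :
    κ ≤ P.aFun m y := by
  have h := Finset.single_le_sum (f := fun m => ‖P.u m y‖ ^ 2) (fun _ _ => by positivity) hm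
  have hc := P.norm_coef_pos hm
  have h0 : 0 < ‖P.u m y‖ ^ 2 := by rw [norm_u]; positivity
  have h1 := Real.log_le_log h0 h
  rw [norm_u, mul_pow, Real.log_mul (by positivity) (by positivity), ← Real.exp_nat_mul,
    Real.log_exp] at h1
  push_cast at h1
  have h1' : Real.log (‖P.coef m‖ ^ 2) + 2 * (linForm (P.rho m) y).re ≤ P.logSum y := h1
  unfold aFun a₀
  linarith

theorem logSum_zero (P : ModelPoint Δ Z κ C) : P.logSum 0 = 0 := by
  simp only [logSum, norm_u, map_zero, Complex.zero_re, Real.exp_zero, mul_one, P.sum_coef,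
    Real.log_one]

theorem aFun_zero (P : ModelPoint Δ Z κ C) (m : Fin l → ℤ) : P.aFun m 0 = P.a₀ m := by
  simp [aFun, logSum_zero]

theorem linForm_norm_le (r : Fin l → ℝ) (B : ℝ) (hB : 0 ≤ B) (h : ∀ i, |r i| ≤ B) :
    ‖linForm r‖ ≤ l * B := by
  refine ContinuousLinearMap.opNorm_le_bound _ (by positivity) fun y => ?_
  rw [linForm_apply]
  calc ‖∑ i, (r i : ℂ) * y i‖ ≤ ∑ i, ‖(r i : ℂ) * y i‖ := norm_sum_le _ _
    _ ≤ ∑ _i : Fin l, B * ‖y‖ := by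
        refine Finset.sum_le_sum fun i _ => ?_
        rw [norm_mul, Complex.norm_real]
        exact mul_le_mul (h i) (norm_le_pi_norm y i) (norm_nonneg _) hB
    _ = l * B * ‖y‖ := by simp [mul_assoc]

/-- The exponents of the term `m`, divided by `a_m`. -/
def scaled (P : ModelPoint Δ Z κ C) (m : Fin l → ℤ) : (Fin l → ℂ) →L[ℝ] ℂ :=
  (linForm fun i => P.rho m i / P.a₀ m).restrictScalars ℝ

theorem scaled_spec (P : ModelPoint Δ Z κ C) (hκ : 0 < κ) {m : Fin l → ℤ} (hm : m ∈ Δ)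
    (y : Fin l → ℂ) : linForm (P.rho m) y = P.a₀ m • P.scaled m y := by
  have h := hκ.trans_le (P.le_a₀ hm)
  simp only [scaled, ContinuousLinearMap.coe_restrictScalars', linForm_apply, Complex.real_smul,
    Finset.mul_sum]
  refine Finset.sum_congr rfl fun i _ => ?_
  push_cast
  have : (P.a₀ m : ℂ) ≠ 0 := by exact_mod_cast h.ne'
  field_simp

theorem scaled_bdd (hκ : 0 < κ) {m : Fin l → ℤ} (hm : m ∈ Δ) :
    ∃ B : ℝ, ∀ P : ModelPoint Δ Z κ C, ‖P.scaled m‖ ≤ B := by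
  refine ⟨l * |C|, fun P => ?_⟩
  rw [scaled, ContinuousLinearMap.norm_restrictScalars]
  refine linForm_norm_le _ _ (abs_nonneg _) fun i => ?_
  have h := hκ.trans_le (P.le_a₀ hm)
  rw [abs_div, abs_of_pos h, div_le_iff₀ h]
  exact (P.rho_le m hm i).trans (mul_le_mul_of_nonneg_right (le_abs_self C) h.le)

theorem exists_pow_mul_exp_le (κ : ℝ) (j : ℕ) :
    ∃ B : ℝ, ∀ a : ℝ, 0 ≤ a → a ^ j * Real.exp ((κ - a) / 2) ≤ B := by
  refine ⟨j.factorial * 2 ^ j * Real.exp (κ / 2), fun a ha => ?_⟩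
  have h1 := Real.pow_div_factorial_le_exp (a / 2) (by positivity) j
  have h2 : a ^ j ≤ j.factorial * 2 ^ j * Real.exp (a / 2) := by
    rw [div_pow, div_div, div_le_iff₀ (by positivity)] at h1
    linarith
  have h3 : Real.exp ((κ - a) / 2) = Real.exp (κ / 2) * (Real.exp (a / 2))⁻¹ := by
    rw [← Real.exp_neg, ← Real.exp_add]; congr 1; ring
  have h4 := Real.exp_pos (a / 2)
  rw [h3]
  calc a ^ j * (Real.exp (κ / 2) * (Real.exp (a / 2))⁻¹)
      ≤ (j.factorial * 2 ^ j * Real.exp (a / 2)) * (Real.exp (κ / 2) * (Real.exp (a / 2))⁻¹) := by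
        gcongr
    _ = _ := by field_simp

/-- The exponent is `a₀ m` times a uniformly bounded linear form, so `j` derivatives cost `(a₀ m) ^
j`, which the size `exp((κ - a₀ m)/2)` of the coefficient compensates. -/
theorem smoothBdd_u (hκ : 0 < κ) {m : Fin l → ℤ} (hm : m ∈ Δ) :
    SmoothBdd (fun _ => 0) (fun P : ModelPoint Δ Z κ C => P.u m) := by
  have : SmoothBdd (fun _ => 0) (fun (P : ModelPoint Δ Z κ C) y =>
      P.coef m * Complex.exp (P.a₀ m • P.scaled m y)) := by
    refine SmoothBdd.cexp_linear (fun j => ?_) (scaled_bdd hκ hm)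
    obtain ⟨B, hB⟩ := exists_pow_mul_exp_le κ j
    refine ⟨B, fun P => ?_⟩
    have h := hκ.trans_le (P.le_a₀ hm)
    rw [norm_smul, P.norm_coef_eq hm, norm_pow, Real.norm_of_nonneg h.le]
    exact hB _ h.le
  refine this.congr fun P => .of_forall fun y => ?_
  simp only [u, P.scaled_spec hκ hm]

theorem smoothBdd_sig (hκ : 0 < κ) :
    SmoothBdd (fun _ => 0) (fun P : ModelPoint Δ Z κ C => P.sig) :=
  .sum _ fun _ hm => smoothBdd_u hκ hm

theorem smoothBdd_logSum (hκ : 0 < κ) :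
    SmoothBdd (fun _ => 0) (fun P : ModelPoint Δ Z κ C => P.logSum) := by
  refine SmoothBdd.log (.sum _ fun m hm => ?_) ⟨1, one_pos, fun P => ?_⟩
  · have h := smoothBdd_u (Z := Z) (C := C) hκ hm
    have h2 := (h.mul (h.clm Complex.conjCLE.toContinuousLinearMap)).clm Complex.reCLM
    refine h2.congr fun P => .of_forall fun y => ?_
    have := Complex.mul_conj (P.u m y)
    simp only [ContinuousLinearEquiv.coe_coe, Complex.conjCLE_apply, this, Complex.reCLM_apply,
      Complex.ofReal_re, Complex.normSq_eq_norm_sq]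
  · simp only [norm_u, map_zero, Complex.zero_re, Real.exp_zero, mul_one, P.sum_coef, le_refl]

/-- The numbers `a₀ m` are unbounded over the family. Division by the value at the centre leaves
`1`, a bounded multiple of `logSum` and a bounded linear form. -/
theorem smoothBdd_ratio (hκ : 0 < κ) {m : Fin l → ℤ} (hm : m ∈ Δ) :
    SmoothBdd (fun _ => 0) (fun (P : ModelPoint Δ Z κ C) y => (P.a₀ m)⁻¹ * P.aFun m y) := by
  have h1 : SmoothBdd (fun _ => 0) (fun (P : ModelPoint Δ Z κ C) (y : Fin l → ℂ) =>
      (1 : ℝ) + (P.a₀ m)⁻¹ * P.logSum y - 2 * (P.scaled m y).re) := by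
    refine ((SmoothBdd.const (c := fun _ => (1 : ℝ)) ⟨_, fun _ => le_rfl⟩).add
      ((SmoothBdd.const (c := fun P => (P.a₀ m)⁻¹) ⟨κ⁻¹, fun P => ?_⟩).mul
      (smoothBdd_logSum hκ))).sub ((SmoothBdd.const (c := fun _ => (2 : ℝ))
        ⟨_, fun _ => le_rfl⟩).mul ((SmoothBdd.linear (scaled_bdd hκ hm)).clm Complex.reCLM))
    rw [norm_inv, Real.norm_of_nonneg (hκ.le.trans (P.le_a₀ hm))]
    exact inv_anti₀ hκ (P.le_a₀ hm)
  refine h1.congr fun P => .of_forall fun y => ?_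
  have h := hκ.trans_le (P.le_a₀ hm)
  simp only [aFun, P.scaled_spec hκ hm y, Complex.real_smul, Complex.re_ofReal_mul]
  field_simp

/-- The weight of the simplex `S` at the point. -/
def weight (P : ModelPoint Δ Z κ C) (S : Finset (Fin l → ℤ)) : ℝ :=
  ((∏ m ∈ S, P.a₀ m)⁻¹) ^ 2

theorem prod_a₀_pos (P : ModelPoint Δ Z κ C) (hκ : 0 < κ) {S : Finset (Fin l → ℤ)} (hS : S ∈ Z) :
    0 < ∏ m ∈ S, P.a₀ m :=
  Finset.prod_pos fun _ hm => hκ.trans_le (P.le_a₀ (P.subset S hS hm))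

theorem weight_pos (P : ModelPoint Δ Z κ C) (hκ : 0 < κ) {S : Finset (Fin l → ℤ)} (hS : S ∈ Z) :
    0 < P.weight S := by
  have := P.prod_a₀_pos hκ hS
  unfold weight
  positivity

theorem sum_weight_pos (P : ModelPoint Δ Z κ C) (hκ : 0 < κ) : 0 < ∑ S ∈ Z, P.weight S :=
  Finset.sum_pos (fun _ hS => P.weight_pos hκ hS) ⟨_, P.mem⟩

/-- Subtracting the unbounded constant normalizes the sum over simplices to a convex combination of
inverse squares of products of the ratios, with value `1` at the origin. The constant disappears on
differentiation. -/
theorem smoothBdd_pot_sub (hκ : 0 < κ) : SmoothBdd (fun _ => 0)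
    (fun (P : ModelPoint Δ Z κ C) y => P.pot y - Real.log (∑ S ∈ Z, P.weight S)) := by
  have h1 : SmoothBdd (fun _ => 0) (fun (P : ModelPoint Δ Z κ C) y =>
      ∑ S ∈ Z, (P.weight S / ∑ S ∈ Z, P.weight S) *
        ((∏ m ∈ S, ((P.a₀ m)⁻¹ * P.aFun m y))⁻¹ * (∏ m ∈ S, ((P.a₀ m)⁻¹ * P.aFun m y))⁻¹)) := by
    refine .sum _ fun S hS => (SmoothBdd.const ⟨1, fun P => ?_⟩).mul ?_
    · have h0 := P.weight_pos hκ hS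
      have h1 := P.sum_weight_pos hκ
      rw [Real.norm_of_nonneg (by positivity), div_le_one h1]
      exact Finset.single_le_sum (f := fun S => P.weight S)
        (fun S hS => (P.weight_pos hκ hS).le) hS
    -- The inclusion `S ⊆ Δ` is read off from a model point; an empty family satisfies any bound.
    · by_cases hne : Nonempty (ModelPoint Δ Z κ C)
      · obtain ⟨P₀⟩ := hne
        have hp : SmoothBdd (fun _ => 0) (fun (P : ModelPoint Δ Z κ C) y =>
            (∏ m ∈ S, ((P.a₀ m)⁻¹ * P.aFun m y))⁻¹) := by
          refine SmoothBdd.inv (.prod _ fun m hm => smoothBdd_ratio hκ (P₀.subset S hS hm))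
            ⟨1, one_pos, fun P => ?_⟩
          rw [Finset.prod_congr rfl (g := fun _ => (1 : ℝ))]
          · simp
          · intro m hm
            rw [aFun_zero]
            exact inv_mul_cancel₀ (hκ.trans_le (P.le_a₀ (P.subset S hS hm))).ne'
        exact hp.mul hp
      · intro n
        have : IsEmpty (ModelPoint Δ Z κ C) := not_nonempty_iff.1 hne
        exact (JetBdd.const (c := fun _ => (0 : ℝ)) ⟨0, by simp⟩).congr fun P => isEmptyElim P
  have h2 := h1.log ⟨1, one_pos, fun P => by
    have h1 := P.sum_weight_pos hκ
    rw [← div_self h1.ne', Finset.sum_div]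
    refine le_of_eq (Finset.sum_congr rfl fun S hS => ?_)
    rw [Finset.prod_congr rfl (g := fun _ => (1 : ℝ))]
    · simp
    · intro m hm
      rw [aFun_zero]
      exact inv_mul_cancel₀ (hκ.trans_le (P.le_a₀ (P.subset S hS hm))).ne'⟩
  refine ((smoothBdd_logSum hκ).add h2).congr fun P => .of_forall fun y => ?_
  have h3 := P.sum_weight_pos hκ
  have h4 : ∑ S ∈ Z, (P.weight S / ∑ S ∈ Z, P.weight S) *
      ((∏ m ∈ S, ((P.a₀ m)⁻¹ * P.aFun m y))⁻¹ * (∏ m ∈ S, ((P.a₀ m)⁻¹ * P.aFun m y))⁻¹) =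
      (∑ S ∈ Z, ((∏ m ∈ S, P.aFun m y)⁻¹) ^ 2) / ∑ S ∈ Z, P.weight S := by
    rw [Finset.sum_div]
    refine Finset.sum_congr rfl fun S hS => ?_
    have h5 := P.prod_a₀_pos hκ hS
    rw [Finset.prod_mul_distrib, Finset.prod_inv_distrib, weight]
    field_simp
  have h6 : 0 < ∑ S ∈ Z, ((∏ m ∈ S, P.aFun m y)⁻¹) ^ 2 := by
    refine Finset.sum_pos (fun S hS => ?_) ⟨_, P.mem⟩
    have : 0 < ∏ m ∈ S, P.aFun m y :=
      Finset.prod_pos fun m hm => hκ.trans_le (P.le_aFun (P.subset S hS hm) y)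
    positivity
  simp only [h4, pot]
  rw [Real.log_div h6.ne' h3.ne']
  ring

end ModelPoint

end ToricDegeneration

end

/-! ### Lower bounds for the Levi form and for the derivative of the defining equation -/

noncomputable section

namespace ToricDegeneration

open Filter Topology

variable {l : ℕ}

/-- The Levi form of `Φ`, up to a constant factor. -/
def lev (Φ : (Fin l → ℂ) → ℝ) (z u v : Fin l → ℂ) : ℝ :=
  fderiv ℝ (fderiv ℝ Φ) z u v + fderiv ℝ (fderiv ℝ Φ) z (Complex.I • u) (Complex.I • v)

namespace ModelPoint

variable {Δ : Finset (Fin l → ℤ)} {Z : Finset (Finset (Fin l → ℤ))} {κ C : ℝ}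

theorem linForm_contDiff (r : Fin l → ℝ) : ContDiff ℝ ∞ (fun y => linForm r y) :=
  ((linForm r).restrictScalars ℝ).contDiff

theorem contDiff_logSum (P : ModelPoint Δ Z κ C) : ContDiff ℝ ∞ P.logSum := by
  unfold logSum
  refine ContDiff.log (ContDiff.sum fun m _ => ?_) fun y => (P.sum_pos y).ne'
  unfold u
  exact (contDiff_const.mul (linForm_contDiff _).cexp).norm_sq ℝ

theorem contDiff_aFun (P : ModelPoint Δ Z κ C) (m : Fin l → ℤ) : ContDiff ℝ ∞ (P.aFun m) := by
  unfold aFun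
  exact (contDiff_const.add P.contDiff_logSum).sub
    (contDiff_const.mul (Complex.reCLM.contDiff.comp (linForm_contDiff _)))

theorem prod_aFun_pos (P : ModelPoint Δ Z κ C) (hκ : 0 < κ) {S : Finset (Fin l → ℤ)} (hS : S ∈ Z)
    (y : Fin l → ℂ) : 0 < ∏ m ∈ S, P.aFun m y :=
  Finset.prod_pos fun _ hm => hκ.trans_le (P.le_aFun (P.subset S hS hm) y)

theorem contDiff_pot (P : ModelPoint Δ Z κ C) (hκ : 0 < κ) : ContDiff ℝ ∞ P.pot := by
  unfold pot
  refine P.contDiff_logSum.add (ContDiff.log (ContDiff.sum fun S hS => ContDiff.pow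
    (ContDiff.inv (contDiff_prod fun m _ => P.contDiff_aFun m)
      fun y => (P.prod_aFun_pos hκ hS y).ne') 2) fun y => ?_)
  refine (Finset.sum_pos (fun S hS => ?_) ⟨_, P.mem⟩).ne'
  have := P.prod_aFun_pos hκ hS y
  positivity

theorem smoothBdd_fderiv_pot (hκ : 0 < κ) :
    SmoothBdd (fun _ => 0) (fun P : ModelPoint Δ Z κ C => fderiv ℝ P.pot) := by
  refine (smoothBdd_pot_sub hκ).fderiv.congr fun P => .of_forall fun y => ?_
  exact fderiv_sub_const _

/-- Along a real line each `a_m` is `n = logSum` plus an affine function, so all `a_m` share the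
nonnegative second derivative `n''`. The logarithms in `h` contribute `2 (a_m'/a_m)² - 2 n''/a_m`,
and the summand `n` of the potential pays for the negative part. Here `μ = n'(0)`. -/
theorem secondDeriv_pot (P : ModelPoint Δ Z κ C) (hκ : 2 * (l + 1) ≤ κ) (v : Fin l → ℂ) :
    ∃ μ : ℝ, 2 * (P.weight P.simplex / ∑ S ∈ Z, P.weight S) *
      ∑ m ∈ P.simplex, ((μ - 2 * (linForm (P.rho m) v).re) / P.a₀ m) ^ 2 ≤
        fderiv ℝ (fderiv ℝ P.pot) 0 v v := by
  have hκ0 : 0 < κ := by have : (0 : ℝ) ≤ l := Nat.cast_nonneg l; linarith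
  have hline : ContDiff ℝ ∞ (fun r : ℝ => r • v) := contDiff_id.smul contDiff_const
  set n : ℝ → ℝ := fun r => P.logSum (r • v) with hn
  have hnC : ContDiff ℝ ∞ n := P.contDiff_logSum.comp hline
  set x : (Fin l → ℤ) → ℝ := fun m => 2 * (linForm (P.rho m) v).re with hx
  have hre : ∀ m (r : ℝ), (linForm (P.rho m) (r • v)).re = r * (linForm (P.rho m) v).re := by
    intro m r
    have : linForm (P.rho m) (r • v) = r • linForm (P.rho m) v :=
      ((linForm (P.rho m)).restrictScalars ℝ).map_smul r v
    rw [this, Complex.real_smul, Complex.re_ofReal_mul]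
  have hnexp : n = fun r => Real.log (∑ m ∈ Δ, Real.exp (Real.log (‖P.coef m‖ ^ 2) + x m * r)) := by
    funext r
    simp only [hn, logSum]
    congr 1
    refine Finset.sum_congr rfl fun m hm => ?_
    have := P.norm_coef_pos hm
    rw [norm_u, mul_pow, Real.exp_add, Real.exp_log (by positivity), ← Real.exp_nat_mul, hre]
    congr 2
    simp only [hx]
    push_cast
    ring
  have hn2 : 0 ≤ secondDeriv n := by
    have h := secondDeriv_log_sum_exp Δ ⟨_, P.simplex_subset P.base_mem⟩
      (f := fun m r => Real.log (‖P.coef m‖ ^ 2) + x m * r)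
      (fun m _ => contDiffAt_const.add (contDiffAt_const.mul contDiffAt_id))
    simp only [secondDeriv_affine, mul_zero, Finset.sum_const_zero] at h
    rw [hnexp]
    exact h
  set α : (Fin l → ℤ) → ℝ → ℝ := fun m r => P.aFun m (r • v) with hα
  have hαC : ∀ m, ContDiff ℝ ∞ (α m) := fun m => (P.contDiff_aFun m).comp hline
  have hαeq : ∀ m, α m = fun r => n r + (P.a₀ m + (-x m) * r) := by
    intro m
    funext r
    simp only [hα, aFun, hn, hre, hx]
    ring
  have hα0 : ∀ m, α m 0 = P.a₀ m := fun m => by simp only [hα, zero_smul, aFun_zero]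
  have hα2 : ∀ m, secondDeriv (α m) = secondDeriv n := by
    intro m
    have haff : ContDiffAt ℝ ∞ (fun r : ℝ => P.a₀ m + (-x m) * r) 0 :=
      contDiffAt_const.add (contDiffAt_const.mul contDiffAt_id)
    rw [hαeq, secondDeriv_add hnC.contDiffAt haff, secondDeriv_affine, add_zero]
  have hα1 : ∀ m, deriv (α m) 0 = deriv n 0 - x m := by
    intro m
    have h1 : HasDerivAt n (deriv n 0) 0 :=
      (hnC.contDiffAt.differentiableAt (by simp)).hasDerivAt
    have h2 : HasDerivAt (fun r : ℝ => P.a₀ m + (-x m) * r) (-x m) 0 := by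
      simpa using ((hasDerivAt_id (0 : ℝ)).const_mul (-x m)).const_add (P.a₀ m)
    rw [hαeq, (h1.fun_add h2).deriv]
    ring
  have hαpos : ∀ S ∈ Z, ∀ m ∈ S, ∀ r, 0 < α m r := fun S hS m hm r =>
    hκ0.trans_le (P.le_aFun (P.subset S hS hm) _)
  set f : Finset (Fin l → ℤ) → ℝ → ℝ := fun S r => ∑ m ∈ S, (-2) * Real.log (α m r) with hf
  have hterm : ∀ S ∈ Z, ∀ m ∈ S, ContDiffAt ℝ ∞ (fun r => (-2) * Real.log (α m r)) 0 :=
    fun S hS m hm => contDiffAt_const.mul ((hαC m).contDiffAt.log (hαpos S hS m hm 0).ne')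
  have hfC : ∀ S ∈ Z, ContDiffAt ℝ ∞ (f S) 0 := fun S hS => ContDiffAt.sum (hterm S hS)
  have hexp : ∀ S ∈ Z, ∀ r, Real.exp (f S r) = ((∏ m ∈ S, α m r)⁻¹) ^ 2 := by
    intro S hS r
    simp only [hf]
    rw [Real.exp_sum, ← Finset.prod_inv_distrib, ← Finset.prod_pow]
    refine Finset.prod_congr rfl fun m hm => ?_
    have h0 := hαpos S hS m hm r
    rw [show (-2 : ℝ) * Real.log (α m r) = -(Real.log (α m r) + Real.log (α m r)) by ring,
      Real.exp_neg, Real.exp_add, Real.exp_log h0, inv_pow, sq]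
  have hpot : (fun r : ℝ => P.pot (r • v)) =
      fun r => n r + Real.log (∑ S ∈ Z, Real.exp (f S r)) := by
    funext r
    simp only [pot, hn]
    congr 2
    exact Finset.sum_congr rfl fun S hS => (hexp S hS r).symm
  have hLC : ContDiffAt ℝ ∞ (fun r => Real.log (∑ S ∈ Z, Real.exp (f S r))) 0 :=
    (ContDiffAt.sum fun S hS => (hfC S hS).exp).log
      (Finset.sum_pos (fun _ _ => Real.exp_pos _) ⟨_, P.mem⟩).ne'
  have hw : ∀ S ∈ Z, Real.exp (f S 0) = P.weight S := by
    intro S hS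
    rw [hexp S hS, weight]
    simp only [hα0]
  have hL := secondDeriv_log_sum_exp Z ⟨_, P.mem⟩ hfC
  rw [Finset.sum_congr rfl hw] at hL
  set W := ∑ S ∈ Z, P.weight S with hW
  have hWpos : 0 < W := P.sum_weight_pos hκ0
  set Q : Finset (Fin l → ℤ) → ℝ :=
    fun S => ∑ m ∈ S, ((deriv n 0 - x m) / P.a₀ m) ^ 2 with hQ
  have hQ0 : ∀ S, 0 ≤ Q S := fun S => Finset.sum_nonneg fun _ _ => by positivity
  have hf2 : ∀ S ∈ Z, -secondDeriv n + 2 * Q S ≤ secondDeriv (f S) := by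
    intro S hS
    simp only [hf]
    rw [secondDeriv_sum S (hterm S hS)]
    have h1 : ∀ m ∈ S, secondDeriv (fun r => (-2) * Real.log (α m r)) =
        2 * ((deriv n 0 - x m) / P.a₀ m) ^ 2 - secondDeriv n * (2 / P.a₀ m) := by
      intro m hm
      rw [secondDeriv_const_mul, secondDeriv_log (hαC m).contDiffAt (hαpos S hS m hm 0), hα0, hα1,
        hα2]
      ring
    rw [Finset.sum_congr rfl h1, Finset.sum_sub_distrib, ← Finset.mul_sum, ← Finset.mul_sum]
    -- This is where `κ ≥ 2 (l + 1)` is needed: a simplex has `l + 1` vertices, each with `a₀ m ≥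
    -- κ`.
    have h2 : ∑ m ∈ S, 2 / P.a₀ m ≤ 1 := by
      calc ∑ m ∈ S, 2 / P.a₀ m ≤ ∑ _m ∈ S, 2 / κ := by
            refine Finset.sum_le_sum fun m hm => ?_
            exact div_le_div_of_nonneg_left zero_le_two hκ0 (P.le_a₀ (P.subset S hS hm))
        _ = (l + 1) * (2 / κ) := by
            rw [Finset.sum_const, P.card S hS, nsmul_eq_mul]; push_cast; ring
        _ ≤ 1 := by rw [← mul_div_assoc, div_le_one hκ0]; linarith
    nlinarith
  refine ⟨deriv n 0, ?_⟩
  rw [fderiv_fderiv_eq_secondDeriv (P.contDiff_pot hκ0).contDiffAt, hpot,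
    secondDeriv_add hnC.contDiffAt hLC]
  -- The normalized weights add up to `1`, so the average of `-n''` cancels the `n''` of the first
  -- summand. Of the nonnegative squares only those of the adapted simplex are kept.
  have h3 : ∑ S ∈ Z, P.weight S / W * (-secondDeriv n + 2 * Q S) ≤
      ∑ S ∈ Z, Real.exp (f S 0) / W * secondDeriv (f S) := by
    refine Finset.sum_le_sum fun S hS => ?_
    rw [hw S hS]
    exact mul_le_mul_of_nonneg_left (hf2 S hS) (by have := P.weight_pos hκ0 hS; positivity)
  have h4 : ∑ S ∈ Z, P.weight S / W * (-secondDeriv n + 2 * Q S) =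
      -secondDeriv n + 2 * ∑ S ∈ Z, P.weight S / W * Q S := by
    have h5 : ∑ S ∈ Z, P.weight S / W = 1 := by rw [← Finset.sum_div]; exact div_self hWpos.ne'
    simp only [mul_add, Finset.sum_add_distrib]
    rw [← Finset.sum_mul, h5, one_mul, Finset.mul_sum]
    congr 1
    exact Finset.sum_congr rfl fun S _ => by ring
  have h6 : P.weight P.simplex / W * Q P.simplex ≤ ∑ S ∈ Z, P.weight S / W * Q S :=
    Finset.single_le_sum (f := fun S => P.weight S / W * Q S)
      (fun S hS => mul_nonneg (by have := P.weight_pos hκ0 hS; positivity) (hQ0 S)) P.mem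
  have h7 : 2 * (P.weight P.simplex / W) * ∑ m ∈ P.simplex,
      ((deriv n 0 - 2 * (linForm (P.rho m) v).re) / P.a₀ m) ^ 2 =
      2 * (P.weight P.simplex / W * Q P.simplex) := by rw [hQ, mul_assoc]
  rw [h7]
  linarith

theorem one_le_const (P : ModelPoint Δ Z κ C) (hκ : 1 ≤ κ) : 1 ≤ C :=
  (hκ.trans (P.le_a₀ (P.simplex_subset P.base_mem))).trans P.base_le

theorem weight_lower (P : ModelPoint Δ Z κ C) (hκ : 1 ≤ κ) :
    (Z.card * C ^ 2)⁻¹ ≤ P.weight P.simplex / ∑ S ∈ Z, P.weight S := by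
  have hκ0 : 0 < κ := one_pos.trans_le hκ
  have hC := P.one_le_const hκ
  have hZ : 0 < (Z.card : ℝ) := by exact_mod_cast Finset.card_pos.2 ⟨_, P.mem⟩
  have hW := P.sum_weight_pos hκ0
  have h1 : ∑ S ∈ Z, P.weight S ≤ ∑ _S ∈ Z, C ^ 2 * P.weight P.simplex := by
    refine Finset.sum_le_sum fun S hS => ?_
    have h2 := P.prod_a₀_pos hκ0 hS
    have h3 := P.prod_a₀_pos hκ0 P.mem
    have h4 : ∏ m ∈ P.simplex, P.a₀ m ≤ C * ∏ m ∈ S, P.a₀ m := P.prod_le S hS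
    unfold weight
    rw [← mul_pow]
    refine pow_le_pow_left₀ (by positivity) ?_ 2
    rw [← div_eq_mul_inv, le_div_iff₀ h3, inv_mul_eq_div, div_le_iff₀ h2]
    exact h4
  rw [Finset.sum_const, nsmul_eq_mul] at h1
  rw [le_div_iff₀ hW, inv_mul_eq_div, div_le_iff₀ (by positivity)]
  linarith

/-- Two vertices suffice for each coordinate. The base vertex has exponent zero and bounded `a₀`, so
its square controls the unknown slope `μ`; the `i`-th vertex then controls the real part of `v i`.
Applying this to `I • v` controls the imaginary part, and the Levi form is the sum of both second
derivatives. -/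
theorem exists_coercive (Δ : Finset (Fin l → ℤ)) (Z : Finset (Finset (Fin l → ℤ))) (C : ℝ)
    (hκ : 2 * (l + 1) ≤ κ) : ∃ c : ℝ, 0 < c ∧ ∀ (P : ModelPoint Δ Z κ C) (v : Fin l → ℂ),
      c * ‖v‖ ^ 2 ≤ lev P.pot 0 v v := by
  by_cases hne : Nonempty (ModelPoint Δ Z κ C)
  swap
  · exact ⟨1, one_pos, fun P => absurd ⟨P⟩ hne⟩
  obtain ⟨P₀⟩ := hne
  have hκ1 : 1 ≤ κ := by have : (0 : ℝ) ≤ l := Nat.cast_nonneg l; linarith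
  have hC := P₀.one_le_const hκ1
  have hZ : 0 < (Z.card : ℝ) := by exact_mod_cast Finset.card_pos.2 ⟨_, P₀.mem⟩
  -- The first factor is the share of the adapted simplex from `weight_lower`; the second comes from
  -- `2 (Re v i)² ≤ C² Q`, with `Q` the sum of squares over that simplex.
  set c : ℝ := (Z.card * C ^ 2)⁻¹ * (4 / C ^ 2) with hc
  have hcpos : 0 < c := by positivity
  refine ⟨c, hcpos, fun P => ?_⟩
  have key : ∀ v : Fin l → ℂ, 0 ≤ fderiv ℝ (fderiv ℝ P.pot) 0 v v ∧
      ∀ i, c * (v i).re ^ 2 ≤ fderiv ℝ (fderiv ℝ P.pot) 0 v v := by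
    intro v
    obtain ⟨μ, hμ⟩ := P.secondDeriv_pot hκ v
    have hw := P.weight_lower hκ1
    set q := P.weight P.simplex / ∑ S ∈ Z, P.weight S with hq
    have hq0 : 0 < q := lt_of_lt_of_le (by positivity) hw
    set Q := ∑ m ∈ P.simplex, ((μ - 2 * (linForm (P.rho m) v).re) / P.a₀ m) ^ 2 with hQ
    have hQ0 : 0 ≤ Q := Finset.sum_nonneg fun _ _ => by positivity
    refine ⟨le_trans (by positivity) hμ, fun i => le_trans ?_ hμ⟩
    have hpair : (μ / P.a₀ P.base) ^ 2 +
        ((μ - 2 * (P.a₀ (P.vert i) * (v i).re)) / P.a₀ (P.vert i)) ^ 2 ≤ Q := by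
      have hsub : ({P.base, P.vert i} : Finset (Fin l → ℤ)) ⊆ P.simplex := by
        intro m hm
        rcases Finset.mem_insert.1 hm with rfl | hm
        · exact P.base_mem
        · rw [Finset.mem_singleton.1 hm]; exact P.vert_mem i
      have := Finset.sum_le_sum_of_subset_of_nonneg hsub
        (f := fun m => ((μ - 2 * (linForm (P.rho m) v).re) / P.a₀ m) ^ 2)
        (fun _ _ _ => by positivity)
      rw [Finset.sum_pair (P.vert_ne i).symm, P.rho_base, P.rho_vert] at this
      have e1 : linForm (0 : Fin l → ℝ) v = 0 := by simp [linForm_apply]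
      have e2 : linForm (Pi.single i (κ - Real.log (‖P.coef (P.vert i)‖ ^ 2))) v =
          (P.a₀ (P.vert i) : ℂ) * v i := by
        rw [linForm_apply, Finset.sum_eq_single i]
        · simp [a₀]
        · intro j _ hj; simp [Pi.single_eq_of_ne hj]
        · simp
      rw [e1, e2, Complex.re_ofReal_mul] at this
      simpa using this
    have ha1 : 1 ≤ P.a₀ (P.vert i) := hκ1.trans (P.le_a₀ (P.simplex_subset (P.vert_mem i)))
    have hb1 : 1 ≤ P.a₀ P.base := hκ1.trans (P.le_a₀ (P.simplex_subset P.base_mem))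
    have hbC : P.a₀ P.base ≤ C := P.base_le
    set b := P.a₀ P.base
    set a := P.a₀ (P.vert i)
    have hX : (μ / a) ^ 2 ≤ C ^ 2 * (μ / b) ^ 2 := by
      rw [← mul_pow, sq_le_sq, abs_div, abs_mul, abs_div, abs_of_pos (by linarith : 0 < a),
        abs_of_pos (by linarith : 0 < b), abs_of_pos (by linarith : 0 < C)]
      calc |μ| / a ≤ |μ| := div_le_self (abs_nonneg _) ha1
        _ = b * (|μ| / b) := by field_simp
        _ ≤ C * (|μ| / b) := by gcongr
    have hY : ((μ - 2 * (a * (v i).re)) / a) = μ / a - 2 * (v i).re := by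
      field_simp
    rw [hY] at hpair
    have h1 : 2 * (v i).re ^ 2 ≤ C ^ 2 * Q := by
      have h2 : (2 * (v i).re) ^ 2 ≤ 2 * ((μ / a) ^ 2 + (μ / a - 2 * (v i).re) ^ 2) := by
        nlinarith [sq_nonneg (2 * (μ / a) - 2 * (v i).re)]
      have h3 : (μ / a - 2 * (v i).re) ^ 2 ≤ C ^ 2 * (μ / a - 2 * (v i).re) ^ 2 :=
        le_mul_of_one_le_left (sq_nonneg _) (one_le_pow₀ hC)
      have h4 : C ^ 2 * ((μ / b) ^ 2 + (μ / a - 2 * (v i).re) ^ 2) ≤ C ^ 2 * Q :=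
        mul_le_mul_of_nonneg_left hpair (by positivity)
      nlinarith
    have h5 : 4 / C ^ 2 * (v i).re ^ 2 ≤ 2 * Q := by
      rw [div_mul_eq_mul_div, div_le_iff₀ (by positivity)]
      linarith
    calc c * (v i).re ^ 2 = (Z.card * C ^ 2)⁻¹ * (4 / C ^ 2 * (v i).re ^ 2) := by rw [hc]; ring
      _ ≤ q * (2 * Q) := mul_le_mul hw h5 (by positivity) hq0.le
      _ = 2 * q * Q := by ring
  intro v
  have h1 := key v
  have h2 := key (Complex.I • v)
  have hlev0 : 0 ≤ lev P.pot 0 v v := add_nonneg h1.1 h2.1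
  have h3 : ∀ i, ‖v i‖ ≤ Real.sqrt (lev P.pot 0 v v / c) := by
    intro i
    apply Real.le_sqrt_of_sq_le
    rw [le_div_iff₀ hcpos, ← Complex.normSq_eq_norm_sq, Complex.normSq_apply]
    have h4 := h1.2 i
    have h5 := h2.2 i
    simp only [Pi.smul_apply, smul_eq_mul, Complex.I_mul_re, neg_sq] at h5
    unfold lev
    linarith
  have h4 := (pi_norm_le_iff_of_nonneg (Real.sqrt_nonneg _)).2 h3
  have h5 := pow_le_pow_left₀ (norm_nonneg v) h4 2
  rw [Real.sq_sqrt (by positivity), le_div_iff₀ hcpos] at h5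
  linarith

theorem hasFDerivAt_sig (P : ModelPoint Δ Z κ C) (y : Fin l → ℂ) :
    HasFDerivAt P.sig (∑ m ∈ Δ, P.u m y • linForm (P.rho m)) y := by
  unfold sig
  refine HasFDerivAt.fun_sum fun m _ => ?_
  have := ((linForm (P.rho m)).hasFDerivAt (x := y)).cexp.const_mul (P.coef m)
  rw [smul_smul] at this
  exact this

theorem fderiv_sig_single (P : ModelPoint Δ Z κ C) (i : Fin l) :
    fderiv ℂ P.sig 0 (Pi.single i 1) = ∑ m ∈ Δ, P.coef m * P.rho m i := by
  rw [(P.hasFDerivAt_sig 0).fderiv]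
  simp [u, linForm_apply, Pi.single_apply]

theorem sum_simplex (P : ModelPoint Δ Z κ C) (f : (Fin l → ℤ) → ℂ) :
    ∑ m ∈ P.simplex, f m = f P.base + ∑ i, f (P.vert i) := by
  classical
  have hb : P.base ∉ Finset.univ.image P.vert := by
    intro h
    obtain ⟨i, -, hi⟩ := Finset.mem_image.1 h
    exact P.vert_ne i hi
  have : insert P.base (Finset.univ.image P.vert) = P.simplex := by
    apply Finset.eq_of_subset_of_card_le
    · intro m hm
      rcases Finset.mem_insert.1 hm with rfl | hm
      · exact P.base_mem
      · obtain ⟨i, -, rfl⟩ := Finset.mem_image.1 hm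
        exact P.vert_mem i
    · rw [P.card _ P.mem, Finset.card_insert_of_notMem hb,
        Finset.card_image_of_injective _ P.vert_inj]
      simp
  rw [← this, Finset.sum_insert hb, Finset.sum_image fun _ _ _ _ h => P.vert_inj h]

theorem exists_small (κ C ν : ℝ) (hν : 0 < ν) :
    ∃ R : ℝ, ∀ a : ℝ, R ≤ a → Real.exp ((κ - a) / 2) ≤ ν ∧
      Real.exp ((κ - a) / 2) * (C * a) ≤ ν := by
  obtain ⟨B, hB⟩ := exists_pow_mul_exp_le κ 2
  have hB0 : 0 ≤ B := by simpa using hB 0 le_rfl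
  refine ⟨max 1 ((1 + |C|) * B / ν), fun a ha => ?_⟩
  have ha1 : 1 ≤ a := (le_max_left _ _).trans ha
  have ha2 : (1 + |C|) * B ≤ a * ν := by
    rw [← div_le_iff₀ hν]; exact (le_max_right _ _).trans ha
  have hE := Real.exp_pos ((κ - a) / 2)
  set E := Real.exp ((κ - a) / 2) with hEd
  have h1 := hB a (by linarith)
  have h2 : (1 + |C|) * (a * E) ≤ ν := by
    have h3 : a * ((1 + |C|) * (a * E)) ≤ a * ν := by
      have : (1 + |C|) * (a ^ 2 * E) ≤ (1 + |C|) * B :=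
        mul_le_mul_of_nonneg_left h1 (by positivity)
      calc a * ((1 + |C|) * (a * E)) = (1 + |C|) * (a ^ 2 * E) := by ring
        _ ≤ a * ν := this.trans ha2
    exact le_of_mul_le_mul_left h3 (by linarith)
  have h4 : 0 ≤ a * E := by positivity
  have h5 := abs_nonneg C
  constructor
  · nlinarith
  · have : C * (a * E) ≤ |C| * (a * E) := mul_le_mul_of_nonneg_right (le_abs_self C) h4
    nlinarith

/-- A zero of the equation forces some vertex term to balance the large base term, because the terms
off the simplex are tiny. In the adapted coordinates the `i`-th partial derivative sees, within the
simplex, only the `i`-th vertex, multiplied by `a₀ ≥ 1`. -/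
theorem exists_deriv_lower (Δ : Finset (Fin l → ℤ)) (Z : Finset (Finset (Fin l → ℤ))) (C : ℝ)
    (hκ : 1 ≤ κ) : ∃ R c : ℝ, 0 < c ∧ ∀ P : ModelPoint Δ Z κ C, P.sig 0 = 0 →
      (∀ m ∈ Δ, m ∉ P.simplex → R ≤ P.a₀ m) →
      ∃ i, c ≤ ‖fderiv ℂ P.sig 0 (Pi.single i 1)‖ := by
  classical
  set c₀ := Real.exp ((κ - C) / 2) with hc₀
  have hc₀pos : 0 < c₀ := Real.exp_pos _
  -- With at most `Δ.card` terms off the simplex, their sum stays below `c₀ / (4 (l + 1))`, half of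
  -- the size guaranteed for the large vertex term.
  set ν : ℝ := c₀ / (4 * (l + 1) * (Δ.card + 1)) with hν
  have hνpos : 0 < ν := by positivity
  have hνle : Δ.card * ν ≤ c₀ / (4 * (l + 1)) := by
    have : (Δ.card + 1) * ν = c₀ / (4 * (l + 1)) := by rw [hν]; field_simp
    linarith
  obtain ⟨R, hR⟩ := exists_small κ C ν hνpos
  refine ⟨R, c₀ / (4 * (l + 1)), by positivity, fun P h0 hfar => ?_⟩
  have hrest : ∀ f : (Fin l → ℤ) → ℂ, (∀ m ∈ Δ, m ∉ P.simplex → ‖f m‖ ≤ ν) →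
      ‖∑ m ∈ Δ \ P.simplex, f m‖ ≤ c₀ / (4 * (l + 1)) := by
    intro f hf
    calc ‖∑ m ∈ Δ \ P.simplex, f m‖ ≤ ∑ m ∈ Δ \ P.simplex, ‖f m‖ := norm_sum_le _ _
      _ ≤ ∑ _m ∈ Δ \ P.simplex, ν := Finset.sum_le_sum fun m hm => by
          rw [Finset.mem_sdiff] at hm; exact hf m hm.1 hm.2
      _ = (Δ \ P.simplex).card * ν := by rw [Finset.sum_const, nsmul_eq_mul]
      _ ≤ Δ.card * ν := by
          gcongr
          exact Finset.sdiff_subset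
      _ ≤ _ := hνle
  have hsplit : ∀ f : (Fin l → ℤ) → ℂ, ∑ m ∈ Δ, f m =
      f P.base + ∑ i, f (P.vert i) + ∑ m ∈ Δ \ P.simplex, f m := by
    intro f
    rw [← P.sum_simplex, add_comm, Finset.sum_sdiff P.simplex_subset]
  have hl : (0 : ℝ) < l + 1 := by positivity
  have hbase : c₀ ≤ ‖P.coef P.base‖ := by
    rw [P.norm_coef_eq (P.simplex_subset P.base_mem), hc₀]
    have : P.a₀ P.base ≤ C := P.base_le
    exact Real.exp_le_exp.2 (by linarith)
  -- Otherwise everything except the base term adds up to at most `c₀ (2l + 1) / (4 (l + 1)) < c₀`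
  -- and cannot cancel it.
  have hbig : ∃ i, c₀ / (2 * (l + 1)) ≤ ‖P.coef (P.vert i)‖ := by
    by_contra hcon
    push Not at hcon
    have h1 : ∑ m ∈ Δ, P.coef m = 0 := by simpa [sig, u] using h0
    rw [hsplit] at h1
    have h2 := hrest P.coef fun m hm hmS => by
      rw [P.norm_coef_eq hm]; exact (hR _ (hfar m hm hmS)).1
    have h3 : ‖∑ i, P.coef (P.vert i)‖ ≤ l * (c₀ / (2 * (l + 1))) := by
      calc ‖∑ i, P.coef (P.vert i)‖ ≤ ∑ i, ‖P.coef (P.vert i)‖ := norm_sum_le _ _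
        _ ≤ ∑ _i : Fin l, c₀ / (2 * (l + 1)) := Finset.sum_le_sum fun i _ => (hcon i).le
        _ = _ := by simp
    have h4 : P.coef P.base = -(∑ i, P.coef (P.vert i) + ∑ m ∈ Δ \ P.simplex, P.coef m) := by
      rw [eq_neg_iff_add_eq_zero, ← add_assoc]; exact h1
    have h5 : ‖P.coef P.base‖ ≤ l * (c₀ / (2 * (l + 1))) + c₀ / (4 * (l + 1)) := by
      rw [h4, norm_neg]
      exact (norm_add_le _ _).trans (add_le_add h3 h2)
    have h6 : l * (c₀ / (2 * (l + 1))) + c₀ / (4 * (l + 1)) < c₀ := by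
      have : l * (c₀ / (2 * (l + 1))) + c₀ / (4 * (l + 1)) =
          c₀ * ((2 * l + 1) / (4 * (l + 1))) := by field_simp; ring
      rw [this]
      have h7 : (2 * (l : ℝ) + 1) / (4 * (l + 1)) < 1 := by
        rw [div_lt_one (by positivity)]
        have : (0 : ℝ) ≤ l := Nat.cast_nonneg l
        linarith
      nlinarith
    linarith
  obtain ⟨i, hi⟩ := hbig
  refine ⟨i, ?_⟩
  have h2 := hrest (fun m => P.coef m * P.rho m i) fun m hm hmS => by
    rw [norm_mul, P.norm_coef_eq hm, Complex.norm_real]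
    exact (mul_le_mul_of_nonneg_left (P.rho_le m hm i) (Real.exp_pos _).le).trans
      (hR _ (hfar m hm hmS)).2
  rw [fderiv_sig_single, hsplit, P.rho_base]
  have h3 : ∑ j, P.coef (P.vert j) * (P.rho (P.vert j) i : ℂ) =
      P.coef (P.vert i) * P.a₀ (P.vert i) := by
    rw [Finset.sum_eq_single i]
    · rw [P.rho_vert, Pi.single_eq_same]; rfl
    · intro j _ hj; rw [P.rho_vert, Pi.single_eq_of_ne hj.symm]; simp
    · simp
  rw [h3]
  have h4 : c₀ / (2 * (l + 1)) ≤ ‖P.coef (P.vert i) * P.a₀ (P.vert i)‖ := by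
    have ha := hκ.trans (P.le_a₀ (P.simplex_subset (P.vert_mem i)))
    rw [norm_mul, Complex.norm_real, Real.norm_of_nonneg (by linarith)]
    exact hi.trans (le_mul_of_one_le_right (norm_nonneg _) ha)
  have h5 : c₀ / (2 * (l + 1)) = c₀ / (4 * (l + 1)) + c₀ / (4 * (l + 1)) := by field_simp; ring
  set x : ℂ := P.coef (P.vert i) * P.a₀ (P.vert i)
  set y : ℂ := ∑ m ∈ Δ \ P.simplex, P.coef m * P.rho m i
  have h6 : ‖x‖ - ‖y‖ ≤ ‖x + y‖ := by
    have := norm_sub_norm_le x (-y)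
    rwa [norm_neg, sub_neg_eq_add] at this
  simp only [Pi.zero_apply, Complex.ofReal_zero, mul_zero, zero_add]
  linarith

end ModelPoint

end ToricDegeneration

end

noncomputable section

namespace ToricDegeneration

open Filter Topology

variable {l : ℕ}

/-! ### Adapted charts of the torus -/

/-- `P` describes the terms at the point `z` in the linear coordinates given by `A`. -/
structure IsModelOf {Δ : Finset (Fin l → ℤ)} {w : (Fin l → ℤ) → ℝ} {κ C : ℝ} (τ : ℂ)
    (z : Fin l → ℂ) (P : ModelPoint Δ (topSimplices Δ w) κ C)
    (A : (Fin l → ℂ) ≃L[ℂ] (Fin l → ℂ)) : Prop where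
  ne_zero : ∀ k, z k ≠ 0
  pairing : ∀ m ∈ Δ, ∀ y, ∑ k, (m k : ℂ) * A y k =
    ∑ k, (P.base k : ℂ) * A y k + linForm (P.rho m) y
  coef : ∀ m ∈ Δ, term w τ m z = (Real.sqrt (sumSq Δ w τ z) : ℂ) * P.coef m

theorem term_ne_zero (w : (Fin l → ℤ) → ℝ) (τ : ℂ) (m : Fin l → ℤ) {z : Fin l → ℂ}
    (hz : ∀ k, z k ≠ 0) : term w τ m z ≠ 0 :=
  mul_ne_zero (Complex.exp_ne_zero _) (Finset.prod_ne_zero_iff.2 fun k _ => zpow_ne_zero _ (hz k))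

theorem sumSq_pos {Δ : Finset (Fin l → ℤ)} (hΔ : Δ.Nonempty) (w : (Fin l → ℤ) → ℝ) (τ : ℂ)
    {z : Fin l → ℂ} (hz : ∀ k, z k ≠ 0) : 0 < sumSq Δ w τ z :=
  Finset.sum_pos (fun m _ => by have := norm_pos_iff.2 (term_ne_zero w τ m hz); positivity) hΔ

theorem log_norm_term (w : (Fin l → ℤ) → ℝ) (τ : ℂ) (m : Fin l → ℤ) {z : Fin l → ℂ}
    (hz : ∀ k, z k ≠ 0) :
    Real.log ‖term w τ m z‖ = w m * τ.re + ∑ k, (m k : ℝ) * Real.log ‖z k‖ := by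
  have h1 : ∀ k, ‖z k‖ ≠ 0 := fun k => norm_ne_zero_iff.2 (hz k)
  rw [term, mono, norm_mul, Complex.norm_exp, Complex.re_ofReal_mul, norm_prod,
    Real.log_mul (Real.exp_pos _).ne' (Finset.prod_ne_zero_iff.2 fun k _ =>
      norm_ne_zero_iff.2 (zpow_ne_zero _ (hz k))), Real.log_exp, Real.log_prod fun k _ =>
      norm_ne_zero_iff.2 (zpow_ne_zero _ (hz k))]
  congr 1
  exact Finset.sum_congr rfl fun k _ => by rw [norm_zpow, Real.log_zpow]

theorem a_eq_affine {Δ : Finset (Fin l → ℤ)} (hΔ : Δ.Nonempty) (w : (Fin l → ℤ) → ℝ) (κ : ℝ)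
    (τ : ℂ) {z : Fin l → ℂ} (hz : ∀ k, z k ≠ 0) (m : Fin l → ℤ) :
    a Δ w κ τ m z = (-2 * τ.re) * w m + affineOf (κ + Real.log (sumSq Δ w τ z))
      (fun k => -2 * Real.log ‖z k‖) (toReal m) := by
  have h1 := sumSq_pos hΔ w τ hz
  have h2 := norm_pos_iff.2 (term_ne_zero w τ m hz)
  rw [a, eta, Real.log_div (by positivity) h1.ne', Real.log_pow, log_norm_term w τ m hz,
    affineOf_apply]
  have h3 : ∑ k, -2 * Real.log ‖z k‖ * toReal m k =
      -2 * ∑ k, (m k : ℝ) * Real.log ‖z k‖ := by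
    rw [Finset.mul_sum]
    exact Finset.sum_congr rfl fun k _ => by rw [toReal]; ring
  rw [h3]
  push_cast
  ring

/-- By `a_eq_affine` the adapted simplex theorem applies to `m ↦ a_m`, with `L = -2 Re τ`. The
coordinates are dual to the simplex and scaled by `a_m` at its vertices, so the exponent of `m` is
its barycentric coordinate times the vertex value. Adaptedness bounds this product by a multiple of
`a_m` itself. -/
theorem exists_model {Δ : Finset (Fin l → ℤ)} {w : (Fin l → ℤ) → ℝ}
    (hΔ : IsLatticePolytope Δ) (hw : IsConvexSimplicial Δ w) {κ : ℝ} (hκ : 0 < κ) :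
    ∃ C ε : ℝ, 0 < ε ∧ ∀ (τ : ℂ) (z : Fin l → ℂ), τ.re < 0 → (∀ k, z k ≠ 0) →
      ∃ (P : ModelPoint Δ (topSimplices Δ w) κ C) (A : (Fin l → ℂ) ≃L[ℂ] (Fin l → ℂ)),
        IsModelOf τ z P A ∧ ∀ m ∈ Δ, m ∉ P.simplex → ε * (-2 * τ.re) ≤ P.a₀ m := by
  classical
  obtain ⟨K, ε, hK, hε, hadapt⟩ := exists_adapted_simplex hΔ hw
  obtain ⟨B, c, hB, hc, hbd⟩ := exists_bary_bounds Δ w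
  have hΔne := nonempty_of_isLatticePolytope hΔ
  -- The three entries serve `rho_le`, `base_le` and `prod_le` respectively.
  set C : ℝ := max (B * K) (max (K * (κ + Real.log Δ.card)) (K ^ (l + 1))) with hC
  refine ⟨C, ε, hε, fun τ z hτ hz => ?_⟩
  have hs := sumSq_pos hΔne w τ hz
  set s : ℝ := Real.sqrt (sumSq Δ w τ z) with hsdef
  have hspos : 0 < s := Real.sqrt_pos.2 hs
  set α : (Fin l → ℤ) → ℝ := fun m => a Δ w κ τ m z with hα
  have hαaff : ∀ m ∈ Δ, α m = (-2 * τ.re) * w m + affineOf (κ + Real.log (sumSq Δ w τ z))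
      (fun k => -2 * Real.log ‖z k‖) (toReal m) := fun m _ => a_eq_affine hΔne w κ τ hz m
  have hcoefa : ∀ m, κ - Real.log (‖term w τ m z / (s : ℂ)‖ ^ 2) = α m := by
    intro m
    rw [norm_div, Complex.norm_real, Real.norm_of_nonneg hspos.le, div_pow, Real.sq_sqrt hs.le]
    rfl
  have hακ : ∀ m ∈ Δ, κ ≤ α m := by
    intro m hm
    have h1 := Finset.single_le_sum (f := fun m => ‖term w τ m z‖ ^ 2)
      (fun _ _ => by positivity) hm
    have h2 : eta Δ w τ m z ≤ 1 := (div_le_one hs).2 h1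
    have h3 : 0 ≤ eta Δ w τ m z := by unfold eta; positivity
    have := Real.log_nonpos h3 h2
    simp only [hα, a]
    linarith
  have hα0 : ∀ m ∈ Δ, 0 ≤ α m := fun m hm => hκ.le.trans (hακ m hm)
  obtain ⟨S, hS, hSα, hfar⟩ := hadapt (-2 * τ.re) _ α (by linarith) hαaff hα0
  have hb := isVertexBasis_of_mem hw hS
  have hSΔ : S ⊆ Δ := (mem_topSimplices.1 hS).1.2.1
  -- a vertex with a large term
  obtain ⟨m1, hm1, hm1a⟩ : ∃ m1 ∈ Δ, α m1 ≤ κ + Real.log Δ.card := by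
    have hcard : (0 : ℝ) < Δ.card := by exact_mod_cast Finset.card_pos.2 hΔne
    obtain ⟨m1, hm1, hle⟩ := Finset.exists_le_of_sum_le hΔne
      (f := fun _ => sumSq Δ w τ z / Δ.card) (g := fun m => ‖term w τ m z‖ ^ 2) (by
        rw [Finset.sum_const, nsmul_eq_mul, mul_div_cancel₀ _ hcard.ne']; rfl)
    refine ⟨m1, hm1, ?_⟩
    have h1 : (Δ.card : ℝ)⁻¹ ≤ eta Δ w τ m1 z := by
      rw [eta, le_div_iff₀ hs, inv_mul_eq_div]; exact hle
    have h2 := Real.log_le_log (by positivity) h1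
    rw [Real.log_inv] at h2
    simp only [hα, a]
    linarith
  -- The point `m1` with a large term need not be a vertex of `S`. Its barycentric coordinates add
  -- up to `1`, so one is nonzero, and adaptedness transfers the bound to that vertex.
  obtain ⟨m0, hm0, hm0b⟩ : ∃ m0 ∈ S, bary S m0 (toReal m1) ≠ 0 := by
    by_contra hcon
    push Not at hcon
    have := sum_bary hb (toReal m1)
    rw [Finset.sum_eq_zero hcon] at this
    exact zero_ne_one this
  have hm0a : α m0 ≤ K * (κ + Real.log Δ.card) :=
    (hSα m0 hm0 m1 hm1 hm0b).trans (mul_le_mul_of_nonneg_left hm1a hK.le)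
  let e : S.erase m0 ≃ Fin l := (S.erase m0).equivFinOfCardEq (by
    rw [Finset.card_erase_of_mem hm0, hb.2]; rfl)
  let vert : Fin l → Fin l → ℤ := fun i => (e.symm i).1
  have hvS : ∀ i, vert i ∈ S := fun i => Finset.mem_of_mem_erase (e.symm i).2
  have hvne : ∀ i, vert i ≠ m0 := fun i => Finset.ne_of_mem_erase (e.symm i).2
  have hvinj : Function.Injective vert := Subtype.val_injective.comp e.symm.injective
  let rho : (Fin l → ℤ) → Fin l → ℝ := fun m i => bary S (vert i) (toReal m) * α (vert i)
  have hαpos : ∀ i, 0 < α (vert i) := fun i => hκ.trans_le (hακ _ (hSΔ (hvS i)))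
  have hrv : ∀ i, rho (vert i) = Pi.single i (α (vert i)) := by
    intro i
    funext j
    simp only [rho]
    rw [bary_apply hb (hvS j) (hvS i)]
    by_cases h : j = i
    · subst h; simp
    · rw [if_neg fun h' => h (hvinj h'), Pi.single_eq_of_ne h, zero_mul]
  have hrb : rho m0 = 0 := by
    funext j
    simp only [rho]
    rw [bary_apply hb (hvS j) hm0, if_neg (hvne j), zero_mul]
    rfl
  let P : ModelPoint Δ (topSimplices Δ w) κ C :=
    { coef := fun m => term w τ m z / (s : ℂ)
      rho := rho
      simplex := S
      base := m0
      vert := vert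
      subset := fun S hS => (mem_topSimplices.1 hS).1.2.1
      card := fun S hS => (mem_topSimplices.1 hS).2
      mem := hS
      coef_ne := fun m _ => div_ne_zero (term_ne_zero w τ m hz)
        (Complex.ofReal_ne_zero.2 hspos.ne')
      sum_coef := by
        have hs2 : s ^ 2 = sumSq Δ w τ z := Real.sq_sqrt hs.le
        simp only [norm_div, Complex.norm_real, Real.norm_of_nonneg hspos.le, div_pow, hs2]
        rw [← Finset.sum_div]
        exact div_self hs.ne'
      base_mem := hm0
      vert_mem := hvS
      vert_inj := hvinj
      vert_ne := hvne
      rho_base := hrb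
      rho_vert := fun i => by rw [hcoefa, hrv]
      rho_le := fun m hm i => by
        rw [hcoefa]
        have h0 := hα0 m hm
        simp only [rho]
        rw [abs_mul, abs_of_pos (hαpos i)]
        by_cases hz0 : bary S (vert i) (toReal m) = 0
        · rw [hz0, abs_zero, zero_mul]
          exact mul_nonneg ((by positivity : 0 ≤ B * K).trans (le_max_left _ _)) h0
        · calc |bary S (vert i) (toReal m)| * α (vert i) ≤ B * (K * α m) :=
                mul_le_mul (hbd S hS _ (hvS i) m hm).1 (hSα _ (hvS i) m hm hz0) (hαpos i).le hB.le
            _ = B * K * α m := by ring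
            _ ≤ C * α m := mul_le_mul_of_nonneg_right (le_max_left _ _) h0
      base_le := by
        rw [hcoefa]
        exact hm0a.trans ((le_max_left _ _).trans (le_max_right _ _))
      prod_le := fun S' hS' => by
        simp only [hcoefa]
        refine (prod_adapted_le hw hα0 hS hS' hSα).trans (mul_le_mul_of_nonneg_right
          ((le_max_right _ _).trans (le_max_right _ _)) ?_)
        exact Finset.prod_nonneg fun m hm => hα0 m ((mem_topSimplices.1 hS').1.2.1 hm) }
  -- The columns are the linear parts of the barycentric functions scaled by `α`, so pairing with `m
  -- - m0` gives the exponents `rho m`. Pairing with the vertices recovers each `y i`, hence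
  -- injectivity.
  let A₀ : (Fin l → ℂ) →ₗ[ℂ] (Fin l → ℂ) := Matrix.toLin' (Matrix.of fun k i =>
    ((α (vert i) * (bary S (vert i)).linear (Pi.single k 1) : ℝ) : ℂ))
  have hA₀ : ∀ y k, A₀ y k = ∑ i, ((α (vert i) * (bary S (vert i)).linear (Pi.single k 1) : ℝ) : ℂ)
      * y i := fun y k => by
    simp only [A₀, Matrix.toLin'_apply, Matrix.mulVec, dotProduct, Matrix.of_apply]
  have hbarysub : ∀ (m : Fin l → ℤ) i, ∑ k, (m k : ℝ) * (bary S (vert i)).linear (Pi.single k 1) =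
      ∑ k, (m0 k : ℝ) * (bary S (vert i)).linear (Pi.single k 1) + bary S (vert i) (toReal m) := by
    intro m i
    have h1 := affineMap_eq_const_add_sum (bary S (vert i)) (toReal m)
    have h2 := affineMap_eq_const_add_sum (bary S (vert i)) (toReal m0)
    rw [bary_apply hb (hvS i) hm0, if_neg (hvne i)] at h2
    have h3 : ∀ m : Fin l → ℤ, ∑ k, (bary S (vert i)).linear (Pi.single k 1) * toReal m k =
        ∑ k, (m k : ℝ) * (bary S (vert i)).linear (Pi.single k 1) := fun m =>
      Finset.sum_congr rfl fun k _ => by rw [toReal]; ring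
    rw [h3] at h1 h2
    linarith
  have hpair : ∀ (m : Fin l → ℤ) y, ∑ k, (m k : ℂ) * A₀ y k =
      ∑ k, (m0 k : ℂ) * A₀ y k + linForm (rho m) y := by
    intro m y
    have h1 : ∀ m : Fin l → ℤ, ∑ k, (m k : ℂ) * A₀ y k = ∑ i, ((α (vert i) *
        ∑ k, (m k : ℝ) * (bary S (vert i)).linear (Pi.single k 1) : ℝ) : ℂ) * y i := by
      intro m
      simp only [hA₀, Finset.mul_sum]
      rw [Finset.sum_comm]
      refine Finset.sum_congr rfl fun i _ => ?_
      push_cast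
      rw [Finset.sum_mul]
      exact Finset.sum_congr rfl fun k _ => by ring
    rw [h1, h1, linForm_apply, ← Finset.sum_add_distrib]
    refine Finset.sum_congr rfl fun i _ => ?_
    rw [hbarysub m i]
    simp only [rho]
    push_cast
    ring
  have hinj : Function.Injective A₀ := by
    rw [← LinearMap.ker_eq_bot, LinearMap.ker_eq_bot']
    intro y hy
    funext i
    have h1 := hpair (vert i) y
    have h2 : linForm (Pi.single i (α (vert i))) y = α (vert i) * y i := by
      rw [linForm_apply, Finset.sum_eq_single i]
      · simp
      · intro j _ hj; simp [Pi.single_eq_of_ne hj]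
      · simp
    rw [hrv, hy, h2] at h1
    simpa [(hαpos i).ne'] using h1
  let A : (Fin l → ℂ) ≃L[ℂ] (Fin l → ℂ) :=
    (LinearEquiv.ofInjectiveEndo A₀ hinj).toContinuousLinearEquiv
  have hAA : ∀ y, A y = A₀ y := fun y => rfl
  refine ⟨P, A, ⟨hz, fun m _ y => hpair m y, fun m _ => ?_⟩, fun m hm hmS => ?_⟩
  · have : (s : ℂ) ≠ 0 := Complex.ofReal_ne_zero.2 hspos.ne'
    exact (mul_div_cancel₀ _ this).symm
  · have : P.a₀ m = α m := hcoefa m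
    rw [this]
    exact hfar m hm hmS

/-- The chart `y ↦ z exp(A y)` of the torus. -/
def chart (z : Fin l → ℂ) (A : (Fin l → ℂ) ≃L[ℂ] (Fin l → ℂ)) (y : Fin l → ℂ) : Fin l → ℂ :=
  fun k => z k * Complex.exp (A y k)

/-- A right inverse of the chart. -/
def chartInv (z : Fin l → ℂ) (A : (Fin l → ℂ) ≃L[ℂ] (Fin l → ℂ)) (x : Fin l → ℂ) : Fin l → ℂ :=
  A.symm fun k => Complex.log (x k / z k)

theorem chart_zero (z : Fin l → ℂ) (A : (Fin l → ℂ) ≃L[ℂ] (Fin l → ℂ)) : chart z A 0 = z := by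
  funext k; simp [chart]

theorem chart_chartInv {z : Fin l → ℂ} (hz : ∀ k, z k ≠ 0) (A : (Fin l → ℂ) ≃L[ℂ] (Fin l → ℂ))
    {x : Fin l → ℂ} (hx : ∀ k, x k ≠ 0) : chart z A (chartInv z A x) = x := by
  funext k
  simp only [chart, chartInv, ContinuousLinearEquiv.apply_symm_apply]
  rw [Complex.exp_log (div_ne_zero (hx k) (hz k)), mul_div_cancel₀ _ (hz k)]

theorem chartInv_self {z : Fin l → ℂ} (hz : ∀ k, z k ≠ 0)
    (A : (Fin l → ℂ) ≃L[ℂ] (Fin l → ℂ)) : chartInv z A z = 0 := by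
  have : (fun k => Complex.log (z k / z k)) = 0 := by funext k; simp [div_self (hz k)]
  rw [chartInv, this, map_zero]

theorem chart_contDiff (z : Fin l → ℂ) (A : (Fin l → ℂ) ≃L[ℂ] (Fin l → ℂ)) :
    ContDiff ℂ ∞ (chart z A) := by
  rw [contDiff_pi]
  intro k
  unfold chart
  exact contDiff_const.mul ((contDiff_pi.1 A.contDiff k).cexp)

theorem chartInv_contDiffAt (z : Fin l → ℂ) (A : (Fin l → ℂ) ≃L[ℂ] (Fin l → ℂ))
    {x : Fin l → ℂ} (hx : ∀ k, x k / z k ∈ Complex.slitPlane) :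
    ContDiffAt ℂ ∞ (chartInv z A) x := by
  unfold chartInv
  refine A.symm.contDiff.contDiffAt.comp x (contDiffAt_pi.2 fun k => ?_)
  have h : ContDiffAt ℂ ∞ (fun x : Fin l → ℂ => x k / z k) x := by fun_prop
  exact (Complex.contDiffAt_log (hx k)).comp x h

namespace IsModelOf

variable {Δ : Finset (Fin l → ℤ)} {w : (Fin l → ℤ) → ℝ} {κ C : ℝ} {τ : ℂ} {z : Fin l → ℂ}
  {P : ModelPoint Δ (topSimplices Δ w) κ C} {A : (Fin l → ℂ) ≃L[ℂ] (Fin l → ℂ)}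

/-- The exponent of the term of the base vertex, as a linear form. -/
def baseForm (P : ModelPoint Δ (topSimplices Δ w) κ C) (A : (Fin l → ℂ) ≃L[ℂ] (Fin l → ℂ)) :
    (Fin l → ℂ) →L[ℂ] ℂ :=
  (linForm fun k => (P.base k : ℝ)).comp (A : (Fin l → ℂ) →L[ℂ] (Fin l → ℂ))

/-- The factor common to all terms is holomorphic and nowhere zero. It drops out of `eta` and of the
zero set, and adds only a constant and a pluriharmonic function to the potential. -/
theorem term_chart (h : IsModelOf τ z P A) {m : Fin l → ℤ} (hm : m ∈ Δ) (y : Fin l → ℂ) :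
    term w τ m (chart z A y) =
      (Real.sqrt (sumSq Δ w τ z) : ℂ) * Complex.exp (baseForm P A y) * P.u m y := by
  have h1 : mono m (chart z A y) = mono m z * Complex.exp (∑ k, (m k : ℂ) * A y k) := by
    simp only [mono, chart, mul_zpow, Finset.prod_mul_distrib, Complex.exp_sum, Complex.exp_int_mul]
  have h2 : baseForm P A y = ∑ k, (P.base k : ℂ) * A y k := by
    simp [baseForm, linForm_apply]
  rw [term, h1, ← mul_assoc]
  change term w τ m z * _ = _
  rw [h.coef m hm, h.pairing m hm, Complex.exp_add, h2, ModelPoint.u]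
  ring

theorem delta_nonempty (P : ModelPoint Δ (topSimplices Δ w) κ C) : Δ.Nonempty :=
  ⟨_, P.simplex_subset P.base_mem⟩

theorem sumSq_pos' (h : IsModelOf τ z P A) : 0 < sumSq Δ w τ z :=
  sumSq_pos (delta_nonempty P) w τ h.ne_zero

theorem sumSq_chart (h : IsModelOf τ z P A) (y : Fin l → ℂ) :
    sumSq Δ w τ (chart z A y) =
      sumSq Δ w τ z * Real.exp (2 * (baseForm P A y).re) * ∑ m ∈ Δ, ‖P.u m y‖ ^ 2 := by
  conv_lhs => rw [sumSq]
  rw [Finset.mul_sum]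
  refine Finset.sum_congr rfl fun m hm => ?_
  rw [h.term_chart hm, norm_mul, norm_mul, Complex.norm_exp, Complex.norm_real,
    Real.norm_of_nonneg (Real.sqrt_nonneg _), mul_pow, mul_pow, Real.sq_sqrt h.sumSq_pos'.le,
    ← Real.exp_nat_mul]
  push_cast
  rfl

theorem a_chart (h : IsModelOf τ z P A) {m : Fin l → ℤ} (hm : m ∈ Δ) (y : Fin l → ℂ) :
    a Δ w κ τ m (chart z A y) = P.aFun m y := by
  have h0 := h.sumSq_pos'
  have h1 := P.sum_pos y
  have hc := P.norm_coef_pos hm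
  have h2 : eta Δ w τ m (chart z A y) = ‖P.u m y‖ ^ 2 / ∑ m ∈ Δ, ‖P.u m y‖ ^ 2 := by
    rw [eta, h.sumSq_chart, h.term_chart hm, norm_mul, norm_mul, Complex.norm_exp,
      Complex.norm_real, Real.norm_of_nonneg (Real.sqrt_nonneg _), mul_pow, mul_pow,
      Real.sq_sqrt h0.le, ← Real.exp_nat_mul]
    push_cast
    have := Real.exp_pos (2 * (baseForm P A y).re)
    field_simp
  have h3 : 0 < ‖P.u m y‖ ^ 2 := by rw [P.norm_u]; positivity
  rw [a, h2, Real.log_div h3.ne' h1.ne', P.norm_u, mul_pow,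
    Real.log_mul (by positivity) (by positivity), ← Real.exp_nat_mul, Real.log_exp,
    ModelPoint.aFun, ModelPoint.a₀, ModelPoint.logSum]
  push_cast
  ring

theorem potential_chart (h : IsModelOf τ z P A) (hκ : 0 < κ) (y : Fin l → ℂ) :
    potential Δ w κ τ (chart z A y) =
      P.pot y + (2 * (baseForm P A y).re + (Real.log (κ ^ 2) + Real.log (sumSq Δ w τ z))) := by
  have h0 := h.sumSq_pos'
  have h1 := P.sum_pos y
  have h2 : ToricDegeneration.h Δ w κ τ (chart z A y) =
      κ ^ 2 * ∑ S ∈ topSimplices Δ w, ((∏ m ∈ S, P.aFun m y)⁻¹) ^ 2 := by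
    rw [ToricDegeneration.h]
    congr 1
    refine Finset.sum_congr rfl fun S hS => ?_
    rw [Finset.prod_congr rfl fun m hm => h.a_chart (P.subset S hS hm) y]
  have h3 : 0 < ∑ S ∈ topSimplices Δ w, ((∏ m ∈ S, P.aFun m y)⁻¹) ^ 2 := by
    refine Finset.sum_pos (fun S hS => ?_) ⟨_, P.mem⟩
    have := P.prod_aFun_pos hκ hS y
    positivity
  have h4 := Real.exp_pos (2 * (baseForm P A y).re)
  rw [potential, h2, h.sumSq_chart, Real.log_mul (by positivity) (by positivity),
    Real.log_mul (by positivity) h3.ne', Real.log_mul (by positivity) h1.ne',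
    Real.log_mul h0.ne' h4.ne', Real.log_exp, ModelPoint.pot, ModelPoint.logSum]
  ring

theorem section_chart (h : IsModelOf τ z P A) (y : Fin l → ℂ) :
    section_t Δ w τ (chart z A y) =
      (Real.sqrt (sumSq Δ w τ z) : ℂ) * Complex.exp (baseForm P A y) * P.sig y := by
  rw [section_t, ModelPoint.sig, Finset.mul_sum]
  exact Finset.sum_congr rfl fun m hm => h.term_chart hm y

theorem chart_mem_X (h : IsModelOf τ z P A) {y : Fin l → ℂ} :
    chart z A y ∈ X Δ w τ ↔ P.sig y = 0 := by
  have h1 : ∀ k, chart z A y k ≠ 0 := fun k => mul_ne_zero (h.ne_zero k) (Complex.exp_ne_zero _)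
  have h2 : (Real.sqrt (sumSq Δ w τ z) : ℂ) ≠ 0 :=
    Complex.ofReal_ne_zero.2 (Real.sqrt_pos.2 h.sumSq_pos').ne'
  simp only [X, Set.mem_ofPred_eq, h.section_chart, mul_eq_zero, h2, Complex.exp_ne_zero, or_self,
    false_or]
  exact ⟨fun h => h.2, fun h => ⟨h1, h⟩⟩

end IsModelOf

end ToricDegeneration

end

noncomputable section

namespace ToricDegeneration

open Filter Topology ChartGeometry

variable {l : ℕ}

/-! ### The Levi form and the approximate metric -/

theorem metric_eq_lev (Δ : Finset (Fin l → ℤ)) (w : (Fin l → ℤ) → ℝ) (κ : ℝ) (τ : ℂ)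
    (z u v : Fin l → ℂ) :
    metric Δ w κ τ z u v = lev (potential Δ w κ τ) z u v / (4 * Real.pi) := by
  have h : Complex.I • Complex.I • v = -v := by
    rw [smul_smul, Complex.I_mul_I, neg_one_smul]
  rw [metric, omega, ddbar, lev, h, map_neg]
  congr 1
  ring

theorem lev_symm {Φ : (Fin l → ℂ) → ℝ} {z : Fin l → ℂ} (hΦ : ContDiffAt ℝ ∞ Φ z)
    (u v : Fin l → ℂ) : lev Φ z u v = lev Φ z v u := by
  have h := hΦ.isSymmSndFDerivAt two_le_infty
  rw [lev, lev, h.eq u v, h.eq (Complex.I • u) (Complex.I • v)]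

theorem lev_add_left (Φ : (Fin l → ℂ) → ℝ) (z u u' v : Fin l → ℂ) :
    lev Φ z (u + u') v = lev Φ z u v + lev Φ z u' v := by
  simp only [lev, smul_add, map_add, add_apply]
  ring

theorem lev_add_right (Φ : (Fin l → ℂ) → ℝ) (z u v v' : Fin l → ℂ) :
    lev Φ z u (v + v') = lev Φ z u v + lev Φ z u v' := by
  simp only [lev, smul_add, map_add]
  ring

theorem lev_smul_left (Φ : (Fin l → ℂ) → ℝ) (c : ℝ) (z u v : Fin l → ℂ) :
    lev Φ z (c • u) v = c * lev Φ z u v := by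
  simp only [lev, smul_comm Complex.I c u, map_smul, smul_apply, smul_eq_mul]
  ring

theorem lev_smul_right (Φ : (Fin l → ℂ) → ℝ) (c : ℝ) (z u v : Fin l → ℂ) :
    lev Φ z u (c • v) = c * lev Φ z u v := by
  simp only [lev, smul_comm Complex.I c v, map_smul, smul_eq_mul]
  ring

/-- Adding a real affine function does not change the Levi form. -/
theorem lev_add_affine {Φ : (Fin l → ℂ) → ℝ} {z : Fin l → ℂ} (hΦ : ContDiffAt ℝ ∞ Φ z)
    (L : (Fin l → ℂ) →L[ℝ] ℝ) (b : ℝ) (u v : Fin l → ℂ) :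
    lev (fun y => Φ y + (L y + b)) z u v = lev Φ z u v := by
  have h : fderiv ℝ (fun y => Φ y + (L y + b)) =ᶠ[𝓝 z] fun y => fderiv ℝ Φ y + L := by
    filter_upwards [eventually_differentiableAt hΦ] with y hy
    exact (hy.hasFDerivAt.add (L.hasFDerivAt.add_const b)).fderiv
  rw [lev, lev, h.fderiv_eq, fderiv_add_const]

/-- The chain rule produces the extra term `DΦ(D²Θ(u, v))`. As `D²Θ` is complex bilinear, its values
at `(u, v)` and at `(iu, iv)` are opposite and cancel in the Levi form. -/
theorem lev_comp {Φ : (Fin l → ℂ) → ℝ} {Θ : (Fin l → ℂ) → Fin l → ℂ} {y : Fin l → ℂ}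
    (hΘ : ContDiff ℂ ∞ Θ) (hΦ : ContDiffAt ℝ ∞ Φ (Θ y)) (u v : Fin l → ℂ) :
    lev (fun y => Φ (Θ y)) y u v = lev Φ (Θ y) (fderiv ℂ Θ y u) (fderiv ℂ Θ y v) := by
  have hΘd : ∀ x, HasFDerivAt Θ ((fderiv ℂ Θ x).restrictScalars ℝ) x := fun x =>
    ((hΘ.differentiable (by simp)).differentiableAt.hasFDerivAt).restrictScalars ℝ
  have hΘ2 : ∀ v, HasFDerivAt (fun x => fderiv ℂ Θ x v)
      (((ContinuousLinearMap.apply ℂ _ v).comp (fderiv ℂ (fderiv ℂ Θ) y)).restrictScalars ℝ) y :=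
    fun v => by
      have h1 : ContDiff ℂ ∞ (fderiv ℂ Θ) := hΘ.fderiv_right (by simp)
      exact (((ContinuousLinearMap.apply ℂ (Fin l → ℂ) v).hasFDerivAt).comp y
        (h1.differentiable (by simp)).differentiableAt.hasFDerivAt).restrictScalars ℝ
  have hcomp : ContDiffAt ℝ ∞ (fun y => Φ (Θ y)) y :=
    hΦ.comp y (hΘ.restrict_scalars ℝ).contDiffAt
  have key : ∀ u v, fderiv ℝ (fderiv ℝ fun y => Φ (Θ y)) y u v =
      fderiv ℝ (fderiv ℝ Φ) (Θ y) (fderiv ℂ Θ y u) (fderiv ℂ Θ y v) +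
        fderiv ℝ Φ (Θ y) (fderiv ℂ (fderiv ℂ Θ) y u v) := by
    intro u v
    have h1 : HasFDerivAt (fun x => fderiv ℝ (fun y => Φ (Θ y)) x v)
        ((ContinuousLinearMap.apply ℝ _ v).comp (fderiv ℝ (fderiv ℝ fun y => Φ (Θ y)) y)) y :=
      ((ContinuousLinearMap.apply ℝ ℝ v).hasFDerivAt).comp y
        (hcomp.fderiv_smooth.differentiableAt (by simp)).hasFDerivAt
    have h2 : (fun x => fderiv ℝ (fun y => Φ (Θ y)) x v) =ᶠ[𝓝 y]
        fun x => fderiv ℝ Φ (Θ x) (fderiv ℂ Θ x v) := by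
      filter_upwards [hΘ.continuous.continuousAt.eventually (eventually_differentiableAt hΦ)]
        with x hx
      have h3 : HasFDerivAt (fun y => Φ (Θ y)) _ x := hx.hasFDerivAt.comp x (hΘd x)
      rw [h3.fderiv]
      rfl
    have h3 := ((hΦ.fderiv_smooth.differentiableAt (by simp)).hasFDerivAt.comp y
      (hΘd y)).clm_apply (hΘ2 v)
    have h4 := h1.unique (h3.congr_of_eventuallyEq h2)
    have h5 := congrArg (fun L => L u) h4
    simpa [add_comm] using h5
  have h6 : fderiv ℂ (fderiv ℂ Θ) y (Complex.I • u) (Complex.I • v) =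
      -fderiv ℂ (fderiv ℂ Θ) y u v := by
    rw [map_smul, map_smul, smul_apply, smul_smul, Complex.I_mul_I,
      neg_one_smul]
  rw [lev, key, key, h6, map_smul (fderiv ℂ Θ y), map_smul (fderiv ℂ Θ y), map_neg, lev]
  ring

theorem contDiffAt_lev {E : Type*} [NormedAddCommGroup E] [NormedSpace ℝ E]
    {Φ : (Fin l → ℂ) → ℝ} {F u v : E → Fin l → ℂ} {x : E} (hΦ : ContDiffAt ℝ ∞ Φ (F x))
    (hF : ContDiffAt ℝ ∞ F x) (hu : ContDiffAt ℝ ∞ u x) (hv : ContDiffAt ℝ ∞ v x) :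
    ContDiffAt ℝ ∞ (fun x => lev Φ (F x) (u x) (v x)) x := by
  have h : ContDiffAt ℝ ∞ (fun x => fderiv ℝ (fderiv ℝ Φ) (F x)) x :=
    hΦ.fderiv_smooth.fderiv_smooth.comp x hF
  exact ((h.clm_apply hu).clm_apply hv).add
    ((h.clm_apply (hu.const_smul Complex.I)).clm_apply (hv.const_smul Complex.I))

namespace IsModelOf

variable {Δ : Finset (Fin l → ℤ)} {w : (Fin l → ℤ) → ℝ} {κ C : ℝ} {τ : ℂ} {z : Fin l → ℂ}
  {P : ModelPoint Δ (topSimplices Δ w) κ C} {A : (Fin l → ℂ) ≃L[ℂ] (Fin l → ℂ)}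

theorem chartInv_contDiffAt_self (h : IsModelOf τ z P A) : ContDiffAt ℂ ∞ (chartInv z A) z :=
  chartInv_contDiffAt z A fun k => by
    rw [div_self (h.ne_zero k)]; exact Complex.one_mem_slitPlane

theorem eventually_ne_zero (h : IsModelOf τ z P A) : ∀ᶠ x in 𝓝 z, ∀ k, x k ≠ 0 :=
  eventually_all.2 fun k => (continuous_apply k).continuousAt.eventually_ne (h.ne_zero k)

/-- The real linear function that is the difference of the potentials, up to a constant. -/
def pluri (P : ModelPoint Δ (topSimplices Δ w) κ C) (A : (Fin l → ℂ) ≃L[ℂ] (Fin l → ℂ)) :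
    (Fin l → ℂ) →L[ℝ] ℝ :=
  (2 : ℝ) • Complex.reCLM.comp ((baseForm P A).restrictScalars ℝ)

theorem potential_chart_eq (h : IsModelOf τ z P A) (hκ : 0 < κ) :
    (fun y => potential Δ w κ τ (chart z A y)) = fun y =>
      P.pot y + (pluri P A y + (Real.log (κ ^ 2) + Real.log (sumSq Δ w τ z))) :=
  funext fun y => h.potential_chart hκ y

theorem potential_contDiffAt (h : IsModelOf τ z P A) (hκ : 0 < κ) :
    ContDiffAt ℝ ∞ (potential Δ w κ τ) z := by
  have h1 : ContDiff ℝ ∞ fun y => potential Δ w κ τ (chart z A y) := by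
    rw [h.potential_chart_eq hκ]
    exact (P.contDiff_pot hκ).add ((pluri P A).contDiff.add contDiff_const)
  have h2 : ContDiffAt ℝ ∞ (fun x => potential Δ w κ τ (chart z A (chartInv z A x))) z :=
    h1.contDiffAt.comp z (h.chartInv_contDiffAt_self.restrict_scalars ℝ)
  refine h2.congr_of_eventuallyEq ?_
  filter_upwards [h.eventually_ne_zero] with x hx
  rw [chart_chartInv h.ne_zero A hx]

theorem metric_chart (h : IsModelOf τ z P A) (hκ : 0 < κ) {y : Fin l → ℂ}
    (hy : ContDiffAt ℝ ∞ (potential Δ w κ τ) (chart z A y)) (u v : Fin l → ℂ) :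
    metric Δ w κ τ (chart z A y) (fderiv ℂ (chart z A) y u) (fderiv ℂ (chart z A) y v) =
      lev P.pot y u v / (4 * Real.pi) := by
  rw [metric_eq_lev, ← lev_comp (chart_contDiff z A) hy, h.potential_chart_eq hκ,
    lev_add_affine (P.contDiff_pot hκ).contDiffAt]

theorem fderiv_chart_chartInv (h : IsModelOf τ z P A) (v : Fin l → ℂ) :
    fderiv ℂ (chart z A) 0 (fderiv ℂ (chartInv z A) z v) = v := by
  have h1 : HasFDerivAt (chartInv z A) (fderiv ℂ (chartInv z A) z) z :=
    (h.chartInv_contDiffAt_self.differentiableAt (by simp)).hasFDerivAt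
  have h2 : HasFDerivAt (chart z A) (fderiv ℂ (chart z A) 0) (chartInv z A z) := by
    rw [chartInv_self h.ne_zero]
    exact ((chart_contDiff z A).differentiable (by simp)).differentiableAt.hasFDerivAt
  have h3 : (fun x => chart z A (chartInv z A x)) =ᶠ[𝓝 z] id := by
    filter_upwards [h.eventually_ne_zero] with x hx
    exact chart_chartInv h.ne_zero A hx
  have h4 := ((h2.comp z h1).congr_of_eventuallyEq h3.symm).unique (hasFDerivAt_id z)
  exact congrArg (fun L => L v) h4

/-- Positivity holds in all directions of the torus, before restriction to the hypersurface; the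
coercivity at the centre of the adapted chart is carried over by the derivative of the chart. -/
theorem metric_pos (h : IsModelOf τ z P A) (hκ : 2 * ((l : ℝ) + 1) ≤ κ) {v : Fin l → ℂ}
    (hv : v ≠ 0) : 0 < metric Δ w κ τ z v v := by
  have hκ0 : 0 < κ := by have : (0 : ℝ) ≤ l := l.cast_nonneg; linarith
  obtain ⟨c, hc, hcoer⟩ := ModelPoint.exists_coercive Δ (topSimplices Δ w) C hκ
  set u := fderiv ℂ (chartInv z A) z v with hu
  have huv : fderiv ℂ (chart z A) 0 u = v := h.fderiv_chart_chartInv v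
  have hu0 : u ≠ 0 := fun h0 => hv (by rw [← huv, h0, map_zero])
  have h1 := h.metric_chart hκ0 (y := 0) (by
    rw [chart_zero]; exact h.potential_contDiffAt hκ0) u u
  rw [huv, chart_zero] at h1
  rw [h1]
  have h2 : 0 < c * ‖u‖ ^ 2 := by have := norm_pos_iff.2 hu0; positivity
  exact div_pos (h2.trans_le (hcoer P u)) (by positivity)

/-- In the chart the section is a nonvanishing factor times `P.sig`. At a zero of `P.sig` the
product rule leaves only a nonzero multiple of its derivative. -/
theorem fderiv_section_ne_zero (h : IsModelOf τ z P A) (h0 : P.sig 0 = 0)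
    (h1 : fderiv ℂ P.sig 0 ≠ 0) : fderiv ℂ (section_t Δ w τ) z ≠ 0 := by
  intro hz
  set s : ℂ := (Real.sqrt (sumSq Δ w τ z) : ℂ) with hs
  have hs0 : s ≠ 0 := Complex.ofReal_ne_zero.2 (Real.sqrt_pos.2 h.sumSq_pos').ne'
  have hsec : DifferentiableAt ℂ (section_t Δ w τ) z := by
    unfold section_t term mono
    refine DifferentiableAt.fun_sum fun m _ => DifferentiableAt.const_mul ?_ _
    have h2 : ∀ k : Fin l, DifferentiableAt ℂ (fun z : Fin l → ℂ => z k ^ m k) z := fun k =>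
      DifferentiableAt.comp (g := fun x : ℂ => x ^ m k) z
        (differentiableAt_zpow.2 (Or.inl (h.ne_zero k))) (differentiableAt_apply k z)
    exact (HasFDerivAt.finsetProd fun k _ => (h2 k).hasFDerivAt).differentiableAt
  have h2 : HasFDerivAt (fun y => section_t Δ w τ (chart z A y)) (0 : (Fin l → ℂ) →L[ℂ] ℂ) 0 := by
    have h3 : HasFDerivAt (section_t Δ w τ) (0 : (Fin l → ℂ) →L[ℂ] ℂ) (chart z A 0) := by
      rw [chart_zero, ← hz]; exact hsec.hasFDerivAt
    have h4 := h3.comp 0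
      ((chart_contDiff z A).differentiable (by simp)).differentiableAt.hasFDerivAt
    rw [ContinuousLinearMap.zero_comp] at h4
    exact h4
  have h5 : HasFDerivAt (fun y => s * Complex.exp (baseForm P A y) * P.sig y)
      (s • fderiv ℂ P.sig 0) 0 := by
    have h6 : HasFDerivAt (fun y => s * Complex.exp (baseForm P A y)) _ 0 :=
      ((baseForm P A).hasFDerivAt.cexp).const_mul s
    have h7 := h6.mul (P.hasFDerivAt_sig 0).differentiableAt.hasFDerivAt
    exact h7.congr_fderiv (by ext v; simp [h0])
  have h8 : (fun y => section_t Δ w τ (chart z A y)) =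
      fun y => s * Complex.exp (baseForm P A y) * P.sig y := funext fun y => h.section_chart y
  rw [h8] at h2
  exact h1 ((smul_eq_zero.1 (h5.unique h2)).resolve_left hs0)

end IsModelOf

end ToricDegeneration

end

noncomputable section

namespace JetBdd

/-- Bounds over all model points are pulled back to families indexed by graphs. -/
theorem reindex {ι ι' E : Type} [NormedAddCommGroup E] [NormedSpace ℝ E] {p : ι → E} {n : ℕ}
    (r : ι' → ι) {F : Type} [NormedAddCommGroup F] [NormedSpace ℝ F] {f : ι → E → F}
    (h : JetBdd p n f) : JetBdd (fun j => p (r j)) n (fun j => f (r j)) := by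
  have h0 : ∀ {F : Type} [NormedAddCommGroup F] [NormedSpace ℝ F] {f : ι → E → F},
      JetBdd p 0 f → JetBdd (fun j => p (r j)) 0 (fun j => f (r j)) := by
    intro F _ _ f h
    obtain ⟨C, hC⟩ := h.2
    exact ⟨fun j => h.1 (r j), C, fun j => hC (r j)⟩
  induction n generalizing F with
  | zero => exact h0 h
  | succ n ih => exact ⟨h0 h.1, ih h.2⟩

end JetBdd

theorem SmoothBdd.reindex {ι ι' E F : Type} [NormedAddCommGroup E] [NormedSpace ℝ E]
    [NormedAddCommGroup F] [NormedSpace ℝ F] {p : ι → E} (r : ι' → ι) {f : ι → E → F}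
    (h : SmoothBdd p f) : SmoothBdd (fun j => p (r j)) (fun j => f (r j)) := fun n =>
  (h n).reindex r

namespace ToricDegeneration

open Filter Topology ChartGeometry

variable {l : ℕ}

/-! ### Hypersurfaces as graphs over a coordinate hyperplane -/

/-- `π` is a real coordinate system on the hyperplane `v i = 0`, extended along the `i`-th axis;
`Q` is the inverse of its restriction. -/
def IsSplitting (i : Fin l) (π : (Fin l → ℂ) →L[ℝ] (Fin (2 * (l - 1)) → ℝ))
    (Q : (Fin (2 * (l - 1)) → ℝ) →L[ℝ] (Fin l → ℂ)) : Prop :=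
  ∀ v : Fin l → ℂ, v = Q (π v) + v i • (Pi.single i 1 : Fin l → ℂ)

theorem exists_splitting (i : Fin l) : ∃ π Q, IsSplitting i π Q := by
  classical
  -- The index `i` forces `l ≥ 1`, so the truncated subtraction in `2 * (l - 1)` is harmless.
  have hdim : Module.finrank ℝ ({j : Fin l // j ≠ i} → ℂ) =
      Module.finrank ℝ (Fin (2 * (l - 1)) → ℝ) := by
    rw [Module.finrank_pi_fintype, Module.finrank_fintype_fun_eq_card]
    simp [Complex.finrank_real_complex, mul_comm]
  let e : ({j : Fin l // j ≠ i} → ℂ) ≃L[ℝ] (Fin (2 * (l - 1)) → ℝ) :=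
    ContinuousLinearEquiv.ofFinrankEq hdim
  let r : (Fin l → ℂ) →L[ℝ] ({j : Fin l // j ≠ i} → ℂ) :=
    ContinuousLinearMap.pi fun j => ContinuousLinearMap.proj j.1
  let q : ({j : Fin l // j ≠ i} → ℂ) →L[ℝ] (Fin l → ℂ) :=
    ContinuousLinearMap.pi fun j =>
      if h : j ≠ i then ContinuousLinearMap.proj (⟨j, h⟩ : {j : Fin l // j ≠ i}) else 0
  refine ⟨(e : _ →L[ℝ] _).comp r, q.comp (e.symm : _ →L[ℝ] _), fun v => ?_⟩
  funext j
  by_cases h : j = i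
  · subst h
    simp [q]
  · simp [q, r, h]

/-- `F` parametrizes the zero set of `P.sig` near `0` as a graph in the splitting `π`. -/
structure IsGraphOf {Δ : Finset (Fin l → ℤ)} {Z : Finset (Finset (Fin l → ℤ))} {κ C : ℝ}
    (π : (Fin l → ℂ) →L[ℝ] (Fin (2 * (l - 1)) → ℝ)) (P : ModelPoint Δ Z κ C)
    (F : (Fin (2 * (l - 1)) → ℝ) → Fin l → ℂ) : Prop where
  smooth : ContDiffAt ℝ ∞ F 0
  zero : F 0 = 0
  proj : ∀ᶠ y in 𝓝 0, π (F y) = y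
  sig : ∀ᶠ y in 𝓝 0, P.sig (F y) = 0

/-- The graph metric, i.e. the pull back of the Levi form. -/
def graphMetric (Φ : (Fin l → ℂ) → ℝ) (F : (Fin (2 * (l - 1)) → ℝ) → Fin l → ℂ)
    (y u v : Fin (2 * (l - 1)) → ℝ) : ℝ :=
  lev Φ (F y) (fderiv ℝ F y u) (fderiv ℝ F y v) / (4 * Real.pi)

section family

variable {Δ : Finset (Fin l → ℤ)} {Z : Finset (Finset (Fin l → ℤ))} {κ C : ℝ} {i : Fin l}
  {π : (Fin l → ℂ) →L[ℝ] (Fin (2 * (l - 1)) → ℝ)} {Q : (Fin (2 * (l - 1)) → ℝ) →L[ℝ] (Fin l → ℂ)}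

theorem hasFDerivAt_real_sig (P : ModelPoint Δ Z κ C) (y : Fin l → ℂ) :
    HasFDerivAt P.sig ((fderiv ℂ P.sig y).restrictScalars ℝ) y :=
  (P.hasFDerivAt_sig y).differentiableAt.hasFDerivAt.restrictScalars ℝ

theorem IsGraphOf.proj_fderiv {P : ModelPoint Δ Z κ C}
    {F : (Fin (2 * (l - 1)) → ℝ) → Fin l → ℂ} (hF : IsGraphOf π P F) :
    ∀ᶠ y in 𝓝 0, ∀ v, π (fderiv ℝ F y v) = v := by
  filter_upwards [eventually_differentiableAt hF.smooth, hF.proj.eventually_nhds] with y h1 h2 v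
  have h3 : HasFDerivAt (fun y => π (F y)) (π.comp (fderiv ℝ F y)) y :=
    π.hasFDerivAt.comp y h1.hasFDerivAt
  have h4 : (fun y => π (F y)) =ᶠ[𝓝 y] id := h2
  exact congrArg (fun L => L v) ((h3.congr_of_eventuallyEq h4.symm).unique (hasFDerivAt_id y))

/-- The derivative of the graph by implicit differentiation. -/
theorem IsGraphOf.fderiv_eq (hs : IsSplitting i π Q) {P : ModelPoint Δ Z κ C}
    {F : (Fin (2 * (l - 1)) → ℝ) → Fin l → ℂ} (hF : IsGraphOf π P F) (hκ : 0 < κ)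
    (h0 : fderiv ℂ P.sig 0 (Pi.single i 1) ≠ 0) :
    ∀ᶠ y in 𝓝 0, ∀ v, fderiv ℝ F y v = Q v - ((fderiv ℝ P.sig (F y) (Pi.single i 1))⁻¹ *
      fderiv ℝ P.sig (F y) (Q v)) • (Pi.single i 1 : Fin l → ℂ) := by
  have hreal : ∀ y, fderiv ℝ P.sig y = (fderiv ℂ P.sig y).restrictScalars ℝ := fun y =>
    (hasFDerivAt_real_sig P y).fderiv
  have hne : ∀ᶠ y in 𝓝 0, fderiv ℝ P.sig (F y) (Pi.single i 1) ≠ 0 := by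
    have h1 : ContDiffAt ℝ ∞ (fderiv ℝ P.sig) (F 0) := by
      rw [hF.zero]
      exact (ModelPoint.smoothBdd_sig hκ).fderiv.contDiffAt P
    have h2 : ContDiffAt ℝ ∞ (fun y => fderiv ℝ P.sig (F y) (Pi.single i 1)) 0 :=
      (h1.comp 0 hF.smooth).clm_apply contDiffAt_const
    refine h2.continuousAt.eventually_ne ?_
    rw [hF.zero, hreal]
    exact h0
  filter_upwards [eventually_differentiableAt hF.smooth, hF.proj_fderiv, hF.sig.eventually_nhds,
    hne] with y h1 h2 h3 h4 v
  have h5 : HasFDerivAt (fun y => P.sig (F y)) ((fderiv ℝ P.sig (F y)).comp (fderiv ℝ F y)) y :=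
    (hasFDerivAt_real_sig P (F y)).differentiableAt.hasFDerivAt.comp y h1.hasFDerivAt
  have h6 : (fun y => P.sig (F y)) =ᶠ[𝓝 y] fun _ => 0 := h3
  have h7 : fderiv ℝ P.sig (F y) (fderiv ℝ F y v) = 0 :=
    congrArg (fun L => L v) ((h5.congr_of_eventuallyEq h6.symm).unique (hasFDerivAt_const 0 y))
  have h8 := hs (fderiv ℝ F y v)
  rw [h2 v] at h8
  set b := fderiv ℝ F y v i with hb
  have h9 : fderiv ℝ P.sig (F y) (b • (Pi.single i 1 : Fin l → ℂ)) =
      b * fderiv ℝ P.sig (F y) (Pi.single i 1) := by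
    rw [hreal]
    exact map_smul (fderiv ℂ P.sig (F y)) b _
  rw [h8, map_add, h9] at h7
  have h10 : b = -((fderiv ℝ P.sig (F y) (Pi.single i 1))⁻¹ * fderiv ℝ P.sig (F y) (Q v)) := by
    rw [eq_neg_iff_add_eq_zero, ← mul_left_inj' h4, zero_mul, add_mul, mul_right_comm,
      inv_mul_cancel₀ h4, one_mul, add_comm]
    exact h7
  rw [h8, h10, neg_smul, sub_eq_add_neg]

/-- Implicit differentiation expresses `DF` through `F` and the derivative of `sig` along `F`, so
jets of order `n` of `F` bound those of order `n + 1`. The denominator is controlled by the slope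
bound `c` at the origin. -/
theorem smoothBdd_graph (hs : IsSplitting i π Q) (hκ : 0 < κ) {ι : Type}
    {P : ι → ModelPoint Δ Z κ C} {F : ι → (Fin (2 * (l - 1)) → ℝ) → Fin l → ℂ}
    (hF : ∀ j, IsGraphOf π (P j) (F j)) {c : ℝ} (hc : 0 < c)
    (hlow : ∀ j, c ≤ ‖fderiv ℂ (P j).sig 0 (Pi.single i 1)‖) :
    SmoothBdd (fun _ => 0) F := by
  have hzero : ∀ j, F j 0 = 0 := fun j => (hF j).zero
  have hne : ∀ j, fderiv ℂ (P j).sig 0 (Pi.single i 1) ≠ 0 := fun j =>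
    norm_pos_iff.1 (hc.trans_le (hlow j))
  have hbase : JetBdd (fun _ : ι => (0 : Fin (2 * (l - 1)) → ℝ)) 0 F :=
    ⟨fun j => (hF j).smooth, 0, fun j => by rw [hzero, norm_zero]⟩
  intro n
  induction n with
  | zero => exact hbase
  | succ n ih =>
    refine ⟨hbase, ?_⟩
    have hS : JetBdd (fun _ : ι => (0 : Fin (2 * (l - 1)) → ℝ)) n
        (fun j y => fderiv ℝ (P j).sig (F j y)) := by
      refine JetBdd.comp (f := fun j => fderiv ℝ (P j).sig) ?_ ih
      simpa only [hzero] using ((ModelPoint.smoothBdd_sig hκ).fderiv n).reindex P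
    have hinv : JetBdd (fun _ : ι => (0 : Fin (2 * (l - 1)) → ℝ)) n
        (fun j y => (fderiv ℝ (P j).sig (F j y) (Pi.single i 1))⁻¹) := by
      refine JetBdd.inv (hS.clm_apply (.const (c := fun _ => Pi.single i 1)
        ⟨‖(Pi.single i 1 : Fin l → ℂ)‖, fun _ => le_rfl⟩)) ⟨c, hc, fun j => ?_⟩
      rw [hzero, (hasFDerivAt_real_sig (P j) 0).fderiv]
      exact hlow j
    let J : ℂ →L[ℝ] (Fin l → ℂ) :=
      (ContinuousLinearMap.id ℝ ℂ).smulRight (Pi.single i 1 : Fin l → ℂ)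
    have hQ : JetBdd (fun _ : ι => (0 : Fin (2 * (l - 1)) → ℝ)) n (fun _ _ => Q) :=
      .const ⟨‖Q‖, fun _ => le_rfl⟩
    have hJ : JetBdd (fun _ : ι => (0 : Fin (2 * (l - 1)) → ℝ)) n (fun _ _ => J) :=
      .const ⟨‖J‖, fun _ => le_rfl⟩
    refine (hQ.sub (hJ.clm_comp ((hinv.clm (ContinuousLinearMap.mul ℝ ℂ)).clm_comp
      (hS.clm_comp hQ)))).congr fun j => ?_
    filter_upwards [(hF j).fderiv_eq hs hκ (hne j)] with y hy
    ext1 v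
    rw [hy v]
    rfl

theorem smoothBdd_graphMetric (hs : IsSplitting i π Q) (hκ : 0 < κ) {ι : Type}
    {P : ι → ModelPoint Δ Z κ C} {F : ι → (Fin (2 * (l - 1)) → ℝ) → Fin l → ℂ}
    (hF : ∀ j, IsGraphOf π (P j) (F j)) {c : ℝ} (hc : 0 < c)
    (hlow : ∀ j, c ≤ ‖fderiv ℂ (P j).sig 0 (Pi.single i 1)‖) (u v : Fin (2 * (l - 1)) → ℝ) :
    SmoothBdd (fun _ => 0) (fun j y => graphMetric (P j).pot (F j) y u v) := by
  have hzero : ∀ j, F j 0 = 0 := fun j => (hF j).zero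
  have hFb := smoothBdd_graph hs hκ hF hc hlow
  have hH : SmoothBdd (fun _ : ι => (0 : Fin (2 * (l - 1)) → ℝ))
      (fun j y => fderiv ℝ (fderiv ℝ (P j).pot) (F j y)) := by
    refine SmoothBdd.comp (f := fun j => fderiv ℝ (fderiv ℝ (P j).pot)) ?_ hFb
    simpa only [hzero] using (ModelPoint.smoothBdd_fderiv_pot hκ).fderiv.reindex P
  have hd := fun v => hFb.fderiv.apply_const v
  have hI := fun v => (hd v).clm (Complex.I • ContinuousLinearMap.id ℝ (Fin l → ℂ))
  exact (((hH.clm_apply (hd u)).clm_apply (hd v)).add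
    ((hH.clm_apply (hI u)).clm_apply (hI v))).mul
      (.const (c := fun _ => (4 * Real.pi)⁻¹) ⟨_, fun _ => le_rfl⟩)

theorem graphMetric_coercive (Δ : Finset (Fin l → ℤ)) (Z : Finset (Finset (Fin l → ℤ))) (C : ℝ)
    (π : (Fin l → ℂ) →L[ℝ] (Fin (2 * (l - 1)) → ℝ)) (hκ : 2 * ((l : ℝ) + 1) ≤ κ) :
    ∃ c : ℝ, 0 < c ∧ ∀ (P : ModelPoint Δ Z κ C) F, IsGraphOf π P F → ∀ u,
      c * ‖u‖ ^ 2 ≤ graphMetric P.pot F 0 u u := by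
  obtain ⟨c, hc, hcoer⟩ := ModelPoint.exists_coercive Δ Z C hκ
  refine ⟨c / ((‖π‖ + 1) ^ 2 * (4 * Real.pi)), by positivity, fun P F hF u => ?_⟩
  -- Since `π ∘ F` is the identity near `0`, `DF` cannot shrink vectors by more than `‖π‖`; the `+
  -- 1` keeps the constant positive.
  have h1 : ‖u‖ ≤ (‖π‖ + 1) * ‖fderiv ℝ F 0 u‖ := by
    conv_lhs => rw [← hF.proj_fderiv.self_of_nhds u]
    refine (π.le_opNorm _).trans ?_
    gcongr
    linarith
  have h2 := hcoer P (fderiv ℝ F 0 u)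
  have h3 : ‖u‖ ^ 2 ≤ (‖π‖ + 1) ^ 2 * ‖fderiv ℝ F 0 u‖ ^ 2 := by
    rw [← mul_pow]; gcongr
  rw [graphMetric, hF.zero, div_mul_eq_mul_div, div_le_div_iff₀ (by positivity) (by positivity)]
  calc c * ‖u‖ ^ 2 * (4 * Real.pi)
      ≤ c * ((‖π‖ + 1) ^ 2 * ‖fderiv ℝ F 0 u‖ ^ 2) * (4 * Real.pi) := by gcongr
    _ = c * ‖fderiv ℝ F 0 u‖ ^ 2 * ((‖π‖ + 1) ^ 2 * (4 * Real.pi)) := by ring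
    _ ≤ _ := by gcongr

end family

end ToricDegeneration

end

noncomputable section

namespace ToricDegeneration

open Filter Topology ChartGeometry

variable {l : ℕ} {Δ : Finset (Fin l → ℤ)} {w : (Fin l → ℤ) → ℝ} {κ C : ℝ} {τ : ℂ}
  {U : Set (Fin (2 * (l - 1)) → ℝ)} {ψ : (Fin (2 * (l - 1)) → ℝ) → Fin l → ℂ}

/-! ### Local parametrizations and graphs -/

theorem isBilin_lev (Φ : (Fin l → ℂ) → ℝ) (z : Fin l → ℂ) {n : ℕ}
    (L : (Fin n → ℝ) →L[ℝ] (Fin l → ℂ)) (c : ℝ) : IsBilin fun u v => lev Φ z (L u) (L v) / c := by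
  refine .mk' (fun u u' v => ?_) (fun r u v => ?_) (fun u v v' => ?_) (fun r u v => ?_)
  · rw [map_add, lev_add_left, add_div]
  · rw [map_smul, lev_smul_left, smul_eq_mul, mul_div_assoc]
  · rw [map_add, lev_add_right, add_div]
  · rw [map_smul, lev_smul_right, smul_eq_mul, mul_div_assoc]

theorem IsLocalParam.contDiffAt {Y : Set (Fin l → ℂ)} (hψ : IsLocalParam Y U ψ)
    {x : Fin (2 * (l - 1)) → ℝ} (hx : x ∈ U) : ContDiffAt ℝ ∞ ψ x :=
  hψ.smooth.contDiffAt (hψ.isOpen.mem_nhds hx)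

theorem chartMetric_eq (x u v : Fin (2 * (l - 1)) → ℝ) :
    chartMetric Δ w κ τ ψ x u v = graphMetric (potential Δ w κ τ) ψ x u v := by
  rw [chartMetric, metric_eq_lev, graphMetric]

theorem isSmoothMetricOn_chartMetric (hψ : IsLocalParam (X Δ w τ) U ψ)
    (hpot : ∀ z : Fin l → ℂ, (∀ k, z k ≠ 0) → ContDiffAt ℝ ∞ (potential Δ w κ τ) z)
    (hpos : ∀ z : Fin l → ℂ, (∀ k, z k ≠ 0) → ∀ v, v ≠ 0 → 0 < metric Δ w κ τ z v v) :
    IsSmoothMetricOn (chartMetric Δ w κ τ ψ) U := by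
  have hp : ∀ x ∈ U, ContDiffAt ℝ ∞ (potential Δ w κ τ) (ψ x) := fun x hx =>
    hpot _ (hψ.mapsTo hx).1
  refine ⟨hψ.isOpen, fun x _ => ?_, fun x hx u v => ?_, fun x hx u hu => ?_, fun x hx u v => ?_⟩
  · rw [funext₂ (chartMetric_eq (Δ := Δ) (w := w) (κ := κ) (τ := τ) (ψ := ψ) x)]
    exact isBilin_lev _ _ _ _
  · rw [chartMetric_eq, chartMetric_eq, graphMetric, lev_symm (hp x hx), graphMetric]
  · refine hpos _ (hψ.mapsTo hx).1 _ fun h0 => hu (hψ.immersion x hx ?_)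
    rw [h0, map_zero]
  · simp only [chartMetric_eq, graphMetric]
    have h1 := (hψ.contDiffAt hx).fderiv_smooth
    exact (contDiffAt_lev (hp x hx) (hψ.contDiffAt hx) (h1.clm_apply contDiffAt_const)
      (h1.clm_apply contDiffAt_const)).div_const _

theorem continuous_fderiv_sig {Z : Finset (Finset (Fin l → ℤ))} (P : ModelPoint Δ Z κ C)
    (v : Fin l → ℂ) : Continuous fun y => fderiv ℂ P.sig y v := by
  have h : (fun y => fderiv ℂ P.sig y v) = fun y => ∑ m ∈ Δ, P.u m y * linForm (P.rho m) v := by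
    funext y
    rw [(P.hasFDerivAt_sig y).fderiv]
    simp
  rw [h]
  unfold ModelPoint.u
  fun_prop

/-- Near each of its points a local parametrization can be replaced by a graph. -/
theorem exists_graph {x₀ : Fin (2 * (l - 1)) → ℝ}
    {P : ModelPoint Δ (topSimplices Δ w) κ C} {A : (Fin l → ℂ) ≃L[ℂ] (Fin l → ℂ)} {i : Fin l}
    {π : (Fin l → ℂ) →L[ℝ] (Fin (2 * (l - 1)) → ℝ)}
    {Q : (Fin (2 * (l - 1)) → ℝ) →L[ℝ] (Fin l → ℂ)} (hκ : 0 < κ)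
    (hψ : IsLocalParam (X Δ w τ) U ψ) (hx₀ : x₀ ∈ U)
    (hpot : ∀ z : Fin l → ℂ, (∀ k, z k ≠ 0) → ContDiffAt ℝ ∞ (potential Δ w κ τ) z)
    (hmet : IsSmoothMetricOn (chartMetric Δ w κ τ ψ) U)
    (h : IsModelOf τ (ψ x₀) P A) (hs : IsSplitting i π Q)
    (h0 : fderiv ℂ P.sig 0 (Pi.single i 1) ≠ 0) :
    ∃ (φ : (Fin (2 * (l - 1)) → ℝ) → Fin (2 * (l - 1)) → ℝ) (V : Set (Fin (2 * (l - 1)) → ℝ))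
      (F : (Fin (2 * (l - 1)) → ℝ) → Fin l → ℂ), IsGraphOf π P F ∧ 0 ∈ V ∧ φ 0 = x₀ ∧
      IsLocalIsometry φ (graphMetric P.pot F) V (chartMetric Δ w κ τ ψ) U := by
  set z := ψ x₀ with hz
  set f : (Fin (2 * (l - 1)) → ℝ) → Fin l → ℂ := fun x => chartInv z A (ψ x) with hf
  have hchart : ∀ x ∈ U, chart z A (f x) = ψ x := fun x hx =>
    chart_chartInv h.ne_zero A (hψ.mapsTo hx).1
  have hsig : ∀ x ∈ U, P.sig (f x) = 0 := fun x hx => by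
    rw [← h.chart_mem_X, hchart x hx]; exact hψ.mapsTo hx
  have hf₀ : f x₀ = 0 := chartInv_self h.ne_zero A
  -- the domain on which `f` is smooth and transversal to the `i`-th axis
  obtain ⟨W, hWo, hx₀W, hWU, hWf, hWne⟩ : ∃ W : Set (Fin (2 * (l - 1)) → ℝ), IsOpen W ∧ x₀ ∈ W ∧
      W ⊆ U ∧ (∀ x ∈ W, ContDiffAt ℝ ∞ f x) ∧
      ∀ x ∈ W, fderiv ℂ P.sig (f x) (Pi.single i 1) ≠ 0 := by
    have hcont : ContinuousOn (fun x k => ψ x k / z k) U := by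
      refine continuousOn_pi.2 fun k => ContinuousOn.div_const ?_ _
      exact (continuous_apply k).comp_continuousOn hψ.smooth.continuousOn
    set W₀ := U ∩ (fun x k => ψ x k / z k) ⁻¹' (Set.univ.pi fun _ => Complex.slitPlane) with hW₀
    have hW₀o : IsOpen W₀ := hcont.isOpen_inter_preimage hψ.isOpen
      (isOpen_set_pi Set.finite_univ fun _ _ => Complex.isOpen_slitPlane)
    have hfW : ∀ x ∈ W₀, ContDiffAt ℝ ∞ f x := fun x hx =>
      ((chartInv_contDiffAt z A fun k => hx.2 k (Set.mem_univ k)).restrict_scalars ℝ).comp x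
        (hψ.contDiffAt hx.1)
    have hcont' : ContinuousOn (fun x => fderiv ℂ P.sig (f x) (Pi.single i 1)) W₀ :=
      (continuous_fderiv_sig P _).comp_continuousOn fun x hx =>
        (hfW x hx).continuousAt.continuousWithinAt
    refine ⟨W₀ ∩ (fun x => fderiv ℂ P.sig (f x) (Pi.single i 1)) ⁻¹' {0}ᶜ,
      hcont'.isOpen_inter_preimage hW₀o isOpen_compl_singleton, ⟨⟨hx₀, fun k _ => ?_⟩, ?_⟩,
      fun x hx => hx.1.1, fun x hx => hfW x hx.1, fun x hx => hx.2⟩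
    · simp only [← hz, div_self (h.ne_zero k)]
      exact Complex.one_mem_slitPlane
    · simp only [Set.mem_preimage, hf₀]
      exact h0
  have hfd : ∀ x ∈ W, HasFDerivAt f (fderiv ℝ f x) x := fun x hx =>
    ((hWf x hx).differentiableAt (by simp)).hasFDerivAt
  have hψf : ∀ x ∈ W, ∀ v, fderiv ℝ ψ x v = fderiv ℂ (chart z A) (f x) (fderiv ℝ f x v) := by
    intro x hx v
    have h1 : HasFDerivAt (chart z A) ((fderiv ℂ (chart z A) (f x)).restrictScalars ℝ) (f x) :=
      (((chart_contDiff z A).differentiable (by simp)).differentiableAt.hasFDerivAt).restrictScalars ℝ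
    have h2 : (fun x => chart z A (f x)) =ᶠ[𝓝 x] ψ := by
      filter_upwards [hψ.isOpen.mem_nhds (hWU hx)] with y hy using hchart y hy
    rw [((h1.comp x (hfd x hx)).congr_of_eventuallyEq h2.symm).fderiv]
    rfl
  have hsigd : ∀ x ∈ W, ∀ v, fderiv ℂ P.sig (f x) (fderiv ℝ f x v) = 0 := by
    intro x hx v
    have h2 : (fun x => P.sig (f x)) =ᶠ[𝓝 x] fun _ => 0 := by
      filter_upwards [hψ.isOpen.mem_nhds (hWU hx)] with y hy using hsig y hy
    exact congrArg (fun L => L v) ((((hasFDerivAt_real_sig P (f x)).comp x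
      (hfd x hx)).congr_of_eventuallyEq h2.symm).unique (hasFDerivAt_const 0 x))
  -- A tangent vector killed by `π` lies on the `i`-th axis. It is also killed by the derivative of
  -- `sig`, which is nonzero along that axis, so it vanishes.
  have hHinj : ∀ x ∈ W, Function.Injective (π.comp (fderiv ℝ f x)) := by
    intro x hx
    refine (injective_iff_map_eq_zero _).2 fun v hv => ?_
    have h1 := hs (fderiv ℝ f x v)
    have h2 : π (fderiv ℝ f x v) = 0 := hv
    rw [h2, map_zero, zero_add] at h1
    have h3 := hsigd x hx v
    rw [h1, map_smul, smul_eq_mul] at h3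
    rw [(mul_eq_zero.1 h3).resolve_right (hWne x hx), zero_smul] at h1
    refine hψ.immersion x (hWU hx) ?_
    rw [hψf x hx, h1, map_zero, map_zero]
  -- By the inverse function theorem `H` is a local diffeomorphism. Its local inverse is the
  -- isometry `φ`, and `f ∘ φ` is the graph.
  set H : (Fin (2 * (l - 1)) → ℝ) → Fin (2 * (l - 1)) → ℝ := fun x => π (f x) with hH
  have hHs : ∀ x ∈ W, ContDiffAt ℝ ∞ H x := fun x hx => π.contDiff.contDiffAt.comp x (hWf x hx)
  have hHd : ∀ x ∈ W, ∃ D : (Fin (2 * (l - 1)) → ℝ) ≃L[ℝ] (Fin (2 * (l - 1)) → ℝ),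
      HasFDerivAt H (D : (Fin (2 * (l - 1)) → ℝ) →L[ℝ] (Fin (2 * (l - 1)) → ℝ)) x := by
    intro x hx
    refine ⟨(LinearEquiv.ofInjectiveEndo (π.comp (fderiv ℝ f x)).toLinearMap
      (hHinj x hx)).toContinuousLinearEquiv, ?_⟩
    exact π.hasFDerivAt.comp x (hfd x hx)
  obtain ⟨D₀, hD₀⟩ := hHd x₀ hx₀W
  let e := (hHs x₀ hx₀W).toOpenPartialHomeomorph H hD₀ (by simp)
  have hee : ∀ x, e x = H x := fun x => rfl
  have hx₀e : x₀ ∈ e.source := (hHs x₀ hx₀W).mem_toOpenPartialHomeomorph_source hD₀ (by simp)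
  have hex₀ : e x₀ = 0 := by rw [hee, hH]; simp only [hf₀, map_zero]
  set V : Set (Fin (2 * (l - 1)) → ℝ) := e.target ∩ e.symm ⁻¹' W with hV
  have hVo : IsOpen V := e.isOpen_inter_preimage_symm hWo
  have hsymm0 : e.symm 0 = x₀ := by rw [← hex₀]; exact e.left_inv hx₀e
  have h0V : (0 : Fin (2 * (l - 1)) → ℝ) ∈ V := by
    refine ⟨hex₀ ▸ e.map_source hx₀e, ?_⟩
    rw [Set.mem_preimage, hsymm0]
    exact hx₀W
  have hφs : ∀ y ∈ V, ContDiffAt ℝ ∞ e.symm y := by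
    intro y hy
    obtain ⟨D, hD⟩ := hHd _ hy.2
    exact e.contDiffAt_symm hy.1 hD (hHs _ hy.2)
  have hφd : ∀ y ∈ V, HasFDerivAt e.symm (fderiv ℝ e.symm y) y := fun y hy =>
    ((hφs y hy).differentiableAt (by simp)).hasFDerivAt
  have hHφ : ∀ y ∈ V, H (e.symm y) = y := fun y hy => e.right_inv hy.1
  set F : (Fin (2 * (l - 1)) → ℝ) → Fin l → ℂ := fun y => f (e.symm y) with hF
  have hFs : ∀ y ∈ V, ContDiffAt ℝ ∞ F y := fun y hy => (hWf _ hy.2).comp y (hφs y hy)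
  have hFd : ∀ y ∈ V, ∀ u, fderiv ℝ F y u = fderiv ℝ f (e.symm y) (fderiv ℝ e.symm y u) := by
    intro y hy u
    have h1 : HasFDerivAt F _ y := (hfd _ hy.2).comp y (hφd y hy)
    rw [h1.fderiv]
    rfl
  have hφinj : ∀ y ∈ V, ∀ u, fderiv ℝ e.symm y u = 0 → u = 0 := by
    intro y hy u hu
    have h2 : (fun y => H (e.symm y)) =ᶠ[𝓝 y] id := by
      filter_upwards [hVo.mem_nhds hy] with y' hy' using hHφ y' hy'
    obtain ⟨D, hD⟩ := hHd _ hy.2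
    have h3 := congrArg (fun L => L u)
      (((hD.comp y (hφd y hy)).congr_of_eventuallyEq h2.symm).unique (hasFDerivAt_id y))
    have h4 : D (fderiv ℝ e.symm y u) = u := h3
    rw [← h4, hu, map_zero]
  have hpull : ∀ y ∈ V, ∀ u v, graphMetric P.pot F y u v =
      chartMetric Δ w κ τ ψ (e.symm y) (fderiv ℝ e.symm y u) (fderiv ℝ e.symm y v) := by
    intro y hy u v
    have hyU := hWU hy.2
    have h1 : ContDiffAt ℝ ∞ (potential Δ w κ τ) (chart z A (F y)) := by
      rw [hF, hchart _ hyU]; exact hpot _ (hψ.mapsTo hyU).1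
    rw [graphMetric, ← h.metric_chart hκ h1, chartMetric, hψf _ hy.2, hψf _ hy.2, hFd y hy,
      hFd y hy, hF, hchart _ hyU]
  refine ⟨e.symm, V, F, ⟨hFs 0 h0V, ?_, ?_, ?_⟩, h0V, hsymm0, ⟨hVo, ?_, ?_, ?_, ?_⟩, hmet,
    fun y hy => hWU hy.2, hφs, hpull⟩
  · rw [hF]; simp only [hsymm0, hf₀]
  · filter_upwards [hVo.mem_nhds h0V] with y hy using hHφ y hy
  · filter_upwards [hVo.mem_nhds h0V] with y hy using hsig _ (hWU hy.2)
  · exact fun y _ => isBilin_lev _ _ _ _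
  · intro y _ u v
    rw [graphMetric, lev_symm (P.contDiff_pot hκ).contDiffAt, graphMetric]
  · intro y hy u hu
    rw [hpull y hy]
    exact hmet.pos _ (hWU hy.2) _ fun h' => hu (hφinj y hy u h')
  · intro y hy u v
    have h1 := (hFs y hy).fderiv_smooth
    exact (contDiffAt_lev (P.contDiff_pot hκ).contDiffAt (hFs y hy)
      (h1.clm_apply contDiffAt_const) (h1.clm_apply contDiffAt_const)).div_const _

/-- The covariant derivatives of the curvature of graphs with a bounded slope are bounded. -/
theorem exists_normLE_graph (Δ : Finset (Fin l → ℤ)) (Z : Finset (Finset (Fin l → ℤ))) (C : ℝ)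
    (hκ : 2 * ((l : ℝ) + 1) ≤ κ) {i : Fin l} {π : (Fin l → ℂ) →L[ℝ] (Fin (2 * (l - 1)) → ℝ)}
    {Q : (Fin (2 * (l - 1)) → ℝ) →L[ℝ] (Fin l → ℂ)} (hs : IsSplitting i π Q) {c : ℝ} (hc : 0 < c)
    (k : ℕ) : ∃ B : ℝ, ∀ (P : ModelPoint Δ Z κ C) F V, IsGraphOf π P F →
      c ≤ ‖fderiv ℂ P.sig 0 (Pi.single i 1)‖ → IsSmoothMetricOn (graphMetric P.pot F) V →
      0 ∈ V → NormLE (graphMetric P.pot F 0) (covDerivRiemann (graphMetric P.pot F) k 0) B := by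
  have hκ0 : 0 < κ := by have : (0 : ℝ) ≤ l := l.cast_nonneg; linarith
  -- All admissible model points, graphs and domains form one index type, so boundedness of the
  -- family yields a single constant valid for all of them.
  let ι : Type := {q : ModelPoint Δ Z κ C × ((Fin (2 * (l - 1)) → ℝ) → Fin l → ℂ) ×
    Set (Fin (2 * (l - 1)) → ℝ) // IsGraphOf π q.1 q.2.1 ∧
      c ≤ ‖fderiv ℂ q.1.sig 0 (Pi.single i 1)‖ ∧
      IsSmoothMetricOn (graphMetric q.1.pot q.2.1) q.2.2 ∧ 0 ∈ q.2.2}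
  have hfam : IsBoundedFamily (ι := ι) (fun _ => 0) (fun q => graphMetric q.1.1.pot q.1.2.1)
      (fun q => q.1.2.2) := by
    refine ⟨fun q => q.2.2.2.1, fun q => q.2.2.2.2, fun u v => ?_, ?_⟩
    · exact smoothBdd_graphMetric hs hκ0 (P := fun q : ι => q.1.1) (fun q => q.2.1) hc
        (fun q => q.2.2.1) u v
    · obtain ⟨b, hb, hcoer⟩ := graphMetric_coercive Δ Z C π hκ
      exact ⟨b, hb, fun q u => hcoer q.1.1 q.1.2.1 q.2.1 u⟩
  obtain ⟨B, hB⟩ := hfam.exists_normLE k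
  exact ⟨B, fun P F V h1 h2 h3 h4 => hB ⟨(P, F, V), h1, h2, h3, h4⟩⟩

theorem normLE_mono {n r : ℕ} {g : (Fin n → ℝ) → (Fin n → ℝ) → ℝ}
    {T : (Fin r → Fin n → ℝ) → ℝ} {B B' : ℝ} (h : NormLE g T B) (hB : B ≤ B') : NormLE g T B' :=
  fun v => (h v).trans (mul_le_mul_of_nonneg_right hB
    (Finset.prod_nonneg fun _ _ => Real.sqrt_nonneg _))

end ToricDegeneration

end

/-! ### Choice of the constants and conclusion -/

open ToricDegeneration ChartGeometry

theorem proposition5p3 {l : ℕ} (Δ : Finset (Fin l → ℤ)) (w : (Fin l → ℤ) → ℝ)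
    (hΔ : ToricDegeneration.IsLatticePolytope Δ)
    (hw : ToricDegeneration.IsConvexSimplicial Δ w) :
    ∃ κ₀ : ℝ, 0 < κ₀ ∧ ∀ κ : ℝ, κ₀ ≤ κ → ∃ δ : ℝ, 0 < δ ∧
      (∀ t τ : ℂ, Complex.exp τ = t → ‖t‖ < δ →
        ToricDegeneration.SmoothHypersurface Δ w τ ∧ ToricDegeneration.MetricPosDef Δ w κ τ) ∧
      ∀ k : ℕ, ∃ C : ℝ, ∀ t τ : ℂ, Complex.exp τ = t → ‖t‖ < δ →
        ToricDegeneration.CurvatureBound Δ w κ τ k C := by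
  -- The threshold is the one at which `secondDeriv_pot` absorbs the negative terms.
  refine ⟨2 * ((l : ℝ) + 1), by positivity, fun κ hκ => ?_⟩
  have hκ1 : 1 ≤ κ := by have : (0 : ℝ) ≤ l := l.cast_nonneg; linarith
  have hκ0 : 0 < κ := by linarith
  obtain ⟨C, ε, hε, hmodel⟩ := exists_model hΔ hw hκ0
  obtain ⟨R, c, hc, hlow⟩ := ModelPoint.exists_deriv_lower Δ (topSimplices Δ w) C hκ1
  -- `|t| < δ` says that `-log |t|` exceeds `|R| / (2ε)`
  have hsmall : ∀ t τ : ℂ, Complex.exp τ = t → ‖t‖ < Real.exp (-(|R| / (2 * ε))) →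
      τ.re < 0 ∧ R ≤ ε * (-2 * τ.re) := by
    rintro t τ rfl ht
    rw [Complex.norm_exp, Real.exp_lt_exp] at ht
    have h1 : 0 ≤ |R| / (2 * ε) := by positivity
    refine ⟨by linarith, (le_abs_self R).trans ?_⟩
    have h2 : |R| / (2 * ε) < -τ.re := by linarith
    rw [div_lt_iff₀ (by positivity)] at h2
    linarith
  have hpt : ∀ τ : ℂ, τ.re < 0 → R ≤ ε * (-2 * τ.re) → ∀ z ∈ X Δ w τ,
      ∃ (P : ModelPoint Δ (topSimplices Δ w) κ C) (A : (Fin l → ℂ) ≃L[ℂ] (Fin l → ℂ)),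
        IsModelOf τ z P A ∧ P.sig 0 = 0 ∧
          ∃ i, c ≤ ‖fderiv ℂ P.sig 0 (Pi.single i 1)‖ := by
    intro τ hτ hR z hz
    obtain ⟨P, A, hPA, hfar⟩ := hmodel τ z hτ hz.1
    have h0 : P.sig 0 = 0 := by rw [← hPA.chart_mem_X, chart_zero]; exact hz
    exact ⟨P, A, hPA, h0, hlow P h0 fun m hm hmS => hR.trans (hfar m hm hmS)⟩
  have hpos : ∀ τ : ℂ, τ.re < 0 → ∀ z : Fin l → ℂ, (∀ k, z k ≠ 0) → ∀ v, v ≠ 0 →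
      0 < metric Δ w κ τ z v v := by
    intro τ hτ z hz v hv
    obtain ⟨P, A, hPA, -⟩ := hmodel τ z hτ hz
    exact hPA.metric_pos hκ hv
  have hpot : ∀ τ : ℂ, τ.re < 0 → ∀ z : Fin l → ℂ, (∀ k, z k ≠ 0) →
      ContDiffAt ℝ ∞ (potential Δ w κ τ) z := by
    intro τ hτ z hz
    obtain ⟨P, A, hPA, -⟩ := hmodel τ z hτ hz
    exact hPA.potential_contDiffAt hκ0
  refine ⟨Real.exp (-(|R| / (2 * ε))), Real.exp_pos _, fun t τ htτ ht => ?_, fun k => ?_⟩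
  · obtain ⟨hτ, hR⟩ := hsmall t τ htτ ht
    refine ⟨fun z hz => ?_, fun z hz v _ hv => hpos τ hτ z hz.1 v hv⟩
    obtain ⟨P, A, hPA, h0, i, hi⟩ := hpt τ hτ hR z hz
    refine hPA.fderiv_section_ne_zero h0 fun h1 => ?_
    rw [h1, zero_apply, norm_zero] at hi
    linarith
  · choose π Q hs using fun i : Fin l => exists_splitting i
    choose B hB using fun i : Fin l =>
      exists_normLE_graph Δ (topSimplices Δ w) C hκ (hs i) hc k
    -- The coordinate that is solved for depends on the point, so the constant must dominate the
    -- bounds for all `l` splittings.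
    refine ⟨∑ i, |B i|, fun t τ htτ ht U ψ hψ x hx => ?_⟩
    obtain ⟨hτ, hR⟩ := hsmall t τ htτ ht
    obtain ⟨P, A, hPA, -, i, hi⟩ := hpt τ hτ hR (ψ x) (hψ.mapsTo hx)
    obtain ⟨φ, V, F, hF, h0V, hφ, hiso⟩ := exists_graph hκ0 hψ hx (hpot τ hτ)
      (isSmoothMetricOn_chartMetric hψ (hpot τ hτ) (hpos τ hτ)) hPA (hs i)
      (norm_pos_iff.1 (hc.trans_le hi))
    have h1 := hiso.normLE k h0V (hB i P F V hF hi hiso.source h0V)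
    rw [hφ] at h1
    exact normLE_mono h1 ((le_abs_self _).trans
      (Finset.single_le_sum (f := fun i => |B i|) (fun _ _ => abs_nonneg _) (Finset.mem_univ i)))
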